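/- Let $n\ge 1$, $0\le d\le n-1$, $\rho>0$. Let $V_1,V_2\in C^\infty(\mathbb R^n;\mathbb R)$ satisfy $|\partial^\alpha V_j(x)|\le C_\alpha(1+|x|^2)^{(-\rho-|\alpha|)/2}$ for all $\alpha\in\mathbb N^n$, with $V_2\ge 0$. Let $p(x,\xi)=|\xi|^2+V_1(x)$ and let $\phi^t=(\bar x(t,\cdot),\bar\xi(t,\cdot))$ be its Hamiltonian flow on $\mathbb R^{2n}$: $\partial_t\bar x=2\bar\xi$, $\partial_t\bar\xi=-\nabla V_1(\bar x)$, $\phi^0=\mathrm{Id}$. Let $E_h\in\mathbb C$ ($h\in(0,1]$) satisfy $\operatorname{Im}E_h\ge0$ and $E_h=E_0+hE_1+o(h)$ as $h\to0$, with $E_0>0$ and $E_1\in\mathbb C$. Assume that for every $w$ with $p(w)=E_0$ the trajectory $\{\phi^t(w):t\in\mathbb R\}$ is unbounded in $\mathbb R^{2n}$ or $V_2(\bar x(t,w))>0$ for some $t\in\mathbb R$. Let $\Gamma_2\subset\mathbb R^n$ be a bounded $d$-dimensional (embedded, smooth) submanifold, let $A:\Gamma_2\to\mathbb C$ be smooth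 with compact support, let $S$ be a (complex-valued) Schwartz function on $\mathbb R^n$, and let $\Gamma$ be open in $\Gamma_2$ with $\operatorname{supp}A\subset\Gamma$ and $\overline\Gamma\subset\Gamma_2$ (closures in $\mathbb R^n$). Assume $V_1<E_0$ on $\overline\Gamma$. Let $$N_E\Gamma=\{(z,\xi)\in\Gamma\times\mathbb R^n:\ \xi\perp T_z\Gamma,\ |\xi|=\sqrt{E_0-V_1(z)}\},$$ an $(n-1)$-dimensional submanifold of $\mathbb R^{2n}$, and let $\tilde\sigma$ be the canonical measure on $N_E\Gamma$ of the Riemannian metric $g_{(z,\xi)}((Z^1,\Xi^1),(Z^2,\Xi^2))=\langle Z^1,Z^2\rangle+\langle\Xi^1_\perp,\Xi^2_\perp\rangle$, where $\Xi_\perp$ is the orthogonal projection of $\Xi$ on $(T_z\Gamma\oplus\mathbb R\xi)^\perp$; that is, $\tilde\sigma$ is $\det(g_{\psi(u)}(\partial_i\psi(u),\partial_j\psi(u)))^{1/2}\,du$ in any local parametrization $\psi$ of $N_E\Gamma$. Extend $\tilde\sigma$ by $0$ to $\mathbb R^{2n}$. Assume that the set of $(z,\xi)\in N_E\Gamma$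 such that $\phi^t(z,\xi)\in N_E\Gamma$ for some $t>0$ is $\tilde\sigma$-null. With $\hat S(\xi)=\int e^{-i\langle x,\xi\rangle}S(x)\,dx$, put $$c(z,\xi)=\pi(2\pi)^{d-n}\,|A(z)|^2\,|\xi|^{-1}\,|\hat S(\xi)|^2 .$$ Let $\nu$ be a (nonnegative) Radon measure on $\mathbb R^{2n}$ such that (i) $\operatorname{supp}\nu\subset p^{-1}(\{E_0\})$; (ii) for every $\sigma\in(0,1)$ there is $R\ge0$ such that $\int q\,d\nu=0$ for all $q\in C_0^\infty(\mathbb R^{2n})$ supported in the incoming region $\{(x,\xi):|x|\ge R,\ \langle x,\xi\rangle<-\sigma|x||\xi|\}$; (iii) for every $q\in C_0^\infty(\mathbb R^{2n})$, $\displaystyle\int_{\mathbb R^{2n}}(-H_p+2\operatorname{Im}E_1+2V_2)q\,d\nu=\int_{N_E\Gamma}c\,q\,d\tilde\sigma$, where $H_p=2\xi\cdot\partial_x-\nabla V_1(x)\cdot\partial_\xi$. Then for every $q\in C_0^\infty(\mathbb R^{2n})$ $$\int_{\mathbb R^{2n}}q\,d\nu=\int_0^{+\infty}\int_{N_E\Gamma}c(z,\xi)\,q(\phi^t(z,\xi))\,e^{-2t\operatorname{Im}E_1-2\int_0^tV_2(\bar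 x(s,z,\xi))\,ds}\,d\tilde\sigma(z,\xi)\,dt,$$ where for each $t\ge 0$ the inner integrand is $\tilde\sigma$-integrable, and the inner integral is an integrable function of $t\in(0,\infty)$. In particular, at most one Radon measure $\nu$ has the properties (i)-(iii). -/

import Mathlib

open MeasureTheory Set Filter Topology Asymptotics
open scoped ContDiff InnerProductSpace SchwartzMap

/-- The configuration space `ℝⁿ`. -/
abbrev Config (n : ℕ) : Type := EuclideanSpace ℝ (Fin n)

/-- The phase space `ℝ²ⁿ = T*ℝⁿ`, with points `(x, ξ)`. -/
abbrev Phase (n : ℕ) : Type := Config n × Config n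

/-! ### Potentials, Hamiltonian and classical flow -/

/-- `V` is smooth and `|∂^α V(x)| ≤ C_α ⟨x⟩^(-ρ-|α|)` for every multi-index `α`
(the derivatives of order `k` are bounded together, through the `k`-th total derivative). -/
def SymbolDecay {n : ℕ} (ρ : ℝ) (V : Config n → ℝ) : Prop :=
  ContDiff ℝ ∞ V ∧
    ∀ k : ℕ, ∃ C : ℝ, ∀ x : Config n,
      ‖iteratedFDeriv ℝ k V x‖ ≤ C * Real.sqrt (1 + ‖x‖ ^ 2) ^ (-ρ - (k : ℝ))

/-- The symbol `p(x, ξ) = |ξ|² + V₁(x)`. -/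
noncomputable def hamSymbol {n : ℕ} (V₁ : Config n → ℝ) (w : Phase n) : ℝ :=
  ‖w.2‖ ^ 2 + V₁ w.1

/-- The Hamiltonian vector field `(x, ξ) ↦ (2ξ, -∇V₁(x))` of `p`. -/
noncomputable def hamField {n : ℕ} (V₁ : Config n → ℝ) (w : Phase n) : Phase n :=
  ((2 : ℝ) • w.2, -gradient V₁ w.1)

/-- `γ` solves `x' = 2ξ`, `ξ' = -∇V₁(x)` for all times. -/
def IsTrajectory {n : ℕ} (V₁ : Config n → ℝ) (γ : ℝ → Phase n) : Prop :=
  ∀ t : ℝ, HasDerivAt γ (hamField V₁ (γ t)) t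

open Classical in
/-- The Hamiltonian flow `φᵗ(w)`: the value at time `t` of the trajectory that starts at `w`.
For potentials with `SymbolDecay` the field is globally Lipschitz, so this trajectory exists for
all times and is unique, and the second branch is never used. -/
noncomputable def hamFlow {n : ℕ} (V₁ : Config n → ℝ) (t : ℝ) (w : Phase n) : Phase n :=
  if h : ∃ γ : ℝ → Phase n, IsTrajectory V₁ γ ∧ γ 0 = w then h.choose t else w

/-- Every trajectory of energy `E₀` is unbounded in phase space or meets the
absorption region `{V₂ > 0}`. -/
def TrappedMeetsAbsorption {n : ℕ} (V₁ V₂ : Config n → ℝ) (E₀ : ℝ) : Prop :=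
  ∀ w : Phase n, hamSymbol V₁ w = E₀ →
    ¬ Bornology.IsBounded (range fun t : ℝ => hamFlow V₁ t w) ∨
      ∃ t : ℝ, 0 < V₂ (hamFlow V₁ t w).1

/-! ### Submanifolds -/

/-- `ψ`, restricted to the open set `W ⊆ ℝᵏ`, is a smooth local parametrization of `M`: an
injective immersion with values in `M` which is a homeomorphism onto a relatively open
subset of `M`. -/
structure IsLocalParam {F : Type*} [NormedAddCommGroup F] [NormedSpace ℝ F] (k : ℕ)
    (M : Set F) (W : Set (EuclideanSpace ℝ (Fin k))) (ψ : EuclideanSpace ℝ (Fin k) → F) :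
    Prop where
  isOpen_source : IsOpen W
  smooth : ContDiffOn ℝ ∞ ψ W
  immersive : ∀ u ∈ W, Function.Injective (fderiv ℝ ψ u)
  injOn : InjOn ψ W
  mapsTo : MapsTo ψ W M
  isOpen_image : ∀ W' ⊆ W, IsOpen W' → ∃ O : Set F, IsOpen O ∧ ψ '' W' = M ∩ O

/-- `M` is a smooth (embedded) `k`-dimensional submanifold of `F`. -/
def IsSubmanifold {F : Type*} [NormedAddCommGroup F] [NormedSpace ℝ F] (k : ℕ) (M : Set F) :
    Prop :=
  ∀ z ∈ M, ∃ W ψ, IsLocalParam k M W ψ ∧ z ∈ ψ '' W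

/-- `A` is a smooth function on the `k`-dimensional submanifold `M` (only the values of `A` on `M`
matter). -/
def SmoothOnSubmanifold {F : Type*} [NormedAddCommGroup F] [NormedSpace ℝ F] (k : ℕ)
    (M : Set F) (A : F → ℂ) : Prop :=
  ∀ W ψ, IsLocalParam k M W ψ → ContDiffOn ℝ ∞ (A ∘ ψ) W

/-- The tangent space `T_z M`, made of the velocities at `z` of the curves drawn on `M`. (For a
submanifold these velocities already form a linear space.) -/
def tangentSpaceOf {n : ℕ} (M : Set (Config n)) (z : Config n) : Submodule ℝ (Config n) :=
  Submodule.span ℝ {v | ∃ c : ℝ → Config n, c 0 = z ∧ (∀ᶠ t in 𝓝 (0 : ℝ), c t ∈ M) ∧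
    HasDerivAt c v 0}

/-! ### The energy sphere bundle `N_E Γ` of the normal bundle, and its measure -/

/-- `N_E Γ = {(z, ξ) : z ∈ Γ, ξ ⊥ T_z Γ, |ξ| = √(E₀ - V₁(z))}`. -/
def normalEnergyBundle {n : ℕ} (V₁ : Config n → ℝ) (E₀ : ℝ) (Γ : Set (Config n)) :
    Set (Phase n) :=
  {w | w.1 ∈ Γ ∧ w.2 ∈ (tangentSpaceOf Γ w.1)ᗮ ∧ ‖w.2‖ = Real.sqrt (E₀ - V₁ w.1)}

/-- The component `Ξ_⊥` of `Ξ` in `(T_z Γ ⊕ ℝ ξ)^⊥`, at the point `w = (z, ξ)`. -/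
noncomputable def perpPart {n : ℕ} (Γ : Set (Config n)) (w : Phase n) (Ξ : Config n) : Config n :=
  (tangentSpaceOf Γ w.1 ⊔ Submodule.span ℝ {w.2})ᗮ.starProjection Ξ

/-- The metric `g_(z,ξ)((Z¹, Ξ¹), (Z², Ξ²)) = ⟨Z¹, Z²⟩ + ⟨Ξ¹_⊥, Ξ²_⊥⟩`. -/
noncomputable def bundleMetric {n : ℕ} (Γ : Set (Config n)) (w v₁ v₂ : Phase n) : ℝ :=
  ⟪v₁.1, v₂.1⟫_ℝ + ⟪perpPart Γ w v₁.2, perpPart Γ w v₂.2⟫_ℝ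

/-- The Gram matrix `g_ψ(u)(∂ᵢψ(u), ∂ⱼψ(u))`, for `1 ≤ i, j ≤ n - 1`. -/
noncomputable def gramMatrix {n : ℕ} (Γ : Set (Config n))
    (ψ : EuclideanSpace ℝ (Fin (n - 1)) → Phase n) (u : EuclideanSpace ℝ (Fin (n - 1))) :
    Matrix (Fin (n - 1)) (Fin (n - 1)) ℝ :=
  Matrix.of fun i j => bundleMetric Γ (ψ u)
    (fderiv ℝ ψ u (EuclideanSpace.single i 1)) (fderiv ℝ ψ u (EuclideanSpace.single j 1))

/-- The measure `B ↦ ∫_{W ∩ ψ⁻¹(B)} √(det g(∂ᵢψ, ∂ⱼψ)) du` carried by the image of a local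
parametrization `ψ : W → N_E Γ`. -/
noncomputable def paramMeasure {n : ℕ} (Γ : Set (Config n))
    (W : Set (EuclideanSpace ℝ (Fin (n - 1)))) (ψ : EuclideanSpace ℝ (Fin (n - 1)) → Phase n) :
    Measure (Phase n) :=
  Measure.map ψ ((volume.restrict W).withDensity
    fun u => ENNReal.ofReal (Real.sqrt (gramMatrix Γ ψ u).det))

/-- The canonical measure `σ̃` of `(N_E Γ, g)`, extended by `0` to the phase space: the least
measure which dominates `√(det g(∂ᵢψ, ∂ⱼψ)) du` for every local parametrization `ψ` of `N_E Γ`.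
These local measures agree on overlaps, so on the image of each `ψ` the measure `σ̃` is given by
exactly this formula. -/
noncomputable def bundleMeasure {n : ℕ} (V₁ : Config n → ℝ) (E₀ : ℝ) (Γ : Set (Config n)) :
    Measure (Phase n) :=
  sSup {m | ∃ W ψ, IsLocalParam (n - 1) (normalEnergyBundle V₁ E₀ Γ) W ψ ∧
    m = paramMeasure Γ W ψ}

/-- `Φ₀`: the points of `N_E Γ` whose trajectory comes back to `N_E Γ` at some positive time. -/
def returnSet {n : ℕ} (V₁ : Config n → ℝ) (E₀ : ℝ) (Γ : Set (Config n)) : Set (Phase n) :=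
  {w | w ∈ normalEnergyBundle V₁ E₀ Γ ∧
    ∃ t : ℝ, 0 < t ∧ hamFlow V₁ t w ∈ normalEnergyBundle V₁ E₀ Γ}

/-! ### The source term -/

/-- The Fourier transform `Ŝ(ξ) = ∫ e^(-i⟨x, ξ⟩) S(x) dx`. -/
noncomputable def fourierHat {n : ℕ} (S : 𝓢(Config n, ℂ)) (ξ : Config n) : ℂ :=
  ∫ x, Complex.exp (-(Complex.I * (⟪x, ξ⟫_ℝ : ℂ))) * S x

/-- `c(z, ξ) = π (2π)^(d-n) |A(z)|² |ξ|⁻¹ |Ŝ(ξ)|²`. -/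
noncomputable def sourceDensity {n : ℕ} (d : ℕ) (A : Config n → ℂ) (S : 𝓢(Config n, ℂ))
    (w : Phase n) : ℝ :=
  Real.pi * (2 * Real.pi) ^ ((d : ℤ) - (n : ℤ)) * ‖A w.1‖ ^ 2 * ‖w.2‖⁻¹ * ‖fourierHat S w.2‖ ^ 2

/-! ### The three properties of the semiclassical measure -/

/-- `q ∈ C₀^∞(ℝ²ⁿ)`. -/
def IsTestFunction {n : ℕ} (q : Phase n → ℂ) : Prop :=
  ContDiff ℝ ∞ q ∧ HasCompactSupport q

/-- The incoming region `Γ₋(R, -σ) = {|x| ≥ R, ⟨x, ξ⟩ < -σ |x| |ξ|}`. -/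
def incomingRegion {n : ℕ} (R σ : ℝ) : Set (Phase n) :=
  {w | R ≤ ‖w.1‖ ∧ ⟪w.1, w.2⟫_ℝ < -σ * ‖w.1‖ * ‖w.2‖}

/-- `H_p q = {p, q} = 2ξ·∂ₓq - ∇V₁(x)·∂_ξ q`. -/
noncomputable def poissonP {n : ℕ} (V₁ : Config n → ℝ) (q : Phase n → ℂ) (w : Phase n) : ℂ :=
  fderiv ℝ q w (hamField V₁ w)

/-- The three properties: (i) support on the energy surface, (ii) vanishing in the incoming
region, (iii) the Liouville equation `(H_p + 2 Im E₁ + 2 V₂) ν = c σ̃`, in the weak sense. -/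
structure HasSemiclassicalProperties {n : ℕ} (V₁ V₂ : Config n → ℝ) (E₀ : ℝ) (E₁ : ℂ)
    (Γ : Set (Config n)) (d : ℕ) (A : Config n → ℂ) (S : 𝓢(Config n, ℂ))
    (ν : Measure (Phase n)) : Prop where
  support_energy : ν.support ⊆ {w | hamSymbol V₁ w = E₀}
  incoming : ∀ σ ∈ Ioo (0 : ℝ) 1, ∃ R : ℝ, 0 ≤ R ∧ ∀ q : Phase n → ℂ, IsTestFunction q →
    tsupport q ⊆ incomingRegion R σ → ∫ w, q w ∂ν = 0
  liouville : ∀ q : Phase n → ℂ, IsTestFunction q →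
    ∫ w, (-poissonP V₁ q w + ((2 * E₁.im + 2 * V₂ w.1 : ℝ) : ℂ) * q w) ∂ν =
      ∫ w, (sourceDensity d A S w : ℂ) * q w ∂(bundleMeasure V₁ E₀ Γ)

/-- The integrand `c(w) q(φᵗ(w)) exp(-2t Im E₁ - 2 ∫₀ᵗ V₂(x̄(s, w)) ds)`. -/
noncomputable def propagatedIntegrand {n : ℕ} (V₁ V₂ : Config n → ℝ) (E₁ : ℂ) (d : ℕ)
    (A : Config n → ℂ) (S : 𝓢(Config n, ℂ)) (q : Phase n → ℂ) (t : ℝ) (w : Phase n) : ℂ :=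
  (sourceDensity d A S w : ℂ) * q (hamFlow V₁ t w) *
    (Real.exp (-2 * t * E₁.im - 2 * ∫ s in (0 : ℝ)..t, V₂ (hamFlow V₁ s w).1) : ℂ)

/-! The formula is Duhamel's principle along the characteristics of `H_p`. Write `b = Im E₁ ≥ 0`,
let `q_t(w) = q(φᵗ(w)) exp(-2tb - 2∫₀ᵗ V₂)` be the damped pullback, and let `Q_T = ∫₀ᵀ q_t dt`.
Shifting the base point along the flow shifts the time window, so `H_p Q_T = (2b + 2V₂) Q_T + q_T -
q` (`hasDerivAt_accumulatedPullback`). Inserting `Q_T` in the Liouville equation (iii) gives `∫ q dν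
- ∫ q_T dν = ∫₀ᵀ ∫ c q_t dσ̃ dt` (`integral_sub_dampedPullback`). Only Lipschitz dependence of the
flow on its initial point is established, so `Q_T` is treated as a Lipschitz function with a
continuous derivative along the flow; mollification extends (iii) to such functions
(`liouville_of_lipschitz`).

It remains to see that `∫ q_T dν → 0` (`tendsto_integral_dampedPullback`). Far away `|x|²` is
strictly convex along trajectories of energy `E₀ > 0`. Hence a trajectory either escapes, and `q_T`
eventually vanishes on it, or is bounded in the future. In the second case its accumulation points
have bounded complete trajectories, which meet `{V₂ > 0}` by hypothesis; the trajectory then gathers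
a definite amount of absorption infinitely often and the damping factor tends to zero. For dominated
convergence, points far away that are not incoming never reach `supp q` later, while `ν` does not
charge far incoming points by (ii); so `q_T` vanishes `ν`-almost everywhere outside one compact set.

Applying the finite-time formula to `|q|` as well, and using `c ≥ 0`, makes the time integral
absolutely convergent (`integral_eq_integral_Ioi`). Fubini requires `σ̃` to be σ-finite and `c`
integrable: `N_E Γ` is a regular level set of dimension `n - 1`, the local densities agree by the
change of variables formula, and `c` vanishes off a compact part of `N_E Γ`. Uniqueness follows
because the right-hand side does not involve `ν`. -/

/-! ### Global flows of Lipschitz vector fields -/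

/-- A Lipschitz vector field has integral curves on a time interval of uniform length. -/
lemma LipschitzWith.exists_hasDerivWithinAt_uniform {F : Type*} [NormedAddCommGroup F]
    [NormedSpace ℝ F] [CompleteSpace F] {K : NNReal} {X : F → F} (hX : LipschitzWith K X) (w : F) :
    ∃ γ : ℝ → F, γ 0 = w ∧ ∀ t ∈ Ioo (-(1 / (2 * (K + 1)) : ℝ)) (1 / (2 * (K + 1))),
      HasDerivAt γ (X (γ t)) t := by
  set ε : ℝ := 1 / (2 * (K + 1)) with hε
  have hK : (0 : ℝ) ≤ K := K.2
  have hε0 : 0 < ε := by positivity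
  have hKε : (K + 1) * ε = 1 / 2 := by rw [hε]; field_simp
  -- On the ball of radius `‖X w‖` around `w` the speed is at most `(1 + K)‖X w‖`, so a curve cannot
  -- leave the ball within time `1 / (2(K + 1))`. This time does not depend on `w`.
  let a : NNReal := ‖X w‖₊
  let L : NNReal := ‖X w‖₊ + K * a
  have h0 : (0 : ℝ) ∈ Icc (-ε) ε := ⟨by linarith, hε0.le⟩
  have hPL : IsPicardLindelof (fun _ => X) (tmin := -ε) (tmax := ε) ⟨0, h0⟩ w a 0 L K := by
    refine IsPicardLindelof.of_time_independent (fun y hy => ?_) hX.lipschitzOnWith ?_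
    · have h1 : ‖X y‖ ≤ ‖X w‖ + ‖X y - X w‖ := by
        have := norm_add_le (X w) (X y - X w); simpa using this
      have h2 := hX.dist_le_mul y w
      rw [dist_eq_norm] at h2
      have h3 : dist y w ≤ a := hy
      have : (K : ℝ) * dist y w ≤ K * a := by gcongr
      simp only [L, NNReal.coe_add, NNReal.coe_mul, coe_nnnorm]
      linarith
    · simp only [L, a, NNReal.coe_add, NNReal.coe_mul, coe_nnnorm, NNReal.coe_zero, sub_zero,
        zero_sub, neg_neg, max_self]
      have : (‖X w‖ + K * ‖X w‖) * ε = ‖X w‖ * ((K + 1) * ε) := by ring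
      rw [this, hKε]
      linarith [norm_nonneg (X w)]
  obtain ⟨γ, hγ0, hγ⟩ := hPL.exists_eq_forall_mem_Icc_hasDerivWithinAt₀
  exact ⟨γ, hγ0, fun t ht => (hγ t (Ioo_subset_Icc_self ht)).hasDerivAt (Icc_mem_nhds ht.1 ht.2)⟩

/-- A Lipschitz vector field of class `C¹` is complete. -/
lemma LipschitzWith.exists_forall_hasDerivAt {F : Type*} [NormedAddCommGroup F]
    [NormedSpace ℝ F] [CompleteSpace F] {K : NNReal} {X : F → F} (hX : LipschitzWith K X)
    (hX1 : ContDiff ℝ 1 X) (w : F) :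
    ∃ γ : ℝ → F, (∀ t, HasDerivAt γ (X (γ t)) t) ∧ γ 0 = w := by
  have hv := (contMDiff_vectorSpace_iff_contDiff (V := X)).2 hX1
  have hε0 : (0 : ℝ) < 1 / (2 * (K + 1)) := by have : (0 : ℝ) ≤ K := K.2; positivity
  -- The existence time is the same at every point, so local curves can be prolonged indefinitely.
  obtain ⟨γ, hγ0, hγ⟩ := exists_isMIntegralCurve_of_isMIntegralCurveOn hv hε0 (fun x => by
    obtain ⟨γ, hγ0, hγ⟩ := hX.exists_hasDerivWithinAt_uniform x
    refine ⟨γ, hγ0, fun t ht => ?_⟩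
    exact (hγ t ht).hasFDerivAt.hasMFDerivAt.hasMFDerivWithinAt) w
  exact ⟨γ, fun t => (hγ t).hasFDerivAt, hγ0⟩

/-- Integral curves of a Lipschitz vector field depend on their initial values in a Lipschitz
way. -/
lemma LipschitzWith.dist_integralCurve_le {F : Type*} [NormedAddCommGroup F]
    [NormedSpace ℝ F] {K : NNReal} {X : F → F} (hX : LipschitzWith K X) {γ γ' : ℝ → F}
    (hγ : ∀ t, HasDerivAt γ (X (γ t)) t) (hγ' : ∀ t, HasDerivAt γ' (X (γ' t)) t) (t : ℝ) :
    dist (γ t) (γ' t) ≤ dist (γ 0) (γ' 0) * Real.exp (K * |t|) := by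
  rcases le_total 0 t with ht | ht
  · have := dist_le_of_trajectories_ODE (v := fun _ => X) (a := 0) (b := t) (fun _ => hX)
      (fun s _ => (hγ s).continuousAt.continuousWithinAt) (fun s _ => (hγ s).hasDerivWithinAt)
      (fun s _ => (hγ' s).continuousAt.continuousWithinAt) (fun s _ => (hγ' s).hasDerivWithinAt)
      le_rfl t ⟨ht, le_rfl⟩
    simpa [abs_of_nonneg ht] using this
  -- Negative times reduce to positive ones: the reversed curves are integral curves of `-X`, which
  -- has the same Lipschitz constant.
  · have key : ∀ {γ : ℝ → F}, (∀ t, HasDerivAt γ (X (γ t)) t) → ∀ s,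
        HasDerivAt (fun s => γ (-s)) (-X (γ (-s))) s := by
      intro γ hγ s
      simpa [Function.comp_def] using (hγ (-s)).scomp s (hasDerivAt_neg s)
    have h1 := key hγ
    have h2 := key hγ'
    have := dist_le_of_trajectories_ODE (v := fun _ y => -X y) (K := K) (a := 0) (b := -t)
      (fun _ => hX.neg)
      (fun s _ => (h1 s).continuousAt.continuousWithinAt) (fun s _ => (h1 s).hasDerivWithinAt)
      (fun s _ => (h2 s).continuousAt.continuousWithinAt) (fun s _ => (h2 s).hasDerivWithinAt)
      le_rfl (-t) ⟨by linarith, le_rfl⟩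
    simpa [abs_of_nonpos ht] using this

/-! ### Potentials with symbol decay -/

section Potential

variable {n : ℕ} {ρ : ℝ} {V : Config n → ℝ}

lemma norm_gradient_eq {n : ℕ} (V : Config n → ℝ) (x : Config n) :
    ‖gradient V x‖ = ‖iteratedFDeriv ℝ 1 V x‖ := by
  rw [norm_iteratedFDeriv_one]
  simp [gradient]

/-- The weight has base at least one and negative exponent. The case `k = 0` will bound momenta at
fixed energy, `k = 1` makes the potential Lipschitz, and `k = 2` makes the Hamiltonian field
Lipschitz. -/
lemma SymbolDecay.exists_bound (hρ : 0 < ρ) (hV : SymbolDecay ρ V) (k : ℕ) :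
    ∃ C : NNReal, ∀ x, ‖iteratedFDeriv ℝ k V x‖ ≤ C := by
  obtain ⟨C, hC⟩ := hV.2 k
  refine ⟨‖C‖₊, fun x => (hC x).trans ?_⟩
  rw [coe_nnnorm, Real.norm_eq_abs]
  have h1 : 1 ≤ Real.sqrt (1 + ‖x‖ ^ 2) := by
    rw [Real.one_le_sqrt]; nlinarith [norm_nonneg x]
  have h2 : Real.sqrt (1 + ‖x‖ ^ 2) ^ (-ρ - (k : ℝ)) ≤ 1 :=
    Real.rpow_le_one_of_one_le_of_nonpos h1 (by have : (0 : ℝ) ≤ k := k.cast_nonneg; linarith)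
  have h3 : 0 ≤ Real.sqrt (1 + ‖x‖ ^ 2) ^ (-ρ - (k : ℝ)) := by positivity
  calc C * _ ≤ |C| * Real.sqrt (1 + ‖x‖ ^ 2) ^ (-ρ - (k : ℝ)) := by gcongr; exact le_abs_self C
    _ ≤ |C| * 1 := by gcongr
    _ = |C| := mul_one _

lemma SymbolDecay.lipschitzWith (hρ : 0 < ρ) (hV : SymbolDecay ρ V) :
    ∃ K : NNReal, LipschitzWith K V := by
  obtain ⟨C, hC⟩ := hV.exists_bound hρ 1
  refine ⟨C, lipschitzWith_of_nnnorm_fderiv_le (hV.1.differentiable (by simp)) fun x => ?_⟩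
  rw [← NNReal.coe_le_coe, coe_nnnorm, ← norm_iteratedFDeriv_one]
  exact hC x

lemma SymbolDecay.contDiff_gradient (hV : SymbolDecay ρ V) : ContDiff ℝ ∞ (gradient V) := by
  have h1 : ContDiff ℝ ∞ (fderiv ℝ V) := hV.1.fderiv_right (by simp)
  exact ((InnerProductSpace.toDual ℝ (Config n)).symm.contDiff).comp h1

lemma SymbolDecay.lipschitzWith_gradient (hρ : 0 < ρ) (hV : SymbolDecay ρ V) :
    ∃ K : NNReal, LipschitzWith K (gradient V) := by
  obtain ⟨C, hC⟩ := hV.exists_bound hρ 2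
  have h1 : ContDiff ℝ ∞ (fderiv ℝ V) := hV.1.fderiv_right (by simp)
  have h2 : LipschitzWith C (fderiv ℝ V) := by
    refine lipschitzWith_of_nnnorm_fderiv_le (h1.differentiable (by simp)) fun x => ?_
    rw [← NNReal.coe_le_coe, coe_nnnorm, ← norm_iteratedFDeriv_one, norm_iteratedFDeriv_fderiv]
    exact hC x
  have h3 := (InnerProductSpace.toDual ℝ (Config n)).symm.lipschitz.comp h2
  exact ⟨_, h3⟩

lemma SymbolDecay.contDiff_hamField (hV : SymbolDecay ρ V) : ContDiff ℝ ∞ (hamField V) := by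
  unfold hamField
  exact (contDiff_snd.const_smul (2 : ℝ)).prodMk (hV.contDiff_gradient.comp contDiff_fst).neg

lemma SymbolDecay.lipschitzWith_hamField (hρ : 0 < ρ) (hV : SymbolDecay ρ V) :
    ∃ K : NNReal, LipschitzWith K (hamField V) := by
  obtain ⟨K, hK⟩ := hV.lipschitzWith_gradient hρ
  have h1 : LipschitzWith (‖(2 : ℝ)‖₊ * 1) (fun w : Phase n => (2 : ℝ) • w.2) :=
    (lipschitzWith_smul (2 : ℝ)).comp LipschitzWith.prod_snd
  have h2 : LipschitzWith (K * 1) (fun w : Phase n => gradient V w.1) :=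
    hK.comp LipschitzWith.prod_fst
  exact ⟨_, h1.prodMk h2.neg⟩

/-! ### The Hamiltonian flow -/

lemma SymbolDecay.hasDerivAt_hamFlow (hρ : 0 < ρ) (hV : SymbolDecay ρ V) (w : Phase n) (t : ℝ) :
    HasDerivAt (fun t => hamFlow V t w) (hamField V (hamFlow V t w)) t := by
  obtain ⟨K, hK⟩ := hV.lipschitzWith_hamField hρ
  have h : ∃ γ : ℝ → Phase n, IsTrajectory V γ ∧ γ 0 = w :=
    hK.exists_forall_hasDerivAt (hV.contDiff_hamField.of_le (by norm_cast)) w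
  have h1 : (fun t => hamFlow V t w) = h.choose := by
    funext t; simp only [hamFlow, dif_pos h]
  have h2 : hamFlow V t w = h.choose t := congrFun h1 t
  rw [h1, h2]
  exact h.choose_spec.1 t

lemma SymbolDecay.hamFlow_zero (hρ : 0 < ρ) (hV : SymbolDecay ρ V) (w : Phase n) :
    hamFlow V 0 w = w := by
  obtain ⟨K, hK⟩ := hV.lipschitzWith_hamField hρ
  have h : ∃ γ : ℝ → Phase n, IsTrajectory V γ ∧ γ 0 = w :=
    hK.exists_forall_hasDerivAt (hV.contDiff_hamField.of_le (by norm_cast)) w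
  simp only [hamFlow, dif_pos h]
  exact h.choose_spec.2

/-- Gronwall's estimate with zero initial distance. Applied to time translates of trajectories it
yields the group law. -/
lemma SymbolDecay.eq_hamFlow (hρ : 0 < ρ) (hV : SymbolDecay ρ V) {γ : ℝ → Phase n}
    (hγ : IsTrajectory V γ) (t : ℝ) : γ t = hamFlow V t (γ 0) := by
  obtain ⟨K, hK⟩ := hV.lipschitzWith_hamField hρ
  have := hK.dist_integralCurve_le hγ (hV.hasDerivAt_hamFlow hρ (γ 0)) t
  rw [hV.hamFlow_zero hρ, dist_self, zero_mul] at this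
  exact dist_le_zero.1 this

lemma SymbolDecay.hamFlow_add (hρ : 0 < ρ) (hV : SymbolDecay ρ V) (s t : ℝ) (w : Phase n) :
    hamFlow V (s + t) w = hamFlow V s (hamFlow V t w) := by
  have h : IsTrajectory V fun s => hamFlow V (s + t) w := fun s => by
    simpa using (hV.hasDerivAt_hamFlow hρ w (s + t)).comp_add_const s t
  have := hV.eq_hamFlow hρ h s
  simpa using this

lemma SymbolDecay.hamFlow_neg_hamFlow (hρ : 0 < ρ) (hV : SymbolDecay ρ V) (t : ℝ) (w : Phase n) :
    hamFlow V (-t) (hamFlow V t w) = w := by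
  rw [← hV.hamFlow_add hρ, neg_add_cancel, hV.hamFlow_zero hρ]

lemma SymbolDecay.exists_dist_hamFlow_le (hρ : 0 < ρ) (hV : SymbolDecay ρ V) :
    ∃ K : NNReal, ∀ t w w',
      dist (hamFlow V t w) (hamFlow V t w') ≤ dist w w' * Real.exp (K * |t|) := by
  obtain ⟨K, hK⟩ := hV.lipschitzWith_hamField hρ
  refine ⟨K, fun t w w' => ?_⟩
  have := hK.dist_integralCurve_le (hV.hasDerivAt_hamFlow hρ w) (hV.hasDerivAt_hamFlow hρ w') t
  simpa [hV.hamFlow_zero hρ] using this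

/-- Combines continuity in time at the fixed point `w` with a Lipschitz bound in the initial point
that is locally uniform in time. -/
lemma SymbolDecay.continuous_uncurry_hamFlow (hρ : 0 < ρ) (hV : SymbolDecay ρ V) :
    Continuous fun x : ℝ × Phase n => hamFlow V x.1 x.2 := by
  obtain ⟨K, hK⟩ := hV.exists_dist_hamFlow_le hρ
  rw [continuous_iff_continuousAt]
  rintro ⟨t, w⟩
  have h1 : Tendsto (fun x : ℝ × Phase n => hamFlow V x.1 w) (𝓝 (t, w)) (𝓝 (hamFlow V t w)) :=
    ((hV.hasDerivAt_hamFlow hρ w t).continuousAt.tendsto).comp continuous_fst.continuousAt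
  rw [ContinuousAt, tendsto_iff_dist_tendsto_zero]
  rw [tendsto_iff_dist_tendsto_zero] at h1
  have h2 : Tendsto (fun x : ℝ × Phase n => dist x.2 w * Real.exp (K * |x.1|)
      + dist (hamFlow V x.1 w) (hamFlow V t w)) (𝓝 (t, w)) (𝓝 0) := by
    have h3 : Tendsto (fun x : ℝ × Phase n => dist x.2 w * Real.exp (K * |x.1|)) (𝓝 (t, w))
        (𝓝 (dist (t, w).2 w * Real.exp (K * |(t, w).1|))) :=
      Continuous.tendsto (by fun_prop) (t, w)
    simpa using h3.add h1
  refine squeeze_zero (fun _ => dist_nonneg) (fun x => ?_) h2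
  exact (dist_triangle _ (hamFlow V x.1 w) _).trans (by gcongr; exact hK _ _ _)

lemma SymbolDecay.continuous_hamFlow (hρ : 0 < ρ) (hV : SymbolDecay ρ V) (t : ℝ) :
    Continuous (hamFlow V t) :=
  (hV.continuous_uncurry_hamFlow hρ).comp (by fun_prop : Continuous fun w : Phase n => (t, w))

lemma SymbolDecay.hasDerivAt_hamFlow_fst (hρ : 0 < ρ) (hV : SymbolDecay ρ V) (w : Phase n)
    (t : ℝ) : HasDerivAt (fun t => (hamFlow V t w).1) ((2 : ℝ) • (hamFlow V t w).2) t :=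
  (hV.hasDerivAt_hamFlow hρ w t).fst

lemma SymbolDecay.hasDerivAt_hamFlow_snd (hρ : 0 < ρ) (hV : SymbolDecay ρ V) (w : Phase n)
    (t : ℝ) : HasDerivAt (fun t => (hamFlow V t w).2) (-gradient V (hamFlow V t w).1) t :=
  (hV.hasDerivAt_hamFlow hρ w t).snd

lemma SymbolDecay.continuous_hamSymbol (hV : SymbolDecay ρ V) : Continuous (hamSymbol V) := by
  have := hV.1.continuous
  unfold hamSymbol
  fun_prop

/-- Conservation of energy. -/
lemma SymbolDecay.hamSymbol_hamFlow (hρ : 0 < ρ) (hV : SymbolDecay ρ V) (t : ℝ) (w : Phase n) :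
    hamSymbol V (hamFlow V t w) = hamSymbol V w := by
  have h : ∀ t, HasDerivAt (fun t => hamSymbol V (hamFlow V t w)) 0 t := by
    intro t
    have h1 := (hV.hasDerivAt_hamFlow_snd hρ w t).norm_sq
    have h2 : HasFDerivAt V (fderiv ℝ V (hamFlow V t w).1) (hamFlow V t w).1 :=
      (hV.1.differentiable (by simp) _).hasFDerivAt
    have h3 := h2.comp_hasDerivAt t (hV.hasDerivAt_hamFlow_fst hρ w t)
    have h4 := h1.add h3
    have h5 : fderiv ℝ V (hamFlow V t w).1 ((2 : ℝ) • (hamFlow V t w).2) =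
        2 * ⟪(hamFlow V t w).2, gradient V (hamFlow V t w).1⟫_ℝ := by
      rw [map_smul, smul_eq_mul, real_inner_comm, gradient, InnerProductSpace.toDual_symm_apply]
    rw [h5, inner_neg_right] at h4
    have h6 : (2 : ℝ) * -⟪(hamFlow V t w).2, gradient V (hamFlow V t w).1⟫_ℝ
        + 2 * ⟪(hamFlow V t w).2, gradient V (hamFlow V t w).1⟫_ℝ = 0 := by ring
    rw [h6] at h4
    exact h4
  have := is_const_of_deriv_eq_zero (fun t => (h t).differentiableAt) (fun t => (h t).deriv) t 0
  simpa [hV.hamFlow_zero hρ] using this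

end Potential

/-! ### Escape to infinity -/

/-- Convexity barrier: if `f'' ≥ a` wherever `f ≥ M`, and the parabola osculating `f` at `0` stays
above `M` at positive times, then `f` stays above this parabola. -/
lemma le_of_deriv2_ge_above {f f1 f2 : ℝ → ℝ} {M a : ℝ} (hf : ∀ t, HasDerivAt f (f1 t) t)
    (hf1 : ∀ t, HasDerivAt f1 (f2 t) t) (h2 : ∀ t, M ≤ f t → a ≤ f2 t)
    (h0 : ∀ t, 0 ≤ t → M < f 0 + f1 0 * t + a / 2 * t ^ 2) {t : ℝ} (ht : 0 ≤ t) :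
    f 0 + f1 0 * t + a / 2 * t ^ 2 ≤ f t := by
  -- As long as `f ≥ M`, the bound `f'' ≥ a` can be integrated twice. The restriction is lifted by
  -- looking at the first time where `f ≤ M`: up to it the bound holds, and the parabola is strictly
  -- above `M`.
  have step : ∀ s, 0 ≤ s → (∀ t ∈ Ioo 0 s, M ≤ f t) → f 0 + f1 0 * s + a / 2 * s ^ 2 ≤ f s := by
    intro s hs hM
    have hd1 : ∀ t, HasDerivAt (fun t => f1 t - a * t) (f2 t - a) t := fun t => by
      simpa using (hf1 t).fun_sub ((hasDerivAt_id' t).const_mul a)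
    have hm1 : MonotoneOn (fun t => f1 t - a * t) (Icc 0 s) := by
      refine monotoneOn_of_deriv_nonneg (convex_Icc _ _)
        (fun t _ => (hd1 t).continuousAt.continuousWithinAt)
        (fun t _ => (hd1 t).differentiableAt.differentiableWithinAt) fun t ht => ?_
      rw [interior_Icc] at ht
      rw [(hd1 t).deriv]
      linarith [h2 t (hM t ht)]
    have hd2 : ∀ t, HasDerivAt (fun t => f t - (f1 0 * t + a / 2 * t ^ 2))
        (f1 t - (f1 0 + a * t)) t := fun t => by
      have h3 := ((hasDerivAt_id' t).const_mul (f1 0)).fun_add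
        ((hasDerivAt_pow 2 t).const_mul (a / 2))
      exact ((hf t).fun_sub h3).congr_deriv (by simp; ring)
    have hm2 : MonotoneOn (fun t => f t - (f1 0 * t + a / 2 * t ^ 2)) (Icc 0 s) := by
      refine monotoneOn_of_deriv_nonneg (convex_Icc _ _)
        (fun t _ => (hd2 t).continuousAt.continuousWithinAt)
        (fun t _ => (hd2 t).differentiableAt.differentiableWithinAt) fun t ht => ?_
      rw [interior_Icc] at ht
      rw [(hd2 t).deriv]
      have := hm1 ⟨le_rfl, hs⟩ (Ioo_subset_Icc_self ht) ht.1.le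
      simp only [mul_zero, sub_zero] at this
      linarith
    have := hm2 ⟨le_rfl, hs⟩ ⟨hs, le_rfl⟩ hs
    simp only [mul_zero, ne_eq, OfNat.ofNat_ne_zero, not_false_eq_true, zero_pow, add_zero,
      sub_zero] at this
    linarith
  have hcont : Continuous f := continuous_iff_continuousAt.2 fun t => (hf t).continuousAt
  have hempty : ¬ (Icc 0 t ∩ {s | f s ≤ M}).Nonempty := by
    intro hne
    obtain ⟨s, hs, hmin⟩ := (isCompact_Icc.inter_right
      (isClosed_le hcont continuous_const)).exists_isLeast hne
    have h3 := step s hs.1.1 fun r hr => by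
      by_contra! hlt
      exact absurd (hmin ⟨⟨hr.1.le, hr.2.le.trans hs.1.2⟩, hlt.le⟩) (not_le.2 hr.2)
    have h4 : f s ≤ M := hs.2
    linarith [h0 s hs.1.1]
  refine step t ht fun r hr => ?_
  by_contra! hlt
  exact hempty ⟨r, ⟨hr.1.le, hr.2.le⟩, hlt.le⟩

section Dynamics

variable {n : ℕ} {ρ : ℝ} {V₁ V₂ : Config n → ℝ} {E₀ : ℝ}

/-- `V` is negligible outside the ball of radius `R`, for the scattering at energy `E₀`. -/
def IsFarRadius (V : Config n → ℝ) (E₀ R : ℝ) : Prop :=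
  0 < R ∧ ∀ x, R ≤ ‖x‖ → |V x| ≤ E₀ / 4 ∧ ‖x‖ * ‖gradient V x‖ ≤ E₀ / 4

lemma IsFarRadius.mono {V : Config n → ℝ} {R R' : ℝ} (h : IsFarRadius V E₀ R) (hR : R ≤ R') :
    IsFarRadius V E₀ R' :=
  ⟨h.1.trans_le hR, fun x hx => h.2 x (hR.trans hx)⟩

/-- The gradient decays one order faster than the potential, which absorbs the factor `‖x‖`; both
quantities are `O(⟨x⟩^(-ρ))`. -/
lemma SymbolDecay.exists_isFarRadius (hρ : 0 < ρ) (hV : SymbolDecay ρ V₁) (hE₀ : 0 < E₀) :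
    ∃ R, IsFarRadius V₁ E₀ R := by
  obtain ⟨C0, hC0⟩ := hV.2 0
  obtain ⟨C1, hC1⟩ := hV.2 1
  have hlim : Tendsto (fun r : ℝ => max |C0| |C1| * r ^ (-ρ)) atTop (𝓝 0) := by
    simpa using (tendsto_rpow_neg_atTop hρ).const_mul (max |C0| |C1|)
  obtain ⟨R, hR⟩ := eventually_atTop.1 (hlim.eventually_lt_const (by positivity : 0 < E₀ / 4))
  refine ⟨max R 1, by positivity, fun x hx => ?_⟩
  have hsx : ‖x‖ ≤ Real.sqrt (1 + ‖x‖ ^ 2) := Real.le_sqrt_of_sq_le (by linarith)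
  set r := Real.sqrt (1 + ‖x‖ ^ 2) with hr
  have hrR : R ≤ r := (le_max_left _ _).trans (hx.trans hsx)
  have hr1 : 0 < r := lt_of_lt_of_le one_pos ((le_max_right _ _).trans (hx.trans hsx))
  have hsmall := hR r hrR
  have hpos : 0 ≤ r ^ (-ρ) := by positivity
  have h0 := hC0 x
  have h1 := hC1 x
  rw [norm_iteratedFDeriv_zero, Real.norm_eq_abs, Nat.cast_zero, sub_zero] at h0
  rw [← norm_gradient_eq, Nat.cast_one, Real.rpow_sub hr1, Real.rpow_one] at h1
  constructor
  · have : C0 * r ^ (-ρ) ≤ max |C0| |C1| * r ^ (-ρ) := by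
      gcongr; exact (le_abs_self _).trans (le_max_left _ _)
    linarith
  · have h2 : C1 * r ^ (-ρ) ≤ max |C0| |C1| * r ^ (-ρ) := by
      gcongr; exact (le_abs_self _).trans (le_max_right _ _)
    calc ‖x‖ * ‖gradient V₁ x‖ ≤ r * (C1 * (r ^ (-ρ) / r)) := by gcongr
      _ = C1 * r ^ (-ρ) := by field_simp
      _ ≤ E₀ / 4 := by linarith

lemma SymbolDecay.hasDerivAt_normSq_hamFlow (hρ : 0 < ρ) (hV : SymbolDecay ρ V₁) (w : Phase n)
    (t : ℝ) : HasDerivAt (fun t => ‖(hamFlow V₁ t w).1‖ ^ 2)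
      (4 * ⟪(hamFlow V₁ t w).1, (hamFlow V₁ t w).2⟫_ℝ) t := by
  have h := (hV.hasDerivAt_hamFlow_fst hρ w t).norm_sq
  rw [inner_smul_right] at h
  exact h.congr_deriv (by ring)

lemma SymbolDecay.hasDerivAt_inner_hamFlow (hρ : 0 < ρ) (hV : SymbolDecay ρ V₁) (w : Phase n)
    (t : ℝ) : HasDerivAt (fun t => 4 * ⟪(hamFlow V₁ t w).1, (hamFlow V₁ t w).2⟫_ℝ)
      (8 * ‖(hamFlow V₁ t w).2‖ ^ 2
        - 4 * ⟪(hamFlow V₁ t w).1, gradient V₁ (hamFlow V₁ t w).1⟫_ℝ) t := by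
  have h := ((hV.hasDerivAt_hamFlow_fst hρ w t).inner ℝ
    (hV.hasDerivAt_hamFlow_snd hρ w t)).const_mul 4
  rw [inner_smul_left, inner_neg_right, real_inner_self_eq_norm_sq] at h
  exact h.congr_deriv (by simp; ring)

/-- The bounded quantity is the second derivative of `‖x‖²` along the flow. Far away `3E₀/4 ≤ ‖ξ‖² ≤
5E₀/4`, so it is at least `6E₀ - E₀`. -/
lemma IsFarRadius.le_deriv2 {R : ℝ} (hR : IsFarRadius V₁ E₀ R) {w : Phase n}
    (hw : hamSymbol V₁ w = E₀) (hwR : R ^ 2 ≤ ‖w.1‖ ^ 2) :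
    5 * E₀ ≤ 8 * ‖w.2‖ ^ 2 - 4 * ⟪w.1, gradient V₁ w.1⟫_ℝ ∧ ‖w.2‖ ^ 2 ≤ 5 / 4 * E₀ := by
  obtain ⟨h1, h2⟩ := hR.2 w.1 (by
    exact (sq_le_sq₀ hR.1.le (norm_nonneg _)).1 hwR)
  have h3 := abs_le.1 h1
  have h4 := (real_inner_le_norm w.1 (gradient V₁ w.1)).trans h2
  unfold hamSymbol at hw
  constructor <;> linarith

/-- A point far away which is not incoming escapes. -/
lemma IsFarRadius.hamFlow_escape (hρ : 0 < ρ) (hV : SymbolDecay ρ V₁) {R : ℝ}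
    (hR : IsFarRadius V₁ E₀ R) {w : Phase n} (hw : hamSymbol V₁ w = E₀)
    (hwR : 2 * R ^ 2 < ‖w.1‖ ^ 2) (hin : -(1 / 2) * ‖w.1‖ * ‖w.2‖ ≤ ⟪w.1, w.2⟫_ℝ) {t : ℝ}
    (ht : 0 ≤ t) :
    ‖w.1‖ ^ 2 + 4 * ⟪w.1, w.2⟫_ℝ * t + 5 * E₀ / 2 * t ^ 2 ≤ ‖(hamFlow V₁ t w).1‖ ^ 2 ∧
      ‖w.1‖ ^ 2 / 2 ≤ ‖(hamFlow V₁ t w).1‖ ^ 2 := by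
  have hξ := (hR.le_deriv2 hw (by nlinarith [sq_nonneg R])).2
  -- Since `5E₀/2 ≥ 2‖ξ‖²`, the parabola dominates `‖x‖² - 2‖x‖‖ξ‖t + 2‖ξ‖²t² = ‖x‖²/2 + (‖x‖ -
  -- 2‖ξ‖t)²/2`. The aperture `1/2` is what makes the square complete, and `‖x‖²/2 > R²` keeps the
  -- parabola above the barrier.
  have hq : ∀ t, 0 ≤ t →
      ‖w.1‖ ^ 2 / 2 ≤ ‖w.1‖ ^ 2 + 4 * ⟪w.1, w.2⟫_ℝ * t + 5 * E₀ / 2 * t ^ 2 := by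
    intro t ht
    have h1 := mul_le_mul_of_nonneg_right hin ht
    have h2 := mul_le_mul_of_nonneg_right hξ (sq_nonneg t)
    nlinarith [sq_nonneg (‖w.1‖ - 2 * ‖w.2‖ * t)]
  have key := le_of_deriv2_ge_above (M := R ^ 2) (a := 5 * E₀)
    (hV.hasDerivAt_normSq_hamFlow hρ w) (hV.hasDerivAt_inner_hamFlow hρ w)
    (fun t ht => (hR.le_deriv2 ((hV.hamSymbol_hamFlow hρ t w).trans hw) ht).1)
    (fun t ht => by
      rw [hV.hamFlow_zero hρ]
      linarith [hq t ht]) ht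
  rw [hV.hamFlow_zero hρ] at key
  exact ⟨key, (hq t ht).trans key⟩

/-- A point far away which is incoming has come from infinity. -/
lemma IsFarRadius.le_hamFlow_neg (hρ : 0 < ρ) (hV : SymbolDecay ρ V₁) (hE₀ : 0 < E₀) {R : ℝ}
    (hR : IsFarRadius V₁ E₀ R) {w : Phase n} (hw : hamSymbol V₁ w = E₀)
    (hwR : R ^ 2 < ‖w.1‖ ^ 2) (hin : ⟪w.1, w.2⟫_ℝ ≤ 0) {t : ℝ} (ht : 0 ≤ t) :
    ‖w.1‖ ^ 2 ≤ ‖(hamFlow V₁ (-t) w).1‖ ^ 2 := by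
  have hq : ∀ t, 0 ≤ t →
      ‖w.1‖ ^ 2 ≤ ‖w.1‖ ^ 2 + -(4 * ⟪w.1, w.2⟫_ℝ) * t + 5 * E₀ / 2 * t ^ 2 := by
    intro t ht
    have h1 := mul_nonneg (by linarith : 0 ≤ -(4 * ⟪w.1, w.2⟫_ℝ)) ht
    have h2 : 0 ≤ 5 * E₀ / 2 * t ^ 2 := by positivity
    linarith
  -- Under time reversal the first derivative changes sign, so an incoming point becomes outgoing,
  -- while the convexity bound is unchanged.
  have hd1 : ∀ t, HasDerivAt (fun t => ‖(hamFlow V₁ (-t) w).1‖ ^ 2)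
      (-(4 * ⟪(hamFlow V₁ (-t) w).1, (hamFlow V₁ (-t) w).2⟫_ℝ)) t := fun t => by
    simpa [Function.comp_def] using
      (hV.hasDerivAt_normSq_hamFlow hρ w (-t)).scomp t (hasDerivAt_neg t)
  have hd2 : ∀ t, HasDerivAt (fun t => -(4 * ⟪(hamFlow V₁ (-t) w).1, (hamFlow V₁ (-t) w).2⟫_ℝ))
      (8 * ‖(hamFlow V₁ (-t) w).2‖ ^ 2
        - 4 * ⟪(hamFlow V₁ (-t) w).1, gradient V₁ (hamFlow V₁ (-t) w).1⟫_ℝ) t := fun t => by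
    simpa [Function.comp_def] using
      ((hV.hasDerivAt_inner_hamFlow hρ w (-t)).scomp t (hasDerivAt_neg t)).fun_neg
  have key := le_of_deriv2_ge_above (M := R ^ 2) (a := 5 * E₀) hd1 hd2
    (fun t ht => (hR.le_deriv2 ((hV.hamSymbol_hamFlow hρ (-t) w).trans hw) ht).1)
    (fun t ht => by
      rw [neg_zero, hV.hamFlow_zero hρ]
      linarith [hq t ht]) ht
  rw [neg_zero, hV.hamFlow_zero hρ] at key
  exact (hq t ht).trans key

lemma SymbolDecay.exists_norm_snd_le (hρ : 0 < ρ) (hV : SymbolDecay ρ V₁) (E₀ : ℝ) :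
    ∃ B : ℝ, ∀ w, hamSymbol V₁ w = E₀ → ‖w.2‖ ≤ B := by
  obtain ⟨C, hC⟩ := hV.exists_bound hρ 0
  refine ⟨Real.sqrt (|E₀| + C), fun w hw => Real.le_sqrt_of_sq_le ?_⟩
  have h1 := hC w.1
  rw [norm_iteratedFDeriv_zero, Real.norm_eq_abs] at h1
  unfold hamSymbol at hw
  linarith [(abs_le.1 h1).1, le_abs_self E₀]

/-- A trajectory of positive energy escapes to infinity or is bounded at positive times. -/
lemma SymbolDecay.tendsto_or_isBounded (hρ : 0 < ρ) (hV : SymbolDecay ρ V₁) (hE₀ : 0 < E₀)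
    {w : Phase n} (hw : hamSymbol V₁ w = E₀) :
    Tendsto (fun t => ‖(hamFlow V₁ t w).1‖) atTop atTop ∨
      Bornology.IsBounded ((fun t => hamFlow V₁ t w) '' Ici 0) := by
  obtain ⟨R, hR⟩ := hV.exists_isFarRadius hρ hE₀
  obtain ⟨B, hB⟩ := hV.exists_norm_snd_le hρ E₀
  -- If the position stays bounded, so does the momentum, by conservation of energy. Otherwise the
  -- trajectory reaches a far point `w₁` at a greater distance than its start.
  by_cases h : ∀ t, 0 ≤ t → ‖(hamFlow V₁ t w).1‖ ≤ max ‖w.1‖ (2 * R)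
  · right
    refine isBounded_iff_forall_norm_le.2 ⟨max (max ‖w.1‖ (2 * R)) B, ?_⟩
    rintro _ ⟨t, ht, rfl⟩
    exact max_le_max (h t ht) (hB _ ((hV.hamSymbol_hamFlow hρ t w).trans hw))
  · left
    push Not at h
    obtain ⟨t₁, ht₁, hlt⟩ := h
    set w₁ := hamFlow V₁ t₁ w with hw₁
    have hw₁E : hamSymbol V₁ w₁ = E₀ := (hV.hamSymbol_hamFlow hρ t₁ w).trans hw
    have h1 : ‖w.1‖ < ‖w₁.1‖ := (le_max_left _ _).trans_lt hlt
    have h2 : 2 * R < ‖w₁.1‖ := (le_max_right _ _).trans_lt hlt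
    have hRpos := hR.1
    -- Were `w₁` incoming, its past would lie at least as far out as `w₁`, whereas the starting
    -- point `w` is closer.
    have hpos : 0 ≤ ⟪w₁.1, w₁.2⟫_ℝ := by
      by_contra! hneg
      have := hR.le_hamFlow_neg hρ hV hE₀ hw₁E (by nlinarith) hneg.le ht₁
      rw [hw₁, hV.hamFlow_neg_hamFlow hρ, ← hw₁] at this
      nlinarith [norm_nonneg w.1]
    have hesc : ∀ t, 0 ≤ t → 5 * E₀ / 2 * t ^ 2 ≤ ‖(hamFlow V₁ t w₁).1‖ ^ 2 := fun t ht => by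
      have := (hR.hamFlow_escape hρ hV hw₁E (by nlinarith)
        (le_trans (by have := norm_nonneg w₁.1; have := norm_nonneg w₁.2; nlinarith) hpos) ht).1
      have h3 : 0 ≤ 4 * ⟪w₁.1, w₁.2⟫_ℝ * t := by positivity
      linarith [sq_nonneg ‖w₁.1‖]
    have hesc' : ∀ t, 0 ≤ t → Real.sqrt (5 * E₀ / 2) * t ≤ ‖(hamFlow V₁ t w₁).1‖ := by
      intro t ht
      rw [← sq_le_sq₀ (by positivity) (norm_nonneg _)]
      rw [mul_pow, Real.sq_sqrt (by positivity)]
      exact hesc t ht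
    have hlim : Tendsto (fun t => Real.sqrt (5 * E₀ / 2) * (t - t₁)) atTop atTop :=
      (tendsto_atTop_add_const_right _ _ tendsto_id).const_mul_atTop (by positivity)
    refine tendsto_atTop_mono' _ ?_ hlim
    filter_upwards [eventually_ge_atTop t₁] with t ht
    have := hesc' (t - t₁) (by linarith)
    rwa [hw₁, ← hV.hamFlow_add hρ, sub_add_cancel] at this

/-! ### Accumulated absorption -/

/-- The absorption `∫₀ᵗ V₂(x̄(s, w)) ds` accumulated along a trajectory. -/
noncomputable def absorption (V₁ V₂ : Config n → ℝ) (t : ℝ) (w : Phase n) : ℝ :=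
  ∫ s in (0 : ℝ)..t, V₂ (hamFlow V₁ s w).1

lemma SymbolDecay.continuous_absorption_integrand (hρ : 0 < ρ) (hV : SymbolDecay ρ V₁)
    (hV₂ : Continuous V₂) : Continuous fun x : Phase n × ℝ => V₂ (hamFlow V₁ x.2 x.1).1 :=
  hV₂.comp (continuous_fst.comp ((hV.continuous_uncurry_hamFlow hρ).comp continuous_swap))

lemma SymbolDecay.intervalIntegrable_absorption (hρ : 0 < ρ) (hV : SymbolDecay ρ V₁)
    (hV₂ : Continuous V₂) (w : Phase n) (a b : ℝ) :
    IntervalIntegrable (fun s => V₂ (hamFlow V₁ s w).1) volume a b :=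
  ((hV.continuous_absorption_integrand hρ hV₂).comp
    (by fun_prop : Continuous fun s : ℝ => (w, s))).intervalIntegrable a b

/-- The cocycle identity over the flow; it makes the damped pullbacks behave well under translation
along trajectories. -/
lemma SymbolDecay.absorption_add (hρ : 0 < ρ) (hV : SymbolDecay ρ V₁) (hV₂ : Continuous V₂)
    (s t : ℝ) (w : Phase n) :
    absorption V₁ V₂ (s + t) w = absorption V₁ V₂ t w + absorption V₁ V₂ s (hamFlow V₁ t w) := by
  unfold absorption
  rw [← intervalIntegral.integral_add_adjacent_intervals
    (hV.intervalIntegrable_absorption hρ hV₂ w 0 t)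
    (hV.intervalIntegrable_absorption hρ hV₂ w t (s + t))]
  congr 1
  have h := intervalIntegral.integral_comp_add_right
    (a := 0) (b := s) (fun s => V₂ (hamFlow V₁ s w).1) t
  rw [zero_add] at h
  rw [← h]
  exact intervalIntegral.integral_congr fun r _ => by simp only [hV.hamFlow_add hρ]

lemma SymbolDecay.continuous_absorption (hρ : 0 < ρ) (hV : SymbolDecay ρ V₁)
    (hV₂ : Continuous V₂) : Continuous fun x : ℝ × Phase n => absorption V₁ V₂ x.1 x.2 :=
  intervalIntegral.continuous_parametric_intervalIntegral_of_continuous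
    (f := fun (x : ℝ × Phase n) s => V₂ (hamFlow V₁ s x.2).1)
    ((hV.continuous_absorption_integrand hρ hV₂).comp
      (by fun_prop : Continuous fun x : (ℝ × Phase n) × ℝ => (x.1.2, x.2))) continuous_fst

lemma absorption_nonneg (hV₂ : ∀ x, 0 ≤ V₂ x) {t : ℝ} (ht : 0 ≤ t) (w : Phase n) :
    0 ≤ absorption V₁ V₂ t w :=
  intervalIntegral.integral_nonneg ht fun _ _ => hV₂ _

/-- Along a trajectory which is bounded at positive times, the accumulated absorption diverges. -/
lemma TrappedMeetsAbsorption.tendsto_absorption (htrap : TrappedMeetsAbsorption V₁ V₂ E₀)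
    (hρ : 0 < ρ) (hV : SymbolDecay ρ V₁) (hV₂ : Continuous V₂) (hV₂0 : ∀ x, 0 ≤ V₂ x)
    {w : Phase n} (hw : hamSymbol V₁ w = E₀)
    (hbdd : Bornology.IsBounded ((fun t => hamFlow V₁ t w) '' Ici 0)) :
    Tendsto (fun t => absorption V₁ V₂ t w) atTop atTop := by
  have hmono : ∀ s t, s ≤ t → absorption V₁ V₂ s w ≤ absorption V₁ V₂ t w := fun s t hst => by
    have := hV.absorption_add hρ hV₂ (t - s) s w
    rw [sub_add_cancel] at this
    linarith [absorption_nonneg (V₁ := V₁) hV₂0 (sub_nonneg.2 hst) (hamFlow V₁ s w)]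
  rcases tendsto_atTop_of_monotone (fun s t => hmono s t) with h | ⟨L, hL⟩
  · exact h
  exfalso
  -- Suppose that the nondecreasing absorption has a finite limit `L`, and take an accumulation
  -- point `w'` of the trajectory at integer times.
  obtain ⟨w', -, k, hk, hlim⟩ := hbdd.isCompact_closure.tendsto_subseq
    (x := fun k : ℕ => hamFlow V₁ k w)
    (fun k => subset_closure ⟨k, mem_Ici.2 (Nat.cast_nonneg k), rfl⟩)
  have hk' : Tendsto (fun j => (k j : ℝ)) atTop atTop :=
    tendsto_natCast_atTop_atTop.comp hk.tendsto_atTop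
  have hw'E : hamSymbol V₁ w' = E₀ := by
    refine tendsto_nhds_unique ((hV.continuous_hamSymbol.tendsto w').comp hlim) ?_
    refine tendsto_const_nhds.congr fun j => ?_
    simp [hV.hamSymbol_hamFlow hρ, hw]
  -- The trajectory of `w'` is bounded in both time directions although that of `w` is only known to
  -- be so in the future: for each `s` of either sign, `s + k j` is eventually nonnegative.
  have hw'b : Bornology.IsBounded (range fun t => hamFlow V₁ t w') := by
    refine hbdd.closure.subset ?_
    rintro _ ⟨s, rfl⟩
    refine mem_closure_of_tendsto (((hV.continuous_hamFlow hρ s).tendsto w').comp hlim) ?_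
    filter_upwards [hk'.eventually_ge_atTop (-s)] with j hj
    exact ⟨s + k j, by simp only [mem_Ici]; linarith, by simp [hV.hamFlow_add hρ]⟩
  obtain ⟨s, hs⟩ := (htrap w' hw'E).resolve_left (not_not_intro hw'b)
  set w'' := hamFlow V₁ s w' with hw''
  have hpos : 0 < absorption V₁ V₂ 1 w'' := by
    refine intervalIntegral.integral_pos one_pos ?_ (fun x _ => hV₂0 _) ⟨0, by simp, ?_⟩
    · exact ((hV.continuous_absorption_integrand hρ hV₂).comp
        (by fun_prop : Continuous fun s : ℝ => (w'', s))).continuousOn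
    · rwa [hV.hamFlow_zero hρ]
  have hcont : Continuous fun v => absorption V₁ V₂ 1 (hamFlow V₁ s v) :=
    (hV.continuous_absorption hρ hV₂).comp (continuous_const.prodMk (hV.continuous_hamFlow hρ s))
  have hl1 := (hcont.tendsto w').comp hlim
  -- The absorption over the unit time windows starting at `s + k j` tends to `L - L = 0`, but by
  -- continuity also to the positive absorption that follows `w''`.
  have hl2 : Tendsto (fun j => absorption V₁ V₂ (1 + (s + k j)) w -
      absorption V₁ V₂ (s + k j) w) atTop (𝓝 (L - L)) :=
    (hL.comp (tendsto_atTop_add_const_left _ _ (tendsto_atTop_add_const_left _ _ hk'))).sub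
      (hL.comp (tendsto_atTop_add_const_left _ _ hk'))
  have heq := tendsto_nhds_unique hl1 (hl2.congr fun j => by
    simp only [Function.comp_apply]
    rw [hV.absorption_add hρ hV₂, hV.hamFlow_add hρ]; ring)
  rw [sub_self] at heq
  exact hpos.ne' heq

/-! ### The damped pullback of a function by the flow -/

/-- The function `q(φᵗ(w)) exp(-2tb - 2 ∫₀ᵗ V₂(x̄(s, w)) ds)`. -/
noncomputable def dampedPullback (V₁ V₂ : Config n → ℝ) (b : ℝ) (q : Phase n → ℂ) (t : ℝ)
    (w : Phase n) : ℂ :=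
  q (hamFlow V₁ t w) * (Real.exp (-2 * t * b - 2 * absorption V₁ V₂ t w) : ℂ)

lemma SymbolDecay.continuous_dampedPullback (hρ : 0 < ρ) (hV : SymbolDecay ρ V₁)
    (hV₂ : Continuous V₂) (b : ℝ) {q : Phase n → ℂ} (hq : Continuous q) :
    Continuous fun x : ℝ × Phase n => dampedPullback V₁ V₂ b q x.1 x.2 := by
  have h1 := hV.continuous_absorption hρ hV₂
  have h2 := hV.continuous_uncurry_hamFlow hρ
  unfold dampedPullback
  fun_prop

lemma norm_dampedPullback_le (hV₂ : ∀ x, 0 ≤ V₂ x) {b : ℝ} (hb : 0 ≤ b) (q : Phase n → ℂ) {t : ℝ}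
    (ht : 0 ≤ t) (w : Phase n) : ‖dampedPullback V₁ V₂ b q t w‖ ≤ ‖q (hamFlow V₁ t w)‖ := by
  unfold dampedPullback
  rw [norm_mul, Complex.norm_real, Real.norm_eq_abs, Real.abs_exp]
  refine mul_le_of_le_one_right (norm_nonneg _) (Real.exp_le_one_iff.2 ?_)
  have h1 := absorption_nonneg (V₁ := V₁) hV₂ ht w
  have h2 := mul_nonneg ht hb
  linarith

/-- On the energy surface, damped pullbacks of compactly supported functions vanish in the limit
of large times. -/
lemma TrappedMeetsAbsorption.tendsto_dampedPullback (htrap : TrappedMeetsAbsorption V₁ V₂ E₀)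
    (hρ : 0 < ρ) (hV : SymbolDecay ρ V₁) (hV₂ : Continuous V₂) (hV₂0 : ∀ x, 0 ≤ V₂ x)
    (hE₀ : 0 < E₀) {b : ℝ} (hb : 0 ≤ b) {q : Phase n → ℂ} (hq : Continuous q)
    (hqc : HasCompactSupport q) {w : Phase n} (hw : hamSymbol V₁ w = E₀) :
    Tendsto (fun t => dampedPullback V₁ V₂ b q t w) atTop (𝓝 0) := by
  rcases hV.tendsto_or_isBounded hρ hE₀ hw with h | h
  · obtain ⟨B, hB⟩ := hqc.isCompact.isBounded.exists_norm_le
    refine tendsto_const_nhds.congr' ?_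
    filter_upwards [h.eventually_gt_atTop B] with t ht
    have : q (hamFlow V₁ t w) = 0 := by
      by_contra hne
      have h1 := hB _ (subset_tsupport q hne)
      have h2 : ‖(hamFlow V₁ t w).1‖ ≤ ‖hamFlow V₁ t w‖ := norm_fst_le _
      linarith
    simp [dampedPullback, this]
  · have habs := htrap.tendsto_absorption hρ hV hV₂ hV₂0 hw h
    obtain ⟨C, hC⟩ := hq.bounded_above_of_compact_support hqc
    have hC0 : 0 ≤ C := (norm_nonneg _).trans (hC w)
    rw [tendsto_zero_iff_norm_tendsto_zero]
    have hlim : Tendsto (fun t => C * Real.exp (-absorption V₁ V₂ t w)) atTop (𝓝 0) := by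
      simpa using (Real.tendsto_exp_neg_atTop_nhds_zero.comp habs).const_mul C
    refine squeeze_zero' (Eventually.of_forall fun t => norm_nonneg _) ?_ hlim
    filter_upwards [eventually_ge_atTop 0] with t ht
    unfold dampedPullback
    rw [norm_mul, Complex.norm_real, Real.norm_eq_abs, Real.abs_exp]
    gcongr
    · exact hC _
    · have h1 := absorption_nonneg (V₁ := V₁) hV₂0 ht w
      have h2 := mul_nonneg ht hb
      linarith

end Dynamics

/-! ### Mollification -/

/-- Convolution with a smooth bump: a smooth function whose values and increments are averages of
values and increments of `Q` over balls of radius `ε`. -/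
lemma exists_mollification {G : Type*} [NormedAddCommGroup G] [NormedSpace ℝ G]
    [FiniteDimensional ℝ G] {F : Type*} [NormedAddCommGroup F] [NormedSpace ℝ F] [CompleteSpace F]
    {Q : G → F} (hQ : Continuous Q) {ε : ℝ} (hε : 0 < ε) :
    ∃ P : G → F, ContDiff ℝ ∞ P ∧
      (∀ x z δ, 0 ≤ δ → (∀ y ∈ Metric.ball x ε, ‖Q y - z‖ ≤ δ) → ‖P x - z‖ ≤ δ) ∧
      (∀ x v z δ, 0 ≤ δ → (∀ y ∈ Metric.ball x ε, ‖Q (y + v) - Q y - z‖ ≤ δ) →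
        ‖P (x + v) - P x - z‖ ≤ δ) := by
  borelize G
  let μ : Measure G := Measure.addHaar
  let η : ContDiffBump (0 : G) := ⟨ε / 2, ε, by positivity, by linarith⟩
  have hcs : HasCompactSupport (η.normed μ) := η.hasCompactSupport_normed
  have hav : ∀ (g : G → F) (x : G) (z : F) (δ : ℝ), Continuous g → 0 ≤ δ →
      (∀ y ∈ Metric.ball x ε, dist (g y) z ≤ δ) →
      dist (convolution (η.normed μ) g (ContinuousLinearMap.lsmul ℝ ℝ) μ x) z ≤ δ := by
    intro g x z δ hg hδ h
    exact dist_convolution_le hδ (η.support_normed_eq (μ := μ)).subset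
      (fun x => η.nonneg_normed (μ := μ) x) (η.integral_normed (μ := μ))
      hg.aestronglyMeasurable h
  refine ⟨convolution (η.normed μ) Q (ContinuousLinearMap.lsmul ℝ ℝ) μ, ?_, ?_, ?_⟩
  · exact hcs.contDiff_convolution_left _ (η.contDiff_normed) hQ.locallyIntegrable
  · intro x z δ hδ h
    simpa only [dist_eq_norm] using hav Q x z δ hQ hδ (by simpa only [dist_eq_norm] using h)
  · intro x v z δ hδ h
    have hQv : Continuous fun y => Q (y + v) := by fun_prop
    have h1 := hav (fun y => Q (y + v) - Q y) x z δ (by fun_prop) hδ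
      (by simpa only [dist_eq_norm] using h)
    have hex : ∀ {g : G → F} (x), Continuous g → Integrable
        (fun t => (ContinuousLinearMap.lsmul ℝ ℝ (η.normed μ t)) (g (x - t))) μ := by
      intro g x hg
      exact hcs.convolutionExists_left (ContinuousLinearMap.lsmul ℝ ℝ) η.continuous_normed
        hg.locallyIntegrable x
    have h2 : convolution (η.normed μ) (fun y => Q (y + v) - Q y)
        (ContinuousLinearMap.lsmul ℝ ℝ) μ x =
        convolution (η.normed μ) Q (ContinuousLinearMap.lsmul ℝ ℝ) μ (x + v) -
        convolution (η.normed μ) Q (ContinuousLinearMap.lsmul ℝ ℝ) μ x := by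
      simp only [convolution_def]
      have h3 : ∀ t, x + v - t = x - t + v := fun t => by abel
      simp only [h3, map_sub]
      exact integral_sub (hex (g := fun y => Q (y + v)) x hQv) (hex x hQ)
    rw [h2, dist_eq_norm] at h1
    exact h1

/-- A sequence of mollifications of a continuous function with compact support. -/
lemma exists_mollification_seq {G : Type*} [NormedAddCommGroup G] [NormedSpace ℝ G]
    [FiniteDimensional ℝ G] {F : Type*} [NormedAddCommGroup F] [NormedSpace ℝ F] [CompleteSpace F]
    {Q : G → F} (hQ : Continuous Q) (hQc : HasCompactSupport Q) :
    ∃ (P : ℕ → G → F) (K : Set G), IsCompact K ∧ (∀ k, ContDiff ℝ ∞ (P k)) ∧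
      (∀ k, tsupport (P k) ⊆ K) ∧
      (∀ B, (∀ w, ‖Q w‖ ≤ B) → ∀ k w, ‖P k w‖ ≤ B) ∧
      (∀ w, Tendsto (fun k => P k w) atTop (𝓝 (Q w))) ∧
      (∀ (k : ℕ) x v z δ, 0 ≤ δ →
        (∀ y ∈ Metric.ball x (1 / (k + 1)), ‖Q (y + v) - Q y - z‖ ≤ δ) →
        ‖P k (x + v) - P k x - z‖ ≤ δ) := by
  have : ProperSpace G := FiniteDimensional.proper ℝ G
  have hε : ∀ k : ℕ, (0 : ℝ) < 1 / (k + 1) := fun k => by positivity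
  choose P hPs hPv hPi using fun k => exists_mollification hQ (hε k)
  have hPsupp : ∀ k, Function.support (P k) ⊆ Metric.cthickening 1 (tsupport Q) := by
    intro k x hx
    by_contra hxK
    refine hx ?_
    have := hPv k x 0 0 le_rfl fun y hy => ?_
    · simpa using this
    · rw [sub_zero, image_eq_zero_of_notMem_tsupport (f := Q), norm_zero]
      intro hy'
      refine hxK (Metric.mem_cthickening_of_dist_le x y 1 _ hy' ?_)
      rw [dist_comm]
      have h1 : (1 : ℝ) / (k + 1) ≤ 1 := by
        rw [div_le_one (by positivity)]; linarith [(Nat.cast_nonneg k : (0 : ℝ) ≤ k)]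
      exact (Metric.mem_ball.1 hy).le.trans h1
  refine ⟨P, Metric.cthickening 1 (tsupport Q), hQc.isCompact.cthickening, hPs,
    fun k => closure_minimal (hPsupp k) Metric.isClosed_cthickening, ?_, ?_, hPi⟩
  · intro B hB k w
    simpa using hPv k w 0 B ((norm_nonneg _).trans (hB 0)) fun y _ => by simpa using hB y
  · intro w
    rw [Metric.tendsto_atTop']
    intro δ hδ
    obtain ⟨r, hr, hball⟩ := Metric.continuousAt_iff.1 (hQ.continuousAt (x := w))
      (δ / 2) (half_pos hδ)
    obtain ⟨k₀, hk₀⟩ := eventually_atTop.1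
      ((tendsto_one_div_add_atTop_nhds_zero_nat (𝕜 := ℝ)).eventually_lt_const hr)
    refine ⟨k₀, fun k hk => ?_⟩
    have := hPv k w (Q w) (δ / 2) (half_pos hδ).le fun y hy => by
      rw [← dist_eq_norm]
      exact (hball ((Metric.mem_ball.1 hy).trans (hk₀ k hk.le))).le
    rw [dist_eq_norm]
    linarith

/-! ### The weak Liouville equation for Lipschitz functions. -/

section Liouville

variable {n : ℕ} {ρ : ℝ} {V₁ : Config n → ℝ}

/-- A Lipschitz function which is differentiable along the flow with a continuous derivative
has this derivative as a directional derivative, locally uniformly. -/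
lemma SymbolDecay.norm_increment_sub_le (hρ : 0 < ρ) (hV : SymbolDecay ρ V₁) {Q DQ : Phase n → ℂ}
    {L : NNReal} (hQ : LipschitzWith L Q) (hDQ : Continuous DQ)
    (hder : ∀ w, HasDerivAt (fun s => Q (hamFlow V₁ s w)) (DQ w) 0) (w : Phase n) {δ : ℝ}
    (hδ : 0 < δ) : ∃ r > 0, ∀ w' ∈ Metric.ball w r, ∀ t ∈ Ioo 0 r,
      ‖Q (w' + t • hamField V₁ w) - Q w' - t • DQ w‖ ≤ t * δ := by
  have hφ := hV.continuous_uncurry_hamFlow hρ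
  have hder' : ∀ w s, HasDerivAt (fun s => Q (hamFlow V₁ s w)) (DQ (hamFlow V₁ s w)) s := by
    intro w s
    have h1 := hder (hamFlow V₁ s w)
    rw [← sub_self s] at h1
    have h2 := h1.comp_sub_const s s
    refine h2.congr_of_eventuallyEq (Eventually.of_forall fun r => ?_)
    simp only [← hV.hamFlow_add hρ, sub_add_cancel]
  have hc1 : ContinuousAt (fun x : ℝ × Phase n => ‖DQ (hamFlow V₁ x.1 x.2) - DQ w‖) (0, w) := by
    exact ((hDQ.comp hφ).sub continuous_const).norm.continuousAt
  have hc2 : ContinuousAt (fun x : ℝ × Phase n =>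
      ‖hamField V₁ (hamFlow V₁ x.1 x.2) - hamField V₁ w‖) (0, w) :=
    ((hV.contDiff_hamField.continuous.comp hφ).sub continuous_const).norm.continuousAt
  have hL : (0 : ℝ) ≤ L := L.2
  have he1 : ∀ᶠ x in 𝓝 ((0 : ℝ), w), ‖DQ (hamFlow V₁ x.1 x.2) - DQ w‖ < δ / 2 :=
    hc1.eventually_lt_const (by simpa [hV.hamFlow_zero hρ] using hδ)
  -- The straight step `t • hamField V₁ w` replaces the flow for time `t`. The error in position
  -- costs a factor `L` in the value of `Q`, hence the tolerance `δ / (2(L + 1))`; the other `δ / 2`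
  -- pays for freezing `DQ` at `w`.
  have he2 : ∀ᶠ x in 𝓝 ((0 : ℝ), w),
      ‖hamField V₁ (hamFlow V₁ x.1 x.2) - hamField V₁ w‖ < δ / (2 * (L + 1)) :=
    hc2.eventually_lt_const (by simp only [hV.hamFlow_zero hρ, sub_self, norm_zero]; positivity)
  obtain ⟨r, hr, hball⟩ := Metric.eventually_nhds_iff.1 (he1.and he2)
  refine ⟨r, hr, fun w' hw' t ht => ?_⟩
  have hmem : ∀ s ∈ Icc 0 t, dist (s, w') ((0 : ℝ), w) < r := fun s hs => by
    rw [Prod.dist_eq, max_lt_iff]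
    refine ⟨?_, hw'⟩
    simp only [Real.dist_eq, sub_zero, abs_of_nonneg hs.1]
    exact hs.2.trans_lt ht.2
  have h1 : ‖(Q (hamFlow V₁ t w') - t • DQ w) - (Q (hamFlow V₁ 0 w') - (0 : ℝ) • DQ w)‖
      ≤ δ / 2 * (t - 0) := by
    refine norm_image_sub_le_of_norm_deriv_le_segment'
      (f := fun s => Q (hamFlow V₁ s w') - s • DQ w)
      (f' := fun s => DQ (hamFlow V₁ s w') - DQ w) (fun s _ => ?_)
      (fun s hs => (hball (hmem s (Ico_subset_Icc_self hs))).1.le) t ⟨ht.1.le, le_rfl⟩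
    simpa using ((hder' w' s).fun_sub ((hasDerivAt_id' s).smul_const (DQ w))).hasDerivWithinAt
  have h2 : ‖(hamFlow V₁ t w' - t • hamField V₁ w) -
      (hamFlow V₁ 0 w' - (0 : ℝ) • hamField V₁ w)‖ ≤ δ / (2 * (L + 1)) * (t - 0) := by
    refine norm_image_sub_le_of_norm_deriv_le_segment'
      (f := fun s => hamFlow V₁ s w' - s • hamField V₁ w)
      (f' := fun s => hamField V₁ (hamFlow V₁ s w') - hamField V₁ w) (fun s _ => ?_)
      (fun s hs => (hball (hmem s (Ico_subset_Icc_self hs))).2.le) t ⟨ht.1.le, le_rfl⟩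
    simpa using ((hV.hasDerivAt_hamFlow hρ w' s).fun_sub
      ((hasDerivAt_id' s).smul_const (hamField V₁ w))).hasDerivWithinAt
  rw [hV.hamFlow_zero hρ, zero_smul, sub_zero, sub_zero] at h1 h2
  have h3 := hQ.dist_le_mul (w' + t • hamField V₁ w) (hamFlow V₁ t w')
  rw [dist_comm (w' + _), dist_eq_norm, dist_eq_norm] at h3
  have h4 : hamFlow V₁ t w' - (w' + t • hamField V₁ w) =
      hamFlow V₁ t w' - t • hamField V₁ w - w' := by abel
  rw [h4] at h3
  have h5 : Q (w' + t • hamField V₁ w) - Q w' - t • DQ w =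
      (Q (w' + t • hamField V₁ w) - Q (hamFlow V₁ t w')) +
        (Q (hamFlow V₁ t w') - t • DQ w - Q w') := by abel
  have h6 : (L : ℝ) * (δ / (2 * (L + 1)) * t) ≤ δ / 2 * t := by
    have : (L : ℝ) * (δ / (2 * (L + 1)) * t) = δ / 2 * t * (L / (L + 1)) := by field_simp
    rw [this]
    refine mul_le_of_le_one_right (by have := ht.1; positivity) ?_
    rw [div_le_one (by positivity)]; linarith
  rw [h5]
  calc _ ≤ L * (δ / (2 * (L + 1)) * t) + δ / 2 * t := by
        refine (norm_add_le _ _).trans (add_le_add (h3.trans ?_) h1)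
        gcongr
    _ ≤ t * δ := by linarith

/-- The weak Liouville equation extends from test functions to Lipschitz functions with compact
support which have a continuous derivative along the flow. -/
theorem SymbolDecay.liouville_of_lipschitz (hρ : 0 < ρ) (hV : SymbolDecay ρ V₁)
    {ν μ : Measure (Phase n)} [IsLocallyFiniteMeasure ν] {a c : Phase n → ℂ} (ha : Continuous a)
    (hc : Integrable c μ)
    (hweak : ∀ q, IsTestFunction q →
      ∫ w, (-poissonP V₁ q w + a w * q w) ∂ν = ∫ w, c w * q w ∂μ)
    {Q DQ : Phase n → ℂ} {L : NNReal} (hQ : LipschitzWith L Q) (hQc : HasCompactSupport Q)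
    (hDQ : Continuous DQ)
    (hder : ∀ w, HasDerivAt (fun s => Q (hamFlow V₁ s w)) (DQ w) 0) :
    ∫ w, (-DQ w + a w * Q w) ∂ν = ∫ w, c w * Q w ∂μ := by
  obtain ⟨B, hB⟩ := hQ.continuous.bounded_above_of_compact_support hQc
  obtain ⟨P, K, hKc, hPs, hPts, hPB', hPlim, hPi⟩ := exists_mollification_seq hQ.continuous hQc
  have hPB := hPB' B hB
  have hPc : ∀ k, HasCompactSupport (P k) := fun k =>
    hKc.of_isClosed_subset (isClosed_tsupport _) (hPts k)
  have hPsupp : ∀ k, Function.support (P k) ⊆ K := fun k => subset_closure.trans (hPts k)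
  have hε0 : Tendsto (fun k : ℕ => (1 : ℝ) / (k + 1)) atTop (𝓝 0) :=
    tendsto_one_div_add_atTop_nhds_zero_nat
  have hPL : ∀ k, LipschitzWith L (P k) := fun k => by
    refine LipschitzWith.of_dist_le_mul fun x y => ?_
    have := hPi k y (x - y) 0 (L * ‖x - y‖) (by positivity) fun z _ => by
      have := hQ.dist_le_mul (z + (x - y)) z
      simpa [dist_eq_norm] using this
    simpa [dist_eq_norm] using this
  -- Increments of `P k` at `w` are averages of increments of `Q` at nearby points in the same
  -- direction `hamField V₁ w`. The uniform increment estimate thus passes to the difference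
  -- quotients of `P k`, without `Q` being differentiable in other directions.
  have hdlim : ∀ w, Tendsto (fun k => poissonP V₁ (P k) w) atTop (𝓝 (DQ w)) := by
    intro w
    rw [Metric.tendsto_atTop']
    intro δ hδ
    obtain ⟨r, hr, hball⟩ := hV.norm_increment_sub_le hρ hQ hDQ hder w (half_pos hδ)
    obtain ⟨k₀, hk₀⟩ := eventually_atTop.1 (hε0.eventually_lt_const hr)
    refine ⟨k₀, fun k hk => ?_⟩
    have hlim : Tendsto (fun t : ℝ => t⁻¹ • (P k (w + t • hamField V₁ w) - P k w)) (𝓝[>] 0)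
        (𝓝 (poissonP V₁ (P k) w)) := by
      have h1 : HasFDerivAt (P k) (fderiv ℝ (P k) w) w :=
        ((hPs k).differentiable (by simp) w).hasFDerivAt
      have h2 := (h1.hasLineDerivAt (hamField V₁ w)).tendsto_slope_zero_right
      simpa [poissonP] using h2
    have hle : ‖poissonP V₁ (P k) w - DQ w‖ ≤ δ / 2 := by
      refine le_of_tendsto (hlim.sub_const (DQ w)).norm ?_
      filter_upwards [Ioo_mem_nhdsGT hr] with t ht
      have h3 := hPi k w (t • hamField V₁ w) (t • DQ w) (t * (δ / 2))
        (by have := ht.1; positivity)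
        fun y hy => hball y ((Metric.mem_ball.1 hy).trans (hk₀ k hk.le)) t ht
      have h4 : t⁻¹ • (P k (w + t • hamField V₁ w) - P k w) - DQ w =
          t⁻¹ • (P k (w + t • hamField V₁ w) - P k w - t • DQ w) := by
        rw [smul_sub t⁻¹ (_ - _) (t • _), inv_smul_smul₀ ht.1.ne']
      rw [h4, norm_smul, norm_inv, Real.norm_eq_abs, abs_of_pos ht.1, inv_mul_le_iff₀ ht.1]
      exact h3
    rw [dist_eq_norm]
    linarith
  have hX : Continuous (hamField V₁) := hV.contDiff_hamField.continuous
  have hpc : ∀ k, Continuous (poissonP V₁ (P k)) := fun k =>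
    ((hPs k).continuous_fderiv (by simp)).clm_apply hX
  have hlhs : Tendsto (fun k => ∫ w, (-poissonP V₁ (P k) w + a w * P k w) ∂ν) atTop
      (𝓝 (∫ w, (-DQ w + a w * Q w) ∂ν)) := by
    -- The mollifications share the Lipschitz constant `L`, the bound `B` and a compact set `K`
    -- containing their supports, which provides the dominating function.
    refine tendsto_integral_of_dominated_convergence
      (K.indicator fun w => L * ‖hamField V₁ w‖ + ‖a w‖ * B)
      (fun k => ((hpc k).neg.add (ha.mul (hPs k).continuous)).aestronglyMeasurable) ?_ ?_ ?_
    · rw [integrable_indicator_iff hKc.measurableSet]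
      exact ContinuousOn.integrableOn_compact hKc (by fun_prop)
    · refine fun k => Eventually.of_forall fun w => ?_
      by_cases hw : w ∈ K
      · rw [indicator_of_mem hw]
        refine (norm_add_le _ _).trans ?_
        rw [norm_neg, norm_mul]
        gcongr
        · exact ((fderiv ℝ (P k) w).le_opNorm _).trans (by
            gcongr; exact norm_fderiv_le_of_lipschitz ℝ (hPL k))
        · exact hPB k w
      · have h1 : P k w = 0 := by
          by_contra h; exact hw (hPsupp k h)
        have h2 : fderiv ℝ (P k) w = 0 := by
          by_contra h
          exact hw (hPts k (support_fderiv_subset ℝ h))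
        simp [hw, h1, h2, poissonP]
    · exact Eventually.of_forall fun w => (hdlim w).neg.add ((hPlim w).const_mul _)
  have hrhs : Tendsto (fun k => ∫ w, c w * P k w ∂μ) atTop (𝓝 (∫ w, c w * Q w ∂μ)) := by
    refine tendsto_integral_of_dominated_convergence (fun w => ‖c w‖ * B)
      (fun k => hc.aestronglyMeasurable.mul (hPs k).continuous.aestronglyMeasurable)
      (hc.norm.mul_const B) ?_ ?_
    · refine fun k => Eventually.of_forall fun w => ?_
      rw [norm_mul]
      gcongr
      exact hPB k w
    · exact Eventually.of_forall fun w => (hPlim w).const_mul _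
  exact tendsto_nhds_unique (hlhs.congr fun k => hweak (P k) ⟨hPs k, hPc k⟩) hrhs

end Liouville

/-! ### Integrals over trajectories -/

section Accumulated

variable {n : ℕ} {ρ : ℝ} {V₁ V₂ : Config n → ℝ} {b : ℝ} {q : Phase n → ℂ}

/-- The function `∫₀ᵀ q(φᵗ(w)) exp(-2tb - 2 ∫₀ᵗ V₂(x̄(s, w)) ds) dt`. -/
noncomputable def accumulatedPullback (V₁ V₂ : Config n → ℝ) (b : ℝ) (q : Phase n → ℂ) (T : ℝ)
    (w : Phase n) : ℂ :=
  ∫ t in (0 : ℝ)..T, dampedPullback V₁ V₂ b q t w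

lemma SymbolDecay.dampedPullback_zero (hρ : 0 < ρ) (hV : SymbolDecay ρ V₁) (w : Phase n) :
    dampedPullback V₁ V₂ b q 0 w = q w := by
  simp [dampedPullback, absorption, hV.hamFlow_zero hρ]

/-- By the cocycle identity, moving the base point along the flow is a shift in time, up to an
explicit factor independent of `t`. -/
lemma SymbolDecay.dampedPullback_hamFlow (hρ : 0 < ρ) (hV : SymbolDecay ρ V₁)
    (hV₂ : Continuous V₂) (s t : ℝ) (w : Phase n) :
    dampedPullback V₁ V₂ b q t (hamFlow V₁ s w) =
      (Real.exp (2 * s * b + 2 * absorption V₁ V₂ s w) : ℂ) *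
        dampedPullback V₁ V₂ b q (t + s) w := by
  unfold dampedPullback
  rw [hV.absorption_add hρ hV₂ t s, hV.hamFlow_add hρ t s, mul_left_comm, ← Complex.ofReal_mul,
    ← Real.exp_add]
  congr 3
  ring_nf

lemma SymbolDecay.hasDerivAt_absorption (hρ : 0 < ρ) (hV : SymbolDecay ρ V₁)
    (hV₂ : Continuous V₂) (t : ℝ) (w : Phase n) :
    HasDerivAt (fun t => absorption V₁ V₂ t w) (V₂ (hamFlow V₁ t w).1) t :=
  (((hV.continuous_absorption_integrand hρ hV₂).comp
    (by fun_prop : Continuous fun s : ℝ => (w, s)))).integral_hasStrictDerivAt 0 t |>.hasDerivAt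

lemma SymbolDecay.continuous_dampedPullback_time (hρ : 0 < ρ) (hV : SymbolDecay ρ V₁)
    (hV₂ : Continuous V₂) (hq : Continuous q) (w : Phase n) :
    Continuous fun t => dampedPullback V₁ V₂ b q t w :=
  (hV.continuous_dampedPullback hρ hV₂ b hq).comp (by fun_prop : Continuous fun t : ℝ => (t, w))

lemma SymbolDecay.continuous_dampedPullback_right (hρ : 0 < ρ) (hV : SymbolDecay ρ V₁)
    (hV₂ : Continuous V₂) (hq : Continuous q) (t : ℝ) :
    Continuous (dampedPullback V₁ V₂ b q t) :=
  (hV.continuous_dampedPullback hρ hV₂ b hq).comp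
    (by fun_prop : Continuous fun w : Phase n => (t, w))

lemma SymbolDecay.continuous_accumulatedPullback (hρ : 0 < ρ) (hV : SymbolDecay ρ V₁)
    (hV₂ : Continuous V₂) (hq : Continuous q) (T : ℝ) :
    Continuous (accumulatedPullback V₁ V₂ b q T) :=
  intervalIntegral.continuous_parametric_intervalIntegral_of_continuous'
    (f := fun w t => dampedPullback V₁ V₂ b q t w)
    ((hV.continuous_dampedPullback hρ hV₂ b hq).comp continuous_swap) 0 T

/-- The transport equation satisfied by `accumulatedPullback`. -/
lemma SymbolDecay.hasDerivAt_accumulatedPullback (hρ : 0 < ρ) (hV : SymbolDecay ρ V₁)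
    (hV₂ : Continuous V₂) (hq : Continuous q) (T : ℝ) (w : Phase n) :
    HasDerivAt (fun s => accumulatedPullback V₁ V₂ b q T (hamFlow V₁ s w))
      (((2 * b + 2 * V₂ w.1 : ℝ) : ℂ) * accumulatedPullback V₁ V₂ b q T w
        + dampedPullback V₁ V₂ b q T w - q w) 0 := by
  have hD := hV.continuous_dampedPullback_time (b := b) hρ hV₂ hq w
  have hF : ∀ u, HasDerivAt (fun u => accumulatedPullback V₁ V₂ b q u w)
      (dampedPullback V₁ V₂ b q u w) u := fun u => (hD.integral_hasStrictDerivAt 0 u).hasDerivAt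
  have hI : ∀ a b' : ℝ, IntervalIntegrable (fun t => dampedPullback V₁ V₂ b q t w) volume a b' :=
    fun a b' => hD.intervalIntegrable a b'
  -- The window `[0, T]` becomes `[s, T + s]`, so the dependence on `s` is through the endpoints and
  -- the exponential factor alone, and `q` need not be differentiated.
  have heq : ∀ s, accumulatedPullback V₁ V₂ b q T (hamFlow V₁ s w) =
      (Real.exp (2 * s * b + 2 * absorption V₁ V₂ s w) : ℂ) *
        (accumulatedPullback V₁ V₂ b q (T + s) w - accumulatedPullback V₁ V₂ b q s w) := by
    intro s
    have h1 : accumulatedPullback V₁ V₂ b q T (hamFlow V₁ s w) = ∫ t in (0 : ℝ)..T,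
        (Real.exp (2 * s * b + 2 * absorption V₁ V₂ s w) : ℂ) *
          dampedPullback V₁ V₂ b q (t + s) w :=
      intervalIntegral.integral_congr fun t _ => hV.dampedPullback_hamFlow hρ hV₂ s t w
    rw [h1, intervalIntegral.integral_const_mul,
      intervalIntegral.integral_comp_add_right (fun t => dampedPullback V₁ V₂ b q t w) s, zero_add]
    unfold accumulatedPullback
    rw [intervalIntegral.integral_interval_sub_left (hI _ _) (hI _ _)]
  have hE : HasDerivAt (fun s => Real.exp (2 * s * b + 2 * absorption V₁ V₂ s w))
      (2 * b + 2 * V₂ w.1) 0 := by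
    have h1 := (((hasDerivAt_id' (0 : ℝ)).const_mul 2).mul_const b).fun_add
      ((hV.hasDerivAt_absorption hρ hV₂ 0 w).const_mul 2)
    refine h1.exp.congr_deriv ?_
    simp [hV.hamFlow_zero hρ, absorption]
  have hT : HasDerivAt (fun s => accumulatedPullback V₁ V₂ b q (T + s) w)
      (dampedPullback V₁ V₂ b q T w) 0 := by
    have h1 : HasDerivAt (fun u => accumulatedPullback V₁ V₂ b q u w)
        (dampedPullback V₁ V₂ b q T w) (T + 0) := by rw [add_zero]; exact hF T
    exact h1.comp_const_add T 0
  have h2 := hE.ofReal_comp.fun_mul (hT.fun_sub (hF 0))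
  refine (h2.congr_of_eventuallyEq (Eventually.of_forall heq)).congr_deriv ?_
  rw [hV.dampedPullback_zero hρ]
  simp [absorption, accumulatedPullback]
  ring

/-- Only points reached by flowing `tsupport q` backwards for a time in `[0, T]` matter; they form a
continuous image of a compact set. One set serves all these times. -/
lemma SymbolDecay.hasCompactSupport_dampedPullback (hρ : 0 < ρ) (hV : SymbolDecay ρ V₁)
    (hqc : HasCompactSupport q) (T : ℝ) : ∃ K : Set (Phase n), IsCompact K ∧
      ∀ t ∈ Icc 0 T, ∀ w ∉ K, dampedPullback V₁ V₂ b q t w = 0 := by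
  refine ⟨(fun x : ℝ × Phase n => hamFlow V₁ (-x.1) x.2) '' (Icc 0 T ×ˢ tsupport q),
    (isCompact_Icc.prod hqc.isCompact).image ((hV.continuous_uncurry_hamFlow hρ).comp
      (by fun_prop : Continuous fun x : ℝ × Phase n => (-x.1, x.2))), fun t ht w hw => ?_⟩
  have : q (hamFlow V₁ t w) = 0 := by
    by_contra hne
    exact hw ⟨(t, hamFlow V₁ t w), ⟨ht, subset_tsupport q hne⟩, hV.hamFlow_neg_hamFlow hρ t w⟩
  simp [dampedPullback, this]

lemma SymbolDecay.hasCompactSupport_accumulatedPullback (hρ : 0 < ρ) (hV : SymbolDecay ρ V₁)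
    (hqc : HasCompactSupport q) {T : ℝ} (hT : 0 ≤ T) :
    HasCompactSupport (accumulatedPullback V₁ V₂ b q T) := by
  obtain ⟨K, hK, h⟩ := hV.hasCompactSupport_dampedPullback (V₂ := V₂) (b := b) hρ hqc T
  refine HasCompactSupport.intro hK fun w hw => ?_
  unfold accumulatedPullback
  rw [intervalIntegral.integral_congr (g := fun _ => 0) fun t ht => ?_]
  · simp
  · rw [uIcc_of_le hT] at ht
    exact h t ht w hw

lemma abs_exp_neg_sub_exp_neg_le {u v : ℝ} (hu : 0 ≤ u) (hv : 0 ≤ v) :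
    |Real.exp (-u) - Real.exp (-v)| ≤ |u - v| := by
  have key : ∀ {u v : ℝ}, 0 ≤ u → u ≤ v → Real.exp (-u) - Real.exp (-v) ≤ v - u := by
    intro u v hu huv
    have h1 : Real.exp (-v) = Real.exp (-u) * Real.exp (u - v) := by
      rw [← Real.exp_add]; ring_nf
    have h2 := Real.add_one_le_exp (u - v)
    have h3 : Real.exp (-u) ≤ 1 := Real.exp_le_one_iff.2 (by linarith)
    have h4 := Real.exp_pos (-u)
    rw [h1]
    nlinarith
  rcases le_total u v with h | h
  · have h1 : Real.exp (-v) ≤ Real.exp (-u) := Real.exp_le_exp.2 (by linarith)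
    rw [abs_of_nonneg (by linarith), abs_sub_comm, abs_of_nonneg (by linarith)]
    exact key hu h
  · have h1 : Real.exp (-u) ≤ Real.exp (-v) := Real.exp_le_exp.2 (by linarith)
    rw [abs_sub_comm, abs_of_nonneg (by linarith), abs_of_nonneg (by linarith)]
    exact key hv h

/-- For times in `[0, T]` the flow expands distances by at most `exp(K T)`, and `u ↦ exp(-u)` is
1-Lipschitz on the nonnegative exponents that occur. This makes the accumulated pullback admissible
in the weak equation. -/
lemma SymbolDecay.lipschitzWith_accumulatedPullback (hρ : 0 < ρ) (hV : SymbolDecay ρ V₁)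
    {L₂ : NNReal} (hV₂ : LipschitzWith L₂ V₂) (hV₂0 : ∀ x, 0 ≤ V₂ x) (hb : 0 ≤ b) {L : NNReal}
    (hq : LipschitzWith L q) (hqc : HasCompactSupport q) {T : ℝ} (hT : 0 ≤ T) :
    ∃ C : NNReal, LipschitzWith C (accumulatedPullback V₁ V₂ b q T) := by
  obtain ⟨B, hB⟩ := hq.continuous.bounded_above_of_compact_support hqc
  have hB0 : 0 ≤ B := (norm_nonneg _).trans (hB 0)
  obtain ⟨K, hK⟩ := hV.exists_dist_hamFlow_le hρ
  set e : ℝ := Real.exp (K * T) with he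
  have hflow : ∀ t ∈ Icc 0 T, ∀ w w',
      dist (hamFlow V₁ t w) (hamFlow V₁ t w') ≤ dist w w' * e := by
    intro t ht w w'
    refine (hK t w w').trans ?_
    rw [abs_of_nonneg ht.1]
    have : (K : ℝ) * t ≤ K * T := mul_le_mul_of_nonneg_left ht.2 K.2
    gcongr
    exact Real.exp_le_exp.2 this
  have habs : ∀ t ∈ Icc 0 T, ∀ w w',
      |absorption V₁ V₂ t w - absorption V₁ V₂ t w'| ≤ L₂ * (dist w w' * e) * T := by
    intro t ht w w'
    unfold absorption
    rw [← intervalIntegral.integral_sub (hV.intervalIntegrable_absorption hρ hV₂.continuous _ _ _)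
      (hV.intervalIntegrable_absorption hρ hV₂.continuous _ _ _), ← Real.norm_eq_abs]
    have h1 := intervalIntegral.norm_integral_le_of_norm_le_const (a := 0) (b := t)
      (C := L₂ * (dist w w' * e))
      (f := fun s => V₂ (hamFlow V₁ s w).1 - V₂ (hamFlow V₁ s w').1) fun s hs => ?_
    · refine h1.trans ?_
      rw [sub_zero, abs_of_nonneg ht.1]
      gcongr
      exact ht.2
    · rw [uIoc_of_le ht.1] at hs
      rw [← dist_eq_norm]
      refine (hV₂.dist_le_mul _ _).trans ?_
      gcongr
      refine le_trans ?_ (hflow s ⟨hs.1.le, hs.2.trans ht.2⟩ w w')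
      rw [Prod.dist_eq]
      exact le_max_left _ _
  have hD : ∀ t ∈ Icc 0 T, ∀ w w',
      ‖dampedPullback V₁ V₂ b q t w - dampedPullback V₁ V₂ b q t w'‖ ≤
        (L * e + B * (2 * L₂ * e * T)) * dist w w' := by
    intro t ht w w'
    have hpos : ∀ w, 0 ≤ 2 * t * b + 2 * absorption V₁ V₂ t w := fun w => by
      have := absorption_nonneg (V₁ := V₁) hV₂0 ht.1 w
      have := mul_nonneg ht.1 hb
      linarith
    have hexp : ∀ w, -2 * t * b - 2 * absorption V₁ V₂ t w =
        -(2 * t * b + 2 * absorption V₁ V₂ t w) := fun w => by ring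
    unfold dampedPullback
    rw [hexp, hexp]
    set u := 2 * t * b + 2 * absorption V₁ V₂ t w with hu
    set v := 2 * t * b + 2 * absorption V₁ V₂ t w' with hv
    have h1 : q (hamFlow V₁ t w) * (Real.exp (-u) : ℂ) - q (hamFlow V₁ t w') * (Real.exp (-v) : ℂ)
        = (q (hamFlow V₁ t w) - q (hamFlow V₁ t w')) * (Real.exp (-u) : ℂ)
          + q (hamFlow V₁ t w') * ((Real.exp (-u) - Real.exp (-v) : ℝ) : ℂ) := by
      push_cast; ring
    rw [h1]
    refine (norm_add_le _ _).trans ?_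
    rw [norm_mul, norm_mul, Complex.norm_real, Complex.norm_real, Real.norm_eq_abs,
      Real.norm_eq_abs, Real.abs_exp, ← dist_eq_norm]
    have h2 : Real.exp (-u) ≤ 1 := Real.exp_le_one_iff.2 (by linarith [hpos w])
    have h3 : dist (q (hamFlow V₁ t w)) (q (hamFlow V₁ t w')) ≤ L * (dist w w' * e) :=
      (hq.dist_le_mul _ _).trans (by gcongr; exact hflow t ht w w')
    have h4 : |Real.exp (-u) - Real.exp (-v)| ≤ 2 * (L₂ * (dist w w' * e) * T) := by
      refine (abs_exp_neg_sub_exp_neg_le (hpos w) (hpos w')).trans ?_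
      have : u - v = 2 * (absorption V₁ V₂ t w - absorption V₁ V₂ t w') := by rw [hu, hv]; ring
      rw [this, abs_mul, abs_of_pos (two_pos : (0 : ℝ) < 2)]
      gcongr
      exact habs t ht w w'
    calc _ ≤ L * (dist w w' * e) * 1 + B * (2 * (L₂ * (dist w w' * e) * T)) := by
          gcongr
          exact hB _
      _ = _ := by ring
  have hC : 0 ≤ (L * e + B * (2 * L₂ * e * T)) * T := by positivity
  refine ⟨Real.toNNReal ((L * e + B * (2 * L₂ * e * T)) * T), LipschitzWith.of_dist_le_mul fun w w' => ?_⟩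
  rw [dist_eq_norm, Real.coe_toNNReal _ hC]
  unfold accumulatedPullback
  have hDc := fun w => hV.continuous_dampedPullback_time (b := b) hρ hV₂.continuous hq.continuous w
  rw [← intervalIntegral.integral_sub ((hDc w).intervalIntegrable _ _)
    ((hDc w').intervalIntegrable _ _)]
  have h1 := intervalIntegral.norm_integral_le_of_norm_le_const (a := 0) (b := T)
    (C := (L * e + B * (2 * L₂ * e * T)) * dist w w')
    (f := fun t => dampedPullback V₁ V₂ b q t w - dampedPullback V₁ V₂ b q t w') fun t ht => by
      rw [uIoc_of_le hT] at ht
      exact hD t ⟨ht.1.le, ht.2⟩ w w'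
  refine h1.trans_eq ?_
  rw [sub_zero, abs_of_nonneg hT]
  ring

end Accumulated

/-! ### Consequences of the properties of the semiclassical measure -/

section Core

variable {n : ℕ} {ρ : ℝ} {V₁ V₂ : Config n → ℝ} {E₀ : ℝ}

/-- An open set on which every test function has integral zero is a null set. -/
lemma measure_eq_zero_of_forall_integral_eq_zero {ν : Measure (Phase n)}
    [IsLocallyFiniteMeasure ν] {U : Set (Phase n)} (hU : IsOpen U)
    (h : ∀ q : Phase n → ℂ, IsTestFunction q → tsupport q ⊆ U → ∫ w, q w ∂ν = 0) : ν U = 0 := by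
  refine measure_null_of_locally_null U fun w hw => ?_
  obtain ⟨r, hr, hball⟩ := Metric.isOpen_iff.1 hU w hw
  let f : ContDiffBump w := ⟨r / 4, r / 2, by positivity, by linarith⟩
  have hts : tsupport (fun x => ((f x : ℝ) : ℂ)) ⊆ Metric.closedBall w (r / 2) := by
    rw [← f.tsupport_eq]
    exact closure_mono fun x hx => by simpa using hx
  have h1 := h (fun x => ((f x : ℝ) : ℂ))
    ⟨Complex.ofRealCLM.contDiff.comp f.contDiff,
      (isCompact_closedBall w (r / 2)).of_isClosed_subset (isClosed_tsupport _) hts⟩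
    (hts.trans ((Metric.closedBall_subset_ball (by linarith)).trans hball))
  rw [integral_complex_ofReal, Complex.ofReal_eq_zero] at h1
  have hint : Integrable f ν := f.continuous.integrable_of_hasCompactSupport f.hasCompactSupport
  have h2 := (integral_eq_zero_iff_of_nonneg (fun x => f.nonneg) hint).1 h1
  refine ⟨Metric.ball w (r / 4), mem_nhdsWithin_of_mem_nhds (Metric.ball_mem_nhds _ (by positivity)),
    measure_mono_null (fun x hx => ?_) (ae_iff.1 h2)⟩
  have h3 : f x = 1 := f.one_of_mem_closedBall (Metric.ball_subset_closedBall hx)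
  simp [h3]

/-- The contribution of the points which are carried to the support of `q` after a long time
vanishes. -/
lemma tendsto_integral_dampedPullback (hρ : 0 < ρ) (hV : SymbolDecay ρ V₁)
    (hV₂ : Continuous V₂) (hV₂0 : ∀ x, 0 ≤ V₂ x) (hE₀ : 0 < E₀)
    (htrap : TrappedMeetsAbsorption V₁ V₂ E₀) {b : ℝ} (hb : 0 ≤ b)
    {ν : Measure (Phase n)} [IsLocallyFiniteMeasure ν]
    (hsupp : ν.support ⊆ {w | hamSymbol V₁ w = E₀}) {R₀ : ℝ}
    (hinc : ν {w | R₀ < ‖w.1‖ ∧ ⟪w.1, w.2⟫_ℝ < -(1 / 2) * ‖w.1‖ * ‖w.2‖} = 0)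
    {q : Phase n → ℂ} (hq : Continuous q) (hqc : HasCompactSupport q) :
    Tendsto (fun T => ∫ w, dampedPullback V₁ V₂ b q T w ∂ν) atTop (𝓝 0) := by
  obtain ⟨R₁, hR₁⟩ := hV.exists_isFarRadius hρ hE₀
  obtain ⟨B, hB⟩ := hqc.isCompact.isBounded.exists_norm_le
  obtain ⟨C, hC⟩ := hq.bounded_above_of_compact_support hqc
  obtain ⟨B', hB'⟩ := hV.exists_norm_snd_le hρ E₀
  -- `supp q` lies over `‖x‖ ≤ |B| < R`. A point that starts beyond `2R` and is not incoming keeps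
  -- `‖x‖² > 2R²`, hence never enters `supp q`.
  set R := max R₁ (|B| + 1) with hRdef
  have hR := hR₁.mono (le_max_left R₁ (|B| + 1))
  rw [← hRdef] at hR
  have hRB : |B| + 1 ≤ R := le_max_right _ _
  have hRpos := hR.1
  set R₂ := max R₀ (2 * R) with hR₂
  -- Momenta on the energy surface are bounded by `B'`, so a point of this surface outside `K` has
  -- its position beyond `R₂`.
  set K : Set (Phase n) := Metric.closedBall 0 (max R₂ B') with hK
  have hae : ∀ᵐ w ∂ν, hamSymbol V₁ w = E₀ ∧
      ¬ (R₀ < ‖w.1‖ ∧ ⟪w.1, w.2⟫_ℝ < -(1 / 2) * ‖w.1‖ * ‖w.2‖) := by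
    have h1 : ∀ᵐ w ∂ν, w ∈ ν.support := Measure.support_mem_ae
    have h2 : ∀ᵐ w ∂ν, ¬ (R₀ < ‖w.1‖ ∧ ⟪w.1, w.2⟫_ℝ < -(1 / 2) * ‖w.1‖ * ‖w.2‖) := by
      rw [ae_iff]; simpa only [not_not] using hinc
    filter_upwards [h1, h2] with w hw1 hw2
    exact ⟨hsupp hw1, hw2⟩
  rw [← integral_zero (Phase n) ℂ (μ := ν)]
  refine tendsto_integral_filter_of_dominated_convergence (K.indicator fun _ => C)
    (Eventually.of_forall fun T =>
      (hV.continuous_dampedPullback_right hρ hV₂ hq T).aestronglyMeasurable) ?_ ?_ ?_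
  · filter_upwards [eventually_ge_atTop 0] with T hT
    filter_upwards [hae] with w hw
    by_cases hwK : w ∈ K
    · rw [indicator_of_mem hwK]
      exact (norm_dampedPullback_le hV₂0 hb q hT w).trans (hC _)
    · rw [indicator_of_notMem hwK]
      refine (norm_dampedPullback_le hV₂0 hb q hT w).trans ?_
      have h1 : R₂ < ‖w.1‖ := by
        by_contra! hle
        refine hwK (mem_closedBall_zero_iff.2 ?_)
        exact max_le_max hle (hB' w hw.1)
      have hw0 : R₀ < ‖w.1‖ := (le_max_left _ _).trans_lt h1
      have hw1 : 2 * R < ‖w.1‖ := (le_max_right _ _).trans_lt h1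
      have hin := not_lt.1 fun hlt => hw.2 ⟨hw0, hlt⟩
      have hesc := (hR.hamFlow_escape hρ hV hw.1 (by nlinarith) hin hT).2
      have hq0 : q (hamFlow V₁ T w) = 0 := by
        by_contra hne
        have h2 := hB _ (subset_tsupport q hne)
        have h3 : ‖(hamFlow V₁ T w).1‖ ≤ |B| := (norm_fst_le _).trans (h2.trans (le_abs_self B))
        nlinarith [norm_nonneg (hamFlow V₁ T w).1]
      rw [hq0, norm_zero]
  · rw [integrable_indicator_iff Metric.isClosed_closedBall.measurableSet]
    exact continuousOn_const.integrableOn_compact (isCompact_closedBall _ _)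
  · filter_upwards [hae] with w hw
    exact htrap.tendsto_dampedPullback hρ hV hV₂ hV₂0 hE₀ hb hq hqc hw.1

variable {ν μ : Measure (Phase n)} {b : ℝ} {c : Phase n → ℝ} {q : Phase n → ℂ}

lemma integrable_mul_dampedPullback (hρ : 0 < ρ) (hV : SymbolDecay ρ V₁)
    (hV₂ : Continuous V₂) (hV₂0 : ∀ x, 0 ≤ V₂ x) (hb : 0 ≤ b)
    (hc : Integrable (fun w => (c w : ℂ)) μ) (hq : Continuous q) (hqc : HasCompactSupport q)
    {t : ℝ} (ht : 0 ≤ t) : Integrable (fun w => (c w : ℂ) * dampedPullback V₁ V₂ b q t w) μ := by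
  obtain ⟨C, hC⟩ := hq.bounded_above_of_compact_support hqc
  refine hc.mul_bdd (c := C)
    (hV.continuous_dampedPullback_right hρ hV₂ hq t).aestronglyMeasurable ?_
  exact Eventually.of_forall fun w => (norm_dampedPullback_le hV₂0 hb q ht w).trans (hC _)

lemma integrable_prod_mul_dampedPullback [SFinite μ] (hρ : 0 < ρ) (hV : SymbolDecay ρ V₁)
    (hV₂ : Continuous V₂) (hV₂0 : ∀ x, 0 ≤ V₂ x) (hb : 0 ≤ b)
    (hc : Integrable (fun w => (c w : ℂ)) μ) (hq : Continuous q) (hqc : HasCompactSupport q)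
    (T : ℝ) : Integrable (fun x : ℝ × Phase n => (c x.2 : ℂ) * dampedPullback V₁ V₂ b q x.1 x.2)
      ((volume.restrict (Ioc 0 T)).prod μ) := by
  obtain ⟨C, hC⟩ := hq.bounded_above_of_compact_support hqc
  refine (hc.comp_snd (volume.restrict (Ioc 0 T))).mul_bdd (c := C)
    (hV.continuous_dampedPullback hρ hV₂ b hq).aestronglyMeasurable ?_
  have h1 : ∀ᵐ x ∂((volume.restrict (Ioc 0 T)).prod μ), x.1 ∈ Ioc 0 T :=
    Measure.quasiMeasurePreserving_fst.ae (ae_restrict_mem measurableSet_Ioc)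
  filter_upwards [h1] with x hx
  exact (norm_dampedPullback_le hV₂0 hb q hx.1.le x.2).trans (hC _)

/-- The Duhamel formula for the weak Liouville equation, at finite times. -/
lemma integral_sub_dampedPullback [IsLocallyFiniteMeasure ν] [SFinite μ] (hρ : 0 < ρ)
    (hV : SymbolDecay ρ V₁) {L₂ : NNReal} (hV₂ : LipschitzWith L₂ V₂) (hV₂0 : ∀ x, 0 ≤ V₂ x)
    (hb : 0 ≤ b) (hc : Integrable (fun w => (c w : ℂ)) μ)
    (hweak : ∀ q, IsTestFunction q →
      ∫ w, (-poissonP V₁ q w + ((2 * b + 2 * V₂ w.1 : ℝ) : ℂ) * q w) ∂ν = ∫ w, (c w : ℂ) * q w ∂μ)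
    {L : NNReal} (hq : LipschitzWith L q) (hqc : HasCompactSupport q) {T : ℝ} (hT : 0 ≤ T) :
    ∫ w, q w ∂ν - ∫ w, dampedPullback V₁ V₂ b q T w ∂ν =
      ∫ t in (0 : ℝ)..T, ∫ w, (c w : ℂ) * dampedPullback V₁ V₂ b q t w ∂μ := by
  have hV₂c := hV₂.continuous
  obtain ⟨C, hC⟩ := hV.lipschitzWith_accumulatedPullback hρ hV₂ hV₂0 hb hq hqc hT
  have hD := hV.continuous_dampedPullback_right (b := b) hρ hV₂c hq.continuous T
  have hQ := hV.continuous_accumulatedPullback (b := b) hρ hV₂c hq.continuous T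
  have key := hV.liouville_of_lipschitz hρ
    (a := fun w => ((2 * b + 2 * V₂ w.1 : ℝ) : ℂ)) (by fun_prop) hc hweak hC
    (hV.hasCompactSupport_accumulatedPullback hρ hqc hT)
    (by have := hq.continuous; fun_prop)
    (hV.hasDerivAt_accumulatedPullback hρ hV₂c hq.continuous T)
  have hDc : HasCompactSupport (dampedPullback V₁ V₂ b q T) := by
    obtain ⟨K, hK, h⟩ := hV.hasCompactSupport_dampedPullback (V₂ := V₂) (b := b) hρ hqc T
    exact HasCompactSupport.intro hK (h T ⟨hT, le_rfl⟩)
  -- The zeroth-order terms of the transport equation and of the weak equation cancel.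
  have h1 : ∀ w, -(((2 * b + 2 * V₂ w.1 : ℝ) : ℂ) * accumulatedPullback V₁ V₂ b q T w
      + dampedPullback V₁ V₂ b q T w - q w) +
      ((2 * b + 2 * V₂ w.1 : ℝ) : ℂ) * accumulatedPullback V₁ V₂ b q T w =
      q w - dampedPullback V₁ V₂ b q T w := fun w => by ring
  simp only [h1] at key
  rw [integral_sub (hq.continuous.integrable_of_hasCompactSupport hqc)
    (hD.integrable_of_hasCompactSupport hDc)] at key
  rw [key, intervalIntegral_integral_swap]
  · unfold accumulatedPullback
    simp only [intervalIntegral.integral_const_mul]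
  · rw [uIoc_of_le hT]
    exact integrable_prod_mul_dampedPullback hρ hV hV₂c hV₂0 hb hc hq.continuous hqc T

/-- The explicit formula for a measure which solves the weak Liouville equation, lives on the
energy surface and vanishes in the incoming region. -/
theorem integral_eq_integral_Ioi [IsLocallyFiniteMeasure ν] [SFinite μ] (hρ : 0 < ρ)
    (hV : SymbolDecay ρ V₁) {L₂ : NNReal} (hV₂ : LipschitzWith L₂ V₂) (hV₂0 : ∀ x, 0 ≤ V₂ x)
    (hE₀ : 0 < E₀) (htrap : TrappedMeetsAbsorption V₁ V₂ E₀)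
    (hb : 0 ≤ b) (hc0 : ∀ w, 0 ≤ c w) (hc : Integrable (fun w => (c w : ℂ)) μ)
    (hsupp : ν.support ⊆ {w | hamSymbol V₁ w = E₀}) {R₀ : ℝ}
    (hinc : ν {w | R₀ < ‖w.1‖ ∧ ⟪w.1, w.2⟫_ℝ < -(1 / 2) * ‖w.1‖ * ‖w.2‖} = 0)
    (hweak : ∀ q, IsTestFunction q →
      ∫ w, (-poissonP V₁ q w + ((2 * b + 2 * V₂ w.1 : ℝ) : ℂ) * q w) ∂ν = ∫ w, (c w : ℂ) * q w ∂μ)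
    {L : NNReal} (hq : LipschitzWith L q) (hqc : HasCompactSupport q) :
    IntegrableOn (fun t => ∫ w, (c w : ℂ) * dampedPullback V₁ V₂ b q t w ∂μ) (Ioi 0) ∧
      ∫ w, q w ∂ν = ∫ t in Ioi (0 : ℝ), ∫ w, (c w : ℂ) * dampedPullback V₁ V₂ b q t w ∂μ := by
  have hV₂c := hV₂.continuous
  have hlim : ∀ {q : Phase n → ℂ} {L : NNReal}, LipschitzWith L q → HasCompactSupport q →
      Tendsto (fun T => ∫ t in (0 : ℝ)..T, ∫ w, (c w : ℂ) * dampedPullback V₁ V₂ b q t w ∂μ) atTop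
        (𝓝 (∫ w, q w ∂ν)) := by
    intro q L hq hqc
    have h1 := (tendsto_integral_dampedPullback hρ hV hV₂c hV₂0 hE₀ htrap hb hsupp hinc
      hq.continuous hqc).const_sub (∫ w, q w ∂ν)
    rw [sub_zero] at h1
    refine h1.congr' ?_
    filter_upwards [eventually_ge_atTop 0] with T hT
    exact integral_sub_dampedPullback hρ hV hV₂ hV₂0 hb hc hweak hq hqc hT
  have hIoc : ∀ {q : Phase n → ℂ}, Continuous q → HasCompactSupport q → ∀ T,
      IntegrableOn (fun t => ∫ w, (c w : ℂ) * dampedPullback V₁ V₂ b q t w ∂μ) (Ioc 0 T) :=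
    fun hq hqc T =>
      (integrable_prod_mul_dampedPullback hρ hV hV₂c hV₂0 hb hc hq hqc T).integral_prod_left
  -- Since `|q|` is still Lipschitz, the finite-time formula applies to it. As `c ≥ 0`, its inner
  -- integrals are nonnegative, dominate those of `q`, and have time integrals converging to `∫ |q|
  -- dν`; this gives integrability on the half-line.
  let q' : Phase n → ℂ := fun w => ((‖q w‖ : ℝ) : ℂ)
  have hq'L : LipschitzWith L q' := by
    refine LipschitzWith.of_dist_le_mul fun x y => ?_
    refine le_trans ?_ (hq.dist_le_mul x y)
    rw [dist_eq_norm, dist_eq_norm, ← Complex.ofReal_sub, Complex.norm_real, Real.norm_eq_abs]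
    exact abs_norm_sub_norm_le _ _
  have hq'c : HasCompactSupport q' := hqc.comp_left (g := fun z : ℂ => ((‖z‖ : ℝ) : ℂ)) (by simp)
  have hpt : ∀ t w, (c w : ℂ) * dampedPullback V₁ V₂ b q' t w =
      ((‖(c w : ℂ) * dampedPullback V₁ V₂ b q t w‖ : ℝ) : ℂ) := by
    intro t w
    unfold dampedPullback
    simp only [q', norm_mul, Complex.norm_real, Real.norm_eq_abs, Real.abs_exp,
      abs_of_nonneg (hc0 w), Complex.ofReal_mul]
  have hle : ∀ t, ‖∫ w, (c w : ℂ) * dampedPullback V₁ V₂ b q t w ∂μ‖ ≤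
      ‖∫ w, (c w : ℂ) * dampedPullback V₁ V₂ b q' t w ∂μ‖ := by
    intro t
    simp only [hpt]
    rw [integral_complex_ofReal, Complex.norm_real]
    exact (norm_integral_le_integral_norm _).trans (le_abs_self _)
  have hint' : IntegrableOn (fun t => ∫ w, (c w : ℂ) * dampedPullback V₁ V₂ b q' t w ∂μ)
      (Ioi 0) := by
    refine integrableOn_Ioi_of_intervalIntegral_norm_tendsto (l := atTop) (b := id)
      (∫ w, ‖q w‖ ∂ν) 0 (hIoc hq'L.continuous hq'c) tendsto_id ?_
    have h1 := hlim hq'L hq'c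
    have h2 := (Complex.continuous_re.tendsto _).comp h1
    have h3 : (∫ w, q' w ∂ν).re = ∫ w, ‖q w‖ ∂ν := by
      simp only [q']
      rw [integral_complex_ofReal, Complex.ofReal_re]
    rw [h3] at h2
    refine h2.congr fun T => ?_
    have h4 : ∀ t, ∫ w, (c w : ℂ) * dampedPullback V₁ V₂ b q' t w ∂μ =
        ((‖∫ w, (c w : ℂ) * dampedPullback V₁ V₂ b q' t w ∂μ‖ : ℝ) : ℂ) := by
      intro t
      simp only [hpt]
      rw [integral_complex_ofReal, Complex.norm_real, Real.norm_of_nonneg]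
      exact integral_nonneg fun w => norm_nonneg _
    have h5 : ∫ t in (0 : ℝ)..T, ∫ w, (c w : ℂ) * dampedPullback V₁ V₂ b q' t w ∂μ =
        ((∫ t in (0 : ℝ)..T, ‖∫ w, (c w : ℂ) * dampedPullback V₁ V₂ b q' t w ∂μ‖ : ℝ) : ℂ) := by
      rw [← intervalIntegral.integral_ofReal]
      exact intervalIntegral.integral_congr fun t _ => h4 t
    simp only [Function.comp_apply, id]
    rw [h5, Complex.ofReal_re]
  have hmeas : AEStronglyMeasurable (fun t => ∫ w, (c w : ℂ) * dampedPullback V₁ V₂ b q t w ∂μ)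
      (volume.restrict (Ioi 0)) := by
    have h1 : Ioi (0 : ℝ) = ⋃ k : ℕ, Ioc 0 (k : ℝ) := by
      ext t
      simp only [mem_Ioi, mem_iUnion, mem_Ioc]
      refine ⟨fun ht => ?_, fun ⟨k, hk⟩ => hk.1⟩
      obtain ⟨k, hk⟩ := exists_nat_ge t
      exact ⟨k, ht, hk⟩
    rw [h1, aestronglyMeasurable_iUnion_iff]
    exact fun k => (hIoc hq.continuous hqc k).aestronglyMeasurable
  have hint : IntegrableOn (fun t => ∫ w, (c w : ℂ) * dampedPullback V₁ V₂ b q t w ∂μ) (Ioi 0) :=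
    Integrable.mono hint' hmeas (Eventually.of_forall hle)
  exact ⟨hint, tendsto_nhds_unique (hlim hq hqc)
    (intervalIntegral_tendsto_integral_Ioi 0 hint tendsto_id)⟩

/-- Locally finite measures are determined by their integrals against test functions. -/
lemma eq_of_forall_integral_testFunction_eq {ν ν' : Measure (Phase n)} [IsLocallyFiniteMeasure ν]
    [IsLocallyFiniteMeasure ν']
    (h : ∀ q : Phase n → ℂ, IsTestFunction q → ∫ w, q w ∂ν = ∫ w, q w ∂ν') : ν = ν' := by
  refine Measure.ext_of_integral_eq_on_compactlySupported fun f => ?_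
  let Q : Phase n → ℂ := fun w => ((f w : ℝ) : ℂ)
  have hQ : Continuous Q := Complex.continuous_ofReal.comp f.continuous
  have hQc : HasCompactSupport Q := f.hasCompactSupport.comp_left Complex.ofReal_zero
  obtain ⟨B, hB⟩ := hQ.bounded_above_of_compact_support hQc
  obtain ⟨P, K, hKc, hPs, hPts, hPB, hPlim, -⟩ := exists_mollification_seq hQ hQc
  have key : ∀ (ν : Measure (Phase n)) [IsLocallyFiniteMeasure ν],
      Tendsto (fun k => ∫ w, P k w ∂ν) atTop (𝓝 (∫ w, Q w ∂ν)) := by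
    intro ν _
    refine tendsto_integral_of_dominated_convergence (K.indicator fun _ => B)
      (fun k => (hPs k).continuous.aestronglyMeasurable) ?_ (fun k => Eventually.of_forall fun w => ?_)
      (Eventually.of_forall hPlim)
    · rw [integrable_indicator_iff hKc.measurableSet]
      exact continuousOn_const.integrableOn_compact hKc
    · by_cases hw : w ∈ K
      · rw [indicator_of_mem hw]; exact hPB B hB k w
      · rw [indicator_of_notMem hw,
          image_eq_zero_of_notMem_tsupport fun hw' => hw (hPts k hw'), norm_zero]
  have h1 := tendsto_nhds_unique (key ν) ((key ν').congr fun k =>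
    (h (P k) ⟨hPs k, hKc.of_isClosed_subset (isClosed_tsupport _) (hPts k)⟩).symm)
  simp only [Q] at h1
  rwa [integral_complex_ofReal, integral_complex_ofReal, Complex.ofReal_inj] at h1

end Core

/-! ### Local parametrizations of submanifolds -/

section Submanifold

variable {F : Type*} [NormedAddCommGroup F] [NormedSpace ℝ F] {k : ℕ} {M : Set F}
  {W : Set (EuclideanSpace ℝ (Fin k))} {ψ : EuclideanSpace ℝ (Fin k) → F}

lemma IsLocalParam.contDiffAt (h : IsLocalParam k M W ψ) {u : EuclideanSpace ℝ (Fin k)}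
    (hu : u ∈ W) : ContDiffAt ℝ ∞ ψ u :=
  h.smooth.contDiffAt (h.isOpen_source.mem_nhds hu)

lemma IsLocalParam.hasFDerivAt (h : IsLocalParam k M W ψ) {u : EuclideanSpace ℝ (Fin k)}
    (hu : u ∈ W) : HasFDerivAt ψ (fderiv ℝ ψ u) u :=
  ((h.contDiffAt hu).differentiableAt (by simp)).hasFDerivAt

/-- The inverse of a local parametrization extends locally to a `C¹` map on the ambient space. -/
lemma IsLocalParam.exists_localInverse [FiniteDimensional ℝ F] (h : IsLocalParam k M W ψ)
    {u₀ : EuclideanSpace ℝ (Fin k)} (hu₀ : u₀ ∈ W) :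
    ∃ (r : F → EuclideanSpace ℝ (Fin k)) (O : Set F), IsOpen O ∧ ψ u₀ ∈ O ∧
      (∀ z ∈ O, ContDiffAt ℝ 1 r z) ∧ r (ψ u₀) = u₀ ∧ ∀ z ∈ M ∩ O, r z ∈ W ∧ ψ (r z) = z := by
  have hψ := h.contDiffAt hu₀
  -- With `L` a linear left inverse of the differential at `u₀`, the map `L ∘ ψ` has identity
  -- derivative there. Its local inverse `s`, composed with `L`, is defined near `ψ u₀` in the
  -- ambient space.
  obtain ⟨l, hl⟩ := (fderiv ℝ ψ u₀).toLinearMap.exists_leftInverse_of_injective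
    (LinearMap.ker_eq_bot.2 (h.immersive u₀ hu₀))
  let L : F →L[ℝ] EuclideanSpace ℝ (Fin k) := LinearMap.toContinuousLinearMap l
  have hg : ContDiffAt ℝ ∞ (fun u => L (ψ u)) u₀ := L.contDiff.contDiffAt.comp u₀ hψ
  have hg' : HasFDerivAt (fun u => L (ψ u))
      ((ContinuousLinearEquiv.refl ℝ (EuclideanSpace ℝ (Fin k)) :
        EuclideanSpace ℝ (Fin k) →L[ℝ] EuclideanSpace ℝ (Fin k))) u₀ := by
    refine (L.hasFDerivAt.comp u₀ (h.hasFDerivAt hu₀)).congr_fderiv ?_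
    ext1 x
    exact LinearMap.congr_fun hl x
  have hstrict := hg.hasStrictFDerivAt' hg' (by simp)
  have hinv := hg.to_localInverse hg' (by simp)
  set s := hg.localInverse hg' (by simp) with hs
  have hleft : ∀ᶠ u in 𝓝 u₀, s (L (ψ u)) = u := hstrict.eventually_left_inverse
  have hr : ContDiffAt ℝ 1 (fun z => s (L z)) (ψ u₀) := by
    have h1 : ContDiffAt ℝ 1 s (L (ψ u₀)) := hinv.of_le (by norm_cast)
    exact h1.comp (ψ u₀) L.contDiff.contDiffAt
  obtain ⟨W', hW'sub, hW'o, hu₀'⟩ := eventually_nhds_iff.1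
    (hleft.and (h.isOpen_source.mem_nhds hu₀))
  -- Embeddedness enters here: points of `M` close to `ψ u₀` come from parameters close to `u₀`.
  obtain ⟨O₁, hO₁, hO₁e⟩ := h.isOpen_image W' (fun u hu => (hW'sub u hu).2) hW'o
  obtain ⟨O₂, hO₂s, hO₂, hO₂m⟩ := eventually_nhds_iff.1 (hr.eventually (by simp))
  have hmem : ψ u₀ ∈ O₁ := (hO₁e.subset ⟨u₀, hu₀', rfl⟩).2
  refine ⟨fun z => s (L z), O₁ ∩ O₂, hO₁.inter hO₂, ⟨hmem, hO₂m⟩, fun z hz => hO₂s z hz.2,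
    hleft.self_of_nhds, fun z hz => ?_⟩
  obtain ⟨u, hu, rfl⟩ := hO₁e.symm.subset ⟨hz.1, hz.2.1⟩
  have h1 := hW'sub u hu
  simp only [h1.1]
  exact ⟨h1.2, trivial⟩

/-- Around each of its points, a submanifold coincides with a compact set. -/
lemma IsLocalParam.exists_compact (h : IsLocalParam k M W ψ) {u : EuclideanSpace ℝ (Fin k)}
    (hu : u ∈ W) : ∃ ε > 0, Metric.closedBall u ε ⊆ W ∧ ∃ O : Set F, IsOpen O ∧ ψ u ∈ O ∧
      M ∩ O = ψ '' Metric.ball u ε ∧ M ∩ O = ψ '' Metric.closedBall u ε ∩ O := by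
  obtain ⟨ε, hε, hball⟩ := Metric.nhds_basis_closedBall.mem_iff.1 (h.isOpen_source.mem_nhds hu)
  obtain ⟨O, hO, hOe⟩ := h.isOpen_image (Metric.ball u ε)
    (Metric.ball_subset_closedBall.trans hball) Metric.isOpen_ball
  refine ⟨ε, hε, hball, O, hO, (hOe.subset ⟨u, Metric.mem_ball_self hε, rfl⟩).2, hOe.symm, ?_⟩
  ext z
  constructor
  · intro hz
    exact ⟨image_mono Metric.ball_subset_closedBall (hOe.symm.subset hz), hz.2⟩
  · rintro ⟨⟨v, hv, rfl⟩, hz⟩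
    exact ⟨h.mapsTo (hball hv), hz⟩

/-- Near each point `M` is the trace of a compact set on an open set, and countably many such open
sets cover `M`. -/
lemma IsSubmanifold.measurableSet [SecondCountableTopology F] [MeasurableSpace F] [BorelSpace F]
    (hM : IsSubmanifold k M) : MeasurableSet M := by
  have key : ∀ z ∈ M, ∃ O : Set F, IsOpen O ∧ z ∈ O ∧ MeasurableSet (M ∩ O) := by
    intro z hz
    obtain ⟨W, ψ, h, u, hu, rfl⟩ := hM z hz
    obtain ⟨ε, hε, hball, O, hO, hzO, -, hOe⟩ := h.exists_compact hu
    refine ⟨O, hO, hzO, hOe ▸ ?_⟩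
    have hc : IsCompact (ψ '' Metric.closedBall u ε) :=
      (isCompact_closedBall u ε).image_of_continuousOn (h.smooth.continuousOn.mono hball)
    exact hc.isClosed.measurableSet.inter hO.measurableSet
  choose! O hO hzO hOm using key
  obtain ⟨t, htM, htc, hcov⟩ := TopologicalSpace.countable_cover_nhdsWithin
    fun z hz => mem_nhdsWithin_of_mem_nhds ((hO z hz).mem_nhds (hzO z hz))
  have : M = ⋃ z ∈ t, M ∩ O z := by
    rw [← inter_iUnion₂]
    exact (inter_eq_left.2 hcov).symm
  rw [this]
  exact MeasurableSet.biUnion htc fun z hz => hOm z (htM hz)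

lemma IsLocalParam.inter (h : IsLocalParam k M W ψ) {O : Set F} (hO : IsOpen O) :
    IsLocalParam k (M ∩ O) (W ∩ ψ ⁻¹' O) ψ where
  isOpen_source := h.smooth.continuousOn.isOpen_inter_preimage h.isOpen_source hO
  smooth := h.smooth.mono inter_subset_left
  immersive u hu := h.immersive u hu.1
  injOn := h.injOn.mono inter_subset_left
  mapsTo u hu := ⟨h.mapsTo hu.1, hu.2⟩
  isOpen_image W' hW' hW'o := by
    obtain ⟨O', hO', he⟩ := h.isOpen_image W' (hW'.trans inter_subset_left) hW'o
    refine ⟨O', hO', ?_⟩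
    ext z
    constructor
    · intro hz
      obtain ⟨u, hu, rfl⟩ := hz
      exact ⟨⟨h.mapsTo (hW' hu).1, (hW' hu).2⟩, (he.subset ⟨u, hu, rfl⟩).2⟩
    · intro hz
      exact he.symm.subset ⟨hz.1.1, hz.2⟩

lemma IsSubmanifold.inter (hM : IsSubmanifold k M) {O : Set F} (hO : IsOpen O) :
    IsSubmanifold k (M ∩ O) := by
  rintro z ⟨hz, hzO⟩
  obtain ⟨W, ψ, h, u, hu, rfl⟩ := hM z hz
  exact ⟨_, ψ, h.inter hO, u, ⟨hu, hzO⟩, rfl⟩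

lemma SmoothOnSubmanifold.continuousOn [FiniteDimensional ℝ F] (hM : IsSubmanifold k M)
    {A : F → ℂ} (hA : SmoothOnSubmanifold k M A) : ContinuousOn A M := by
  intro z hz
  obtain ⟨W, ψ, h, u, hu, rfl⟩ := hM z hz
  obtain ⟨r, O, hO, hzO, hr, hru, hinv⟩ := h.exists_localInverse hu
  have h1 : ContinuousAt (A ∘ ψ) (r (ψ u)) := by
    rw [hru]
    exact (hA W ψ h).continuousOn.continuousAt (h.isOpen_source.mem_nhds hu)
  have h2 : ContinuousAt (fun z => (A ∘ ψ) (r z)) (ψ u) :=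
    ContinuousAt.comp (f := r) h1 (hr _ hzO).continuousAt
  refine h2.continuousWithinAt.congr_of_eventuallyEq ?_ ?_
  · filter_upwards [self_mem_nhdsWithin, mem_nhdsWithin_of_mem_nhds (hO.mem_nhds hzO)] with z hz hzO
    simp [(hinv z ⟨hz, hzO⟩).2]
  · simp [hru]

/-- A curve `c` on `M` equals `ψ ∘ r ∘ c` near time zero, with `r` the ambient local inverse, so its
velocity lies in the range of the differential; conversely the curves `t ↦ ψ (u + t • x)` realize
the whole range. -/
lemma IsLocalParam.tangentSpaceOf_eq {n : ℕ} {M : Set (Config n)}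
    {ψ : EuclideanSpace ℝ (Fin k) → Config n} (h : IsLocalParam k M W ψ)
    {u : EuclideanSpace ℝ (Fin k)} (hu : u ∈ W) :
    tangentSpaceOf M (ψ u) = (fderiv ℝ ψ u).range := by
  apply le_antisymm
  · refine Submodule.span_le.2 ?_
    rintro v ⟨c, hc0, hcM, hc⟩
    obtain ⟨r, O, hO, hzO, hr, hru, hinv⟩ := h.exists_localInverse hu
    have hcO : ∀ᶠ t in 𝓝 (0 : ℝ), c t ∈ O :=
      hc.continuousAt.eventually_mem (by rw [hc0]; exact hO.mem_nhds hzO)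
    have h1 : HasFDerivAt r (fderiv ℝ r (ψ u)) (c 0) := by
      rw [hc0]; exact ((hr _ hzO).differentiableAt (by simp)).hasFDerivAt
    have h2 := h1.comp_hasDerivAt 0 hc
    have h3 : HasFDerivAt ψ (fderiv ℝ ψ u) ((r ∘ c) 0) := by
      simp only [Function.comp_apply, hc0, hru]; exact h.hasFDerivAt hu
    have h4 := h3.comp_hasDerivAt 0 h2
    have h5 : HasDerivAt c (fderiv ℝ ψ u (fderiv ℝ r (ψ u) v)) 0 := by
      refine h4.congr_of_eventuallyEq ?_
      filter_upwards [hcM, hcO] with t ht1 ht2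
      exact (hinv _ ⟨ht1, ht2⟩).2.symm
    exact ⟨_, h5.unique hc⟩
  · rintro _ ⟨x, rfl⟩
    refine Submodule.subset_span ⟨fun t => ψ (u + t • x), by simp, ?_, ?_⟩
    · have h1 : ContinuousAt (fun t : ℝ => u + t • x) 0 := by fun_prop
      have h2 := h1.eventually_mem (by simpa using h.isOpen_source.mem_nhds hu)
      filter_upwards [h2] with t ht
      exact h.mapsTo ht
    · have h1 : HasDerivAt (fun t : ℝ => u + t • x) x 0 := by
        simpa using ((hasDerivAt_id' (0 : ℝ)).smul_const x).const_add u
      have h2 : HasFDerivAt ψ (fderiv ℝ ψ u) (u + (0 : ℝ) • x) := by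
        simpa using h.hasFDerivAt hu
      exact h2.comp_hasDerivAt (0 : ℝ) h1

end Submanifold

/-! ### The canonical measure -/

section BundleMeasure

variable {n : ℕ} {Γ : Set (Config n)} {N : Set (Phase n)}

lemma paramMeasure_apply {W : Set (EuclideanSpace ℝ (Fin (n - 1)))}
    {ψ : EuclideanSpace ℝ (Fin (n - 1)) → Phase n} (h : IsLocalParam (n - 1) N W ψ)
    {B : Set (Phase n)} (hB : MeasurableSet B) :
    paramMeasure Γ W ψ B =
      ∫⁻ u in ψ ⁻¹' B ∩ W, ENNReal.ofReal (Real.sqrt (gramMatrix Γ ψ u).det) := by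
  have h1 : AEMeasurable ψ (volume.restrict W) :=
    h.smooth.continuousOn.aemeasurable h.isOpen_source.measurableSet
  unfold paramMeasure
  rw [Measure.map_apply_of_aemeasurable (h1.mono_ac (withDensity_absolutelyContinuous _ _)) hB,
    withDensity_apply', Measure.restrict_restrict' h.isOpen_source.measurableSet]

lemma bundleMetric_add_left (Γ : Set (Config n)) (w v₁ v₂ v : Phase n) :
    bundleMetric Γ w (v₁ + v₂) v = bundleMetric Γ w v₁ v + bundleMetric Γ w v₂ v := by
  simp only [bundleMetric, perpPart, Prod.fst_add, Prod.snd_add, map_add, inner_add_left]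
  ring

lemma bundleMetric_smul_left (Γ : Set (Config n)) (w : Phase n) (a : ℝ) (v₁ v : Phase n) :
    bundleMetric Γ w (a • v₁) v = a * bundleMetric Γ w v₁ v := by
  simp only [bundleMetric, perpPart, Prod.smul_fst, Prod.smul_snd, map_smul, inner_smul_left]
  simp; ring

lemma bundleMetric_comm (Γ : Set (Config n)) (w v₁ v₂ : Phase n) :
    bundleMetric Γ w v₁ v₂ = bundleMetric Γ w v₂ v₁ := by
  simp only [bundleMetric]
  rw [real_inner_comm, real_inner_comm (perpPart Γ w v₁.2)]

/-- The metric `bundleMetric Γ w` as a bilinear form. -/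
noncomputable def bundleForm (Γ : Set (Config n)) (w : Phase n) : LinearMap.BilinForm ℝ (Phase n) :=
  LinearMap.mk₂ ℝ (bundleMetric Γ w) (bundleMetric_add_left Γ w) (bundleMetric_smul_left Γ w)
    (fun v v₁ v₂ => by
      rw [bundleMetric_comm, bundleMetric_add_left, bundleMetric_comm, bundleMetric_comm Γ w v₂])
    (fun a v v₁ => by
      rw [bundleMetric_comm, bundleMetric_smul_left, bundleMetric_comm, smul_eq_mul])

/-- Orthogonal projections do not increase norms. The bound is uniform in `w`, so local boundedness
of the density needs no regularity of the projection in the base point. -/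
lemma abs_bundleMetric_le (Γ : Set (Config n)) (w v₁ v₂ : Phase n) :
    |bundleMetric Γ w v₁ v₂| ≤ 2 * (‖v₁‖ * ‖v₂‖) := by
  have h1 := abs_real_inner_le_norm v₁.1 v₂.1
  have h2 := abs_real_inner_le_norm (perpPart Γ w v₁.2) (perpPart Γ w v₂.2)
  have h3 : ∀ Ξ, ‖perpPart Γ w Ξ‖ ≤ ‖Ξ‖ := fun Ξ => Submodule.norm_starProjection_apply_le _ Ξ
  have h4 : ‖v₁.1‖ * ‖v₂.1‖ ≤ ‖v₁‖ * ‖v₂‖ := by gcongr <;> exact norm_fst_le _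
  have h5 : ‖perpPart Γ w v₁.2‖ * ‖perpPart Γ w v₂.2‖ ≤ ‖v₁‖ * ‖v₂‖ := by
    gcongr <;> exact (h3 _).trans (norm_snd_le _)
  unfold bundleMetric
  refine (abs_add_le _ _).trans ?_
  linarith

/-- The Gram matrix is the matrix of the pulled-back form, so a change of chart with differential
`τ` turns it into `τᵀ G τ`. The square root of the determinant thus acquires the Jacobian `|det τ|`.
-/
lemma gramMatrix_of_comp {ψ₀ ψ₁ : EuclideanSpace ℝ (Fin (n - 1)) → Phase n}
    {u u₀ : EuclideanSpace ℝ (Fin (n - 1))} (hu : ψ₀ u₀ = ψ₁ u)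
    {τ : EuclideanSpace ℝ (Fin (n - 1)) →L[ℝ] EuclideanSpace ℝ (Fin (n - 1))}
    (hτ : fderiv ℝ ψ₁ u = (fderiv ℝ ψ₀ u₀).comp τ) :
    (gramMatrix Γ ψ₁ u).det = τ.det ^ 2 * (gramMatrix Γ ψ₀ u₀).det := by
  let e := (EuclideanSpace.basisFun (Fin (n - 1)) ℝ).toBasis
  have he : ∀ i, e i = EuclideanSpace.single i 1 := fun i => by simp [e]
  have hform : ∀ (ψ : EuclideanSpace ℝ (Fin (n - 1)) → Phase n) u, gramMatrix Γ ψ u =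
      LinearMap.BilinForm.toMatrix e ((bundleForm Γ (ψ u)).comp (fderiv ℝ ψ u).toLinearMap
        (fderiv ℝ ψ u).toLinearMap) := by
    intro ψ u
    ext i j
    simp [gramMatrix, LinearMap.BilinForm.toMatrix_apply, he, bundleForm]
  have h2 : (bundleForm Γ (ψ₁ u)).comp (fderiv ℝ ψ₁ u).toLinearMap (fderiv ℝ ψ₁ u).toLinearMap =
      ((bundleForm Γ (ψ₀ u₀)).comp (fderiv ℝ ψ₀ u₀).toLinearMap
        (fderiv ℝ ψ₀ u₀).toLinearMap).comp τ.toLinearMap τ.toLinearMap := by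
    rw [hτ, hu]; rfl
  rw [hform, hform, h2, LinearMap.BilinForm.toMatrix_comp (b := e) (c := e), Matrix.det_mul,
    Matrix.det_mul, Matrix.det_transpose, LinearMap.det_toMatrix]
  simp only [ContinuousLinearMap.det]
  ring

/-- Two local parametrizations define the same measure on the intersection of their images. -/
lemma paramMeasure_le {W₀ W₁ : Set (EuclideanSpace ℝ (Fin (n - 1)))}
    {ψ₀ ψ₁ : EuclideanSpace ℝ (Fin (n - 1)) → Phase n} (h₀ : IsLocalParam (n - 1) N W₀ ψ₀)
    (h₁ : IsLocalParam (n - 1) N W₁ ψ₁) {B : Set (Phase n)} (hB : MeasurableSet B)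
    (hBsub : B ⊆ ψ₀ '' W₀) : paramMeasure Γ W₁ ψ₁ B ≤ paramMeasure Γ W₀ ψ₀ B := by
  rw [paramMeasure_apply h₀ hB, paramMeasure_apply h₁ hB]
  set s := ψ₁ ⁻¹' B ∩ W₁ with hs
  have hsm : MeasurableSet s := by
    have h2 : Measurable (W₁.domRestrict ψ₁) := h₁.smooth.continuousOn.domRestrict.measurable
    have h3 := h₁.isOpen_source.measurableSet.subtype_image (h2 hB)
    convert h3 using 1
    ext u
    exact ⟨fun h => ⟨⟨u, h.2⟩, h.1, rfl⟩, by rintro ⟨v, hv, rfl⟩; exact ⟨hv, v.2⟩⟩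
  have hex : ∀ u ∈ s, ∃ v ∈ W₀, ψ₀ v = ψ₁ u := fun u hu => hBsub hu.1
  -- `τ` is the transition map `ψ₀⁻¹ ∘ ψ₁` on `s`. It coincides there with `r ∘ ψ₁` for an ambient
  -- local inverse `r` of `ψ₀`, hence is differentiable within `s`.
  choose! τ hτW hτ using hex
  have hder : ∀ u ∈ s, ∃ τ' : EuclideanSpace ℝ (Fin (n - 1)) →L[ℝ] EuclideanSpace ℝ (Fin (n - 1)),
      HasFDerivWithinAt τ τ' s u ∧ fderiv ℝ ψ₁ u = (fderiv ℝ ψ₀ (τ u)).comp τ' := by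
    intro u hu
    obtain ⟨r, O, hO, hzO, hr, hru, hinv⟩ := h₀.exists_localInverse (hτW u hu)
    rw [hτ u hu] at hzO hru
    have hnhds : ∀ᶠ v in 𝓝 u, v ∈ W₁ ∧ ψ₁ v ∈ O :=
      (h₁.isOpen_source.eventually_mem hu.2).and
        ((h₁.contDiffAt hu.2).continuousAt.eventually_mem (hO.mem_nhds hzO))
    have hd1 : HasFDerivAt (fun v => r (ψ₁ v)) ((fderiv ℝ r (ψ₁ u)).comp (fderiv ℝ ψ₁ u)) u :=
      (((hr _ hzO).differentiableAt (by simp)).hasFDerivAt).comp u (h₁.hasFDerivAt hu.2)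
    refine ⟨_, hd1.hasFDerivWithinAt.congr_of_eventuallyEq ?_ hru.symm, ?_⟩
    · filter_upwards [self_mem_nhdsWithin, mem_nhdsWithin_of_mem_nhds hnhds] with v hvs hv
      have h3 := hinv _ ⟨h₁.mapsTo hv.1, hv.2⟩
      exact h₀.injOn (hτW v hvs) h3.1 ((hτ v hvs).trans h3.2.symm)
    · have h4 : HasFDerivAt ψ₀ (fderiv ℝ ψ₀ (τ u)) (r (ψ₁ u)) := by
        rw [hru]; exact h₀.hasFDerivAt (hτW u hu)
      have h5 := h4.comp u hd1
      refine (h₁.hasFDerivAt hu.2).unique (h5.congr_of_eventuallyEq ?_)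
      filter_upwards [hnhds] with v hv
      exact (hinv _ ⟨h₁.mapsTo hv.1, hv.2⟩).2.symm
  choose! τ' hτ' hcomp using hder
  have hinj : InjOn τ s := fun u hu v hv huv =>
    h₁.injOn hu.2 hv.2 (by rw [← hτ u hu, ← hτ v hv, huv])
  calc ∫⁻ u in s, ENNReal.ofReal (Real.sqrt (gramMatrix Γ ψ₁ u).det)
      = ∫⁻ u in s, ENNReal.ofReal |(τ' u).det| *
          ENNReal.ofReal (Real.sqrt (gramMatrix Γ ψ₀ (τ u)).det) := by
        refine setLIntegral_congr_fun hsm fun u hu => ?_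
        rw [gramMatrix_of_comp (hτ u hu) (hcomp u hu), Real.sqrt_mul (sq_nonneg _),
          Real.sqrt_sq_eq_abs, ENNReal.ofReal_mul (abs_nonneg _)]
    _ = ∫⁻ v in τ '' s, ENNReal.ofReal (Real.sqrt (gramMatrix Γ ψ₀ v).det) :=
        (lintegral_image_eq_lintegral_abs_det_fderiv_mul volume hsm hτ' hinj
          fun v => ENNReal.ofReal (Real.sqrt (gramMatrix Γ ψ₀ v).det)).symm
    _ ≤ _ := by
        refine lintegral_mono_set ?_
        rintro _ ⟨u, hu, rfl⟩
        refine ⟨?_, hτW u hu⟩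
        rw [mem_preimage, hτ u hu]
        exact hu.1

lemma paramMeasure_compl {W : Set (EuclideanSpace ℝ (Fin (n - 1)))}
    {ψ : EuclideanSpace ℝ (Fin (n - 1)) → Phase n} (h : IsLocalParam (n - 1) N W ψ)
    (hN : MeasurableSet N) : paramMeasure Γ W ψ Nᶜ = 0 := by
  rw [paramMeasure_apply h hN.compl]
  have : ψ ⁻¹' Nᶜ ∩ W = ∅ := by
    ext u
    simp only [mem_inter_iff, mem_preimage, mem_compl_iff, mem_empty_iff_false, iff_false, not_and]
    exact fun h1 h2 => h1 (h.mapsTo h2)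
  rw [this, Measure.restrict_empty, lintegral_zero_measure]

variable {V₁ : Config n → ℝ} {E₀ : ℝ}

/-- Restricted to the bundle, the measure still dominates every chart measure, so minimality of the
supremum forces it to be carried by the bundle. -/
lemma bundleMeasure_compl (hN : MeasurableSet (normalEnergyBundle V₁ E₀ Γ)) :
    bundleMeasure V₁ E₀ Γ (normalEnergyBundle V₁ E₀ Γ)ᶜ = 0 := by
  have h1 : bundleMeasure V₁ E₀ Γ ≤
      (bundleMeasure V₁ E₀ Γ).restrict (normalEnergyBundle V₁ E₀ Γ) := by
    refine sSup_le ?_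
    rintro m ⟨W, ψ, h, rfl⟩
    have h2 : paramMeasure Γ W ψ ≤ bundleMeasure V₁ E₀ Γ := le_sSup ⟨W, ψ, h, rfl⟩
    rw [← Measure.restrict_eq_self_of_ae_mem (s := normalEnergyBundle V₁ E₀ Γ)
      (μ := paramMeasure Γ W ψ) (by rw [ae_iff]; exact paramMeasure_compl h hN)]
    exact Measure.restrict_mono le_rfl h2
  have h3 := h1 (normalEnergyBundle V₁ E₀ Γ)ᶜ
  rw [Measure.restrict_apply hN.compl, compl_inter_self, measure_empty] at h3
  exact le_antisymm h3 zero_le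

/-- The canonical measure is finite near each point of a coordinate patch. -/
lemma exists_isOpen_bundleMeasure_lt_top (hN : MeasurableSet (normalEnergyBundle V₁ E₀ Γ))
    {W : Set (EuclideanSpace ℝ (Fin (n - 1)))} {ψ : EuclideanSpace ℝ (Fin (n - 1)) → Phase n}
    (h : IsLocalParam (n - 1) (normalEnergyBundle V₁ E₀ Γ) W ψ)
    {u : EuclideanSpace ℝ (Fin (n - 1))} (hu : u ∈ W) :
    ∃ O : Set (Phase n), IsOpen O ∧ ψ u ∈ O ∧ bundleMeasure V₁ E₀ Γ O < ⊤ := by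
  set N := normalEnergyBundle V₁ E₀ Γ with hNdef
  obtain ⟨ε, hε, hball, O, hO, hzO, hOb, -⟩ := h.exists_compact hu
  refine ⟨O, hO, hzO, ?_⟩
  -- Minimality again: replacing the measure on `O` by the single chart measure of `ψ` gives another
  -- upper bound, because on `O` all chart measures are dominated by that of `ψ`.
  have hle : bundleMeasure V₁ E₀ Γ ≤
      (paramMeasure Γ W ψ).restrict O + (bundleMeasure V₁ E₀ Γ).restrict Oᶜ := by
    refine sSup_le ?_
    rintro m ⟨W₁, ψ₁, h₁, rfl⟩
    have h2 : paramMeasure Γ W₁ ψ₁ ≤ bundleMeasure V₁ E₀ Γ := le_sSup ⟨W₁, ψ₁, h₁, rfl⟩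
    rw [← Measure.restrict_add_restrict_compl (μ := paramMeasure Γ W₁ ψ₁) hO.measurableSet]
    refine add_le_add ?_ (Measure.restrict_mono le_rfl h2)
    refine Measure.le_iff.2 fun B hB => ?_
    rw [Measure.restrict_apply hB, Measure.restrict_apply hB]
    have h3 : paramMeasure Γ W₁ ψ₁ (B ∩ O) ≤ paramMeasure Γ W₁ ψ₁ (B ∩ O ∩ N) := by
      have h4 : paramMeasure Γ W₁ ψ₁ ((B ∩ O) \ N) = 0 :=
        measure_mono_null (fun x hx => hx.2) (paramMeasure_compl h₁ hN)
      rw [← measure_inter_add_sdiff (μ := paramMeasure Γ W₁ ψ₁) (B ∩ O) hN, h4, add_zero]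
    refine h3.trans ((paramMeasure_le h h₁ ((hB.inter hO.measurableSet).inter hN) ?_).trans
      (measure_mono inter_subset_left))
    intro z hz
    obtain ⟨v, hv, rfl⟩ := hOb.subset ⟨hz.2, hz.1.2⟩
    exact ⟨v, hball (Metric.ball_subset_closedBall hv), rfl⟩
  refine (hle O).trans_lt ?_
  rw [Measure.add_apply, Measure.restrict_apply hO.measurableSet,
    Measure.restrict_apply hO.measurableSet, inter_compl_self, measure_empty, add_zero, inter_self,
    paramMeasure_apply h hO.measurableSet]
  have hfd : ContinuousOn (fderiv ℝ ψ) W := h.smooth.continuousOn_fderiv_of_isOpen h.isOpen_source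
    (by simp)
  obtain ⟨D, hD⟩ := (isCompact_closedBall u ε).exists_bound_of_continuousOn (hfd.mono hball)
  set C : ℝ := (Fintype.card (Fin (n - 1))).factorial • (2 * (D * D)) ^ Fintype.card (Fin (n - 1))
    with hC
  have hdet : ∀ v ∈ Metric.closedBall u ε, |(gramMatrix Γ ψ v).det| ≤ C := by
    intro v hv
    refine Matrix.det_le (abv := AbsoluteValue.abs) fun i j => ?_
    refine (abs_bundleMetric_le _ _ _ _).trans ?_
    have h4 : ∀ i, ‖fderiv ℝ ψ v (EuclideanSpace.single i 1)‖ ≤ D := fun i => by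
      refine ((fderiv ℝ ψ v).le_opNorm _).trans ?_
      simpa using hD v hv
    gcongr
    · exact (norm_nonneg _).trans (h4 i)
    · exact h4 i
    · exact h4 j
  calc ∫⁻ v in ψ ⁻¹' O ∩ W, ENNReal.ofReal (Real.sqrt (gramMatrix Γ ψ v).det)
      ≤ ∫⁻ v in Metric.closedBall u ε, ENNReal.ofReal (Real.sqrt (gramMatrix Γ ψ v).det) := by
        refine lintegral_mono_set ?_
        rintro v ⟨hvO, hvW⟩
        obtain ⟨v', hv', he⟩ := hOb.subset ⟨h.mapsTo hvW, hvO⟩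
        rw [← h.injOn (hball (Metric.ball_subset_closedBall hv')) hvW he]
        exact Metric.ball_subset_closedBall hv'
    _ ≤ ∫⁻ _ in Metric.closedBall u ε, ENNReal.ofReal (Real.sqrt C) := by
        refine setLIntegral_mono measurable_const fun v hv => ?_
        exact ENNReal.ofReal_le_ofReal (Real.sqrt_le_sqrt ((le_abs_self _).trans (hdet v hv)))
    _ < ⊤ := by
        rw [setLIntegral_const]
        exact ENNReal.mul_lt_top ENNReal.ofReal_lt_top (isCompact_closedBall u ε).measure_lt_top

lemma sigmaFinite_bundleMeasure (hN : IsSubmanifold (n - 1) (normalEnergyBundle V₁ E₀ Γ)) :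
    SigmaFinite (bundleMeasure V₁ E₀ Γ) := by
  have hNm := hN.measurableSet
  have key : ∀ w ∈ normalEnergyBundle V₁ E₀ Γ,
      ∃ O : Set (Phase n), IsOpen O ∧ w ∈ O ∧ bundleMeasure V₁ E₀ Γ O < ⊤ := by
    intro w hw
    obtain ⟨W, ψ, h, u, hu, rfl⟩ := hN w hw
    exact exists_isOpen_bundleMeasure_lt_top hNm h hu
  choose! O hO hwO hfin using key
  obtain ⟨t, htN, htc, hcov⟩ := TopologicalSpace.countable_cover_nhdsWithin
    fun w hw => mem_nhdsWithin_of_mem_nhds ((hO w hw).mem_nhds (hwO w hw))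
  refine Measure.sigmaFinite_of_countable (S := insert (normalEnergyBundle V₁ E₀ Γ)ᶜ (O '' t))
    ((htc.image O).insert _) ?_ ?_
  · rintro s (rfl | ⟨w, hw, rfl⟩)
    · rw [bundleMeasure_compl hNm]; exact ENNReal.zero_lt_top
    · exact hfin w (htN hw)
  · refine eq_univ_of_forall fun w => ?_
    by_cases hw : w ∈ normalEnergyBundle V₁ E₀ Γ
    · obtain ⟨w', hw', hmem⟩ := mem_iUnion₂.1 (hcov hw)
      exact ⟨O w', Or.inr ⟨w', hw', rfl⟩, hmem⟩
    · exact ⟨_, Or.inl rfl, hw⟩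

/-- Local finiteness is available only at points of the bundle, which need not be closed; hence the
requirement that `K` lie inside it. -/
lemma bundleMeasure_lt_top_of_isCompact (hN : IsSubmanifold (n - 1) (normalEnergyBundle V₁ E₀ Γ))
    {K : Set (Phase n)} (hK : IsCompact K) (hKN : K ⊆ normalEnergyBundle V₁ E₀ Γ) :
    bundleMeasure V₁ E₀ Γ K < ⊤ := by
  refine hK.measure_lt_top_of_nhdsWithin fun w hw => ?_
  obtain ⟨W, ψ, h, u, hu, rfl⟩ := hN w (hKN hw)
  obtain ⟨O, hO, hwO, hfin⟩ := exists_isOpen_bundleMeasure_lt_top hN.measurableSet h hu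
  exact ⟨O, mem_nhdsWithin_of_mem_nhds (hO.mem_nhds hwO), hfin⟩

end BundleMeasure

/-! ### Regular level sets -/

/-- Near a regular point, a level set is parametrized by the inverse of a linear projection. -/
lemma exists_levelSet_param {E H : Type*} [NormedAddCommGroup E] [NormedSpace ℝ E]
    [FiniteDimensional ℝ E] [NormedAddCommGroup H] [NormedSpace ℝ H] [FiniteDimensional ℝ H]
    {k : ℕ} {f : E → H} {U : Set E} (hU : IsOpen U) (hf : ContDiffOn ℝ ∞ f U) {a : E} (ha : a ∈ U)
    (hsurj : Function.Surjective (fderiv ℝ f a))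
    (hdim : Module.finrank ℝ E = Module.finrank ℝ H + k) :
    ∃ (U' : Set E) (W : Set (EuclideanSpace ℝ (Fin k))) (θ : EuclideanSpace ℝ (Fin k) → E)
      (π : E →L[ℝ] EuclideanSpace ℝ (Fin k)), IsOpen U' ∧ a ∈ U' ∧ U' ⊆ U ∧ IsOpen W ∧
      ContDiffOn ℝ ∞ θ W ∧ (∀ v ∈ W, θ v ∈ U' ∧ f (θ v) = f a ∧ π (θ v) = v) ∧
      ∀ x ∈ U', f x = f a → π x ∈ W ∧ θ (π x) = x := by
  have : CompleteSpace E := FiniteDimensional.complete ℝ E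
  have : CompleteSpace H := FiniteDimensional.complete ℝ H
  set T := fderiv ℝ f a with hT
  have hker : Module.finrank ℝ T.toLinearMap.ker = Module.finrank ℝ (EuclideanSpace ℝ (Fin k)) := by
    have h1 := T.toLinearMap.finrank_range_add_finrank_ker
    rw [LinearMap.range_eq_top.2 hsurj, finrank_top] at h1
    rw [finrank_euclideanSpace_fin]
    omega
  -- A projection onto the kernel of `T`, read in coordinates, completes `f` to a map `g = (f, π)`
  -- with invertible differential at `a`. The level set is then the slice with first component `f
  -- a`.
  obtain ⟨p, hp⟩ := T.toLinearMap.ker.subtype.exists_leftInverse_of_injective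
    (Submodule.ker_subtype _)
  let e : T.toLinearMap.ker ≃ₗ[ℝ] EuclideanSpace ℝ (Fin k) := LinearEquiv.ofFinrankEq _ _ hker
  let π : E →L[ℝ] EuclideanSpace ℝ (Fin k) := LinearMap.toContinuousLinearMap (e.toLinearMap ∘ₗ p)
  let g : E → H × EuclideanSpace ℝ (Fin k) := fun x => (f x, π x)
  have hg : ContDiffOn ℝ ∞ g U := hf.prodMk π.contDiff.contDiffOn
  have hga : ContDiffAt ℝ ∞ g a := hg.contDiffAt (hU.mem_nhds ha)
  have hfa : HasFDerivAt f T a :=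
    ((hf.contDiffAt (hU.mem_nhds ha)).differentiableAt (by simp)).hasFDerivAt
  have hinj : Function.Injective (T.prod π).toLinearMap := by
    refine LinearMap.ker_eq_bot.1 (LinearMap.ker_eq_bot'.2 fun x hx => ?_)
    have hx1 : T x = 0 := congrArg Prod.fst hx
    have hx2 : e (p x) = 0 := congrArg Prod.snd hx
    have hx3 : p x = ⟨x, hx1⟩ := LinearMap.congr_fun hp ⟨x, hx1⟩
    rw [hx3] at hx2
    have := e.map_eq_zero_iff.1 hx2
    exact congrArg Subtype.val this
  let D : E ≃L[ℝ] H × EuclideanSpace ℝ (Fin k) := (LinearEquiv.ofInjectiveOfFinrankEq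
    (T.prod π).toLinearMap hinj (by
      rw [hdim, Module.finrank_prod, finrank_euclideanSpace_fin])).toContinuousLinearEquiv
  have hgD : HasFDerivAt g (D : E →L[ℝ] H × EuclideanSpace ℝ (Fin k)) a := by
    refine (hfa.prodMk π.hasFDerivAt).congr_fderiv ?_
    ext1 x
    rfl
  let Φ := hga.toOpenPartialHomeomorph g hgD (by simp)
  have hΦ : ∀ x, Φ x = g x := fun x => rfl
  have haΦ : a ∈ Φ.source := hga.mem_toOpenPartialHomeomorph_source hgD (by simp)
  -- Restricting to points where the differential of `g` is invertible makes the inverse smooth on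
  -- the whole slice, not merely at the image of `a`.
  set U₁ : Set E := U ∩ fderiv ℝ g ⁻¹'
    range ((↑) : (E ≃L[ℝ] H × EuclideanSpace ℝ (Fin k)) → E →L[ℝ] H × EuclideanSpace ℝ (Fin k))
    with hU₁
  have hU₁o : IsOpen U₁ := (hg.continuousOn_fderiv_of_isOpen hU (by simp)).isOpen_inter_preimage hU
    (ContinuousLinearEquiv.isOpen)
  refine ⟨Φ.source ∩ U₁, {v | (f a, v) ∈ Φ.target ∩ Φ.symm ⁻¹' U₁}, fun v => Φ.symm (f a, v), π,
    Φ.open_source.inter hU₁o, ⟨haΦ, ha, D, hgD.fderiv.symm⟩, fun x hx => hx.2.1, ?_, ?_, ?_, ?_⟩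
  · exact (Φ.isOpen_inter_preimage_symm hU₁o).preimage (by fun_prop)
  · intro v hv
    obtain ⟨D', hD'⟩ := hv.2.2
    have hd : HasFDerivAt Φ (D' : E →L[ℝ] H × EuclideanSpace ℝ (Fin k)) (Φ.symm (f a, v)) := by
      rw [hD']
      exact ((hg.contDiffAt (hU.mem_nhds hv.2.1)).differentiableAt (by simp)).hasFDerivAt
    have h1 := Φ.contDiffAt_symm hv.1 hd (hg.contDiffAt (hU.mem_nhds hv.2.1))
    have h2 : ContDiffAt ℝ ∞ (fun v : EuclideanSpace ℝ (Fin k) => (f a, v)) v := by fun_prop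
    exact (ContDiffAt.comp v h1 h2).contDiffWithinAt
  · intro v hv
    have h1 : g (Φ.symm (f a, v)) = (f a, v) := Φ.right_inv hv.1
    exact ⟨⟨Φ.map_target hv.1, hv.2⟩, congrArg Prod.fst h1, congrArg Prod.snd h1⟩
  · intro x hx hfx
    have h1 : (f a, π x) = Φ x := by rw [hΦ, ← hfx]
    have h2 : Φ.symm (f a, π x) = x := by rw [h1]; exact Φ.left_inv hx.1
    refine ⟨⟨?_, ?_⟩, h2⟩
    · rw [h1]; exact Φ.map_source hx.1
    · rw [mem_preimage, h2]; exact hx.2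

/-! ### The energy sphere bundle is a submanifold -/

section Bundle

variable {n d : ℕ} {Γ : Set (Config n)} {V₁ : Config n → ℝ} {E₀ : ℝ}
  {W : Set (EuclideanSpace ℝ (Fin d))} {ψ : EuclideanSpace ℝ (Fin d) → Config n}

lemma IsLocalParam.mem_normalEnergyBundle_iff (h : IsLocalParam d Γ W ψ)
    {u : EuclideanSpace ℝ (Fin d)} (hu : u ∈ W) (hE : V₁ (ψ u) < E₀) (ξ : Config n) :
    (ψ u, ξ) ∈ normalEnergyBundle V₁ E₀ Γ ↔
      (∀ i, ⟪fderiv ℝ ψ u (EuclideanSpace.single i 1), ξ⟫_ℝ = 0) ∧ ‖ξ‖ ^ 2 + V₁ (ψ u) = E₀ := by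
  have h1 : ξ ∈ (tangentSpaceOf Γ (ψ u))ᗮ ↔
      ∀ i, ⟪fderiv ℝ ψ u (EuclideanSpace.single i 1), ξ⟫_ℝ = 0 := by
    rw [h.tangentSpaceOf_eq hu, Submodule.mem_orthogonal]
    refine ⟨fun hξ i => hξ _ ⟨_, rfl⟩, ?_⟩
    rintro hξ _ ⟨x, rfl⟩
    have hx : x = ∑ i, x i • EuclideanSpace.single i (1 : ℝ) := by
      simpa using ((EuclideanSpace.basisFun (Fin d) ℝ).sum_repr x).symm
    rw [ContinuousLinearMap.coe_coe, hx, map_sum, sum_inner]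
    exact Finset.sum_eq_zero fun i _ => by rw [map_smul, inner_smul_left, hξ i, mul_zero]
  have h2 : ‖ξ‖ = Real.sqrt (E₀ - V₁ (ψ u)) ↔ ‖ξ‖ ^ 2 + V₁ (ψ u) = E₀ := by
    rw [eq_comm, Real.sqrt_eq_iff_eq_sq (by linarith) (norm_nonneg _)]
    constructor <;> intro h <;> linarith
  simp only [normalEnergyBundle, mem_ofPred_eq, h1, h2]
  exact ⟨fun h => h.2, fun h' => ⟨h.mapsTo hu, h'⟩⟩

/-- The Gram matrix of an immersion is invertible: a tangent vector orthogonal to all coordinate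
vectors is orthogonal to itself. -/
lemma IsLocalParam.exists_inner_eq (h : IsLocalParam d Γ W ψ) {u : EuclideanSpace ℝ (Fin d)}
    (hu : u ∈ W) (v : Fin d → ℝ) :
    ∃ x, ∀ i, ⟪fderiv ℝ ψ u (EuclideanSpace.single i 1), fderiv ℝ ψ u x⟫_ℝ = v i := by
  let l : EuclideanSpace ℝ (Fin d) →ₗ[ℝ] (Fin d → ℝ) := LinearMap.pi fun i =>
    (innerₛₗ ℝ (fderiv ℝ ψ u (EuclideanSpace.single i 1))) ∘ₗ (fderiv ℝ ψ u).toLinearMap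
  have hl : ∀ x i, l x i = ⟪fderiv ℝ ψ u (EuclideanSpace.single i 1), fderiv ℝ ψ u x⟫_ℝ :=
    fun x i => rfl
  have hinj : Function.Injective l := by
    refine LinearMap.ker_eq_bot.1 (LinearMap.ker_eq_bot'.2 fun x hx => ?_)
    have hxs : x = ∑ i, x i • EuclideanSpace.single i (1 : ℝ) := by
      simpa using ((EuclideanSpace.basisFun (Fin d) ℝ).sum_repr x).symm
    have h1 : ⟪fderiv ℝ ψ u (∑ i, x i • EuclideanSpace.single i (1 : ℝ)), fderiv ℝ ψ u x⟫_ℝ = 0 := by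
      rw [map_sum, sum_inner]
      refine Finset.sum_eq_zero fun i _ => ?_
      rw [map_smul, inner_smul_left, ← hl, hx, Pi.zero_apply, mul_zero]
    rw [← hxs] at h1
    exact h.immersive u hu ((inner_self_eq_zero.1 h1).trans (map_zero _).symm)
  obtain ⟨x, hx⟩ := (LinearMap.injective_iff_surjective_of_finrank_eq_finrank (by simp)).1 hinj v
  exact ⟨x, fun i => by rw [← hl, hx]⟩

/-- The defining function of `N_E Γ` in the coordinates `(u, ξ)`. -/
noncomputable def bundleEquation (V₁ : Config n → ℝ) (ψ : EuclideanSpace ℝ (Fin d) → Config n)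
    (y : EuclideanSpace ℝ (Fin d) × Config n) : (Fin d → ℝ) × ℝ :=
  (fun i => ⟪fderiv ℝ ψ y.1 (EuclideanSpace.single i 1), y.2⟫_ℝ, ‖y.2‖ ^ 2 + V₁ (ψ y.1))

lemma IsLocalParam.contDiffOn_bundleEquation (h : IsLocalParam d Γ W ψ) (hV : ContDiff ℝ ∞ V₁) :
    ContDiffOn ℝ ∞ (bundleEquation V₁ ψ) (W ×ˢ univ) := by
  have h1 : ContDiffOn ℝ ∞ (fun y : EuclideanSpace ℝ (Fin d) × Config n => fderiv ℝ ψ y.1)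
      (W ×ˢ univ) :=
    (h.smooth.fderiv_of_isOpen h.isOpen_source (by simp)).comp contDiff_fst.contDiffOn
      fun y hy => hy.1
  have h2 : ContDiffOn ℝ ∞ (fun y : EuclideanSpace ℝ (Fin d) × Config n => ψ y.1) (W ×ˢ univ) :=
    h.smooth.comp contDiff_fst.contDiffOn fun y hy => hy.1
  refine ContDiffOn.prodMk (contDiffOn_pi.2 fun i => ?_) ?_
  · exact (h1.clm_apply contDiffOn_const).inner ℝ contDiff_snd.contDiffOn
  · exact (contDiff_snd.norm_sq ℝ).contDiffOn.add (hV.comp_contDiffOn h2)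

/-- Varying `ξ` alone is enough. A tangential variation prescribes the first `d` components and
leaves the energy unchanged, since `ξ` is normal; a multiple of `ξ` then adjusts the energy alone.
-/
lemma IsLocalParam.surjective_fderiv_bundleEquation (h : IsLocalParam d Γ W ψ)
    (hV : ContDiff ℝ ∞ V₁) {u : EuclideanSpace ℝ (Fin d)} (hu : u ∈ W) {ξ : Config n}
    (hξ : ∀ i, ⟪fderiv ℝ ψ u (EuclideanSpace.single i 1), ξ⟫_ℝ = 0) (hξ0 : ξ ≠ 0) :
    Function.Surjective (fderiv ℝ (bundleEquation V₁ ψ) (u, ξ)) := by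
  have hd : HasFDerivAt (bundleEquation V₁ ψ) (fderiv ℝ (bundleEquation V₁ ψ) (u, ξ)) (u, ξ) :=
    (((h.contDiffOn_bundleEquation hV).contDiffAt
      ((h.isOpen_source.prod isOpen_univ).mem_nhds ⟨hu, mem_univ _⟩)).differentiableAt
        (by simp)).hasFDerivAt
  have hline : ∀ η : Config n, fderiv ℝ (bundleEquation V₁ ψ) (u, ξ) (0, η) =
      (fun i => ⟪fderiv ℝ ψ u (EuclideanSpace.single i 1), η⟫_ℝ, 2 * ⟪ξ, η⟫_ℝ) := by
    intro η
    have hc : HasDerivAt (fun t : ℝ => ξ + t • η) η 0 := by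
      simpa using ((hasDerivAt_id' (0 : ℝ)).smul_const η).const_add ξ
    have hc' : HasDerivAt (fun t : ℝ => (u, ξ + t • η)) (0, η) 0 :=
      (hasDerivAt_const (0 : ℝ) u).prodMk hc
    have h1 : HasFDerivAt (bundleEquation V₁ ψ) (fderiv ℝ (bundleEquation V₁ ψ) (u, ξ))
        (u, ξ + (0 : ℝ) • η) := by simpa using hd
    have h2 := h1.comp_hasDerivAt (0 : ℝ) hc'
    refine h2.unique (HasDerivAt.prodMk (hasDerivAt_pi.2 fun i => ?_) ?_)
    · simpa using (hasDerivAt_const (0 : ℝ) (fderiv ℝ ψ u (EuclideanSpace.single i 1))).inner ℝ hc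
    · simpa using hc.norm_sq.add_const (V₁ (ψ u))
  rintro ⟨v, s⟩
  obtain ⟨x, hx⟩ := h.exists_inner_eq hu v
  have hxξ : ⟪ξ, fderiv ℝ ψ u x⟫_ℝ = 0 := by
    have hxs : x = ∑ i, x i • EuclideanSpace.single i (1 : ℝ) := by
      simpa using ((EuclideanSpace.basisFun (Fin d) ℝ).sum_repr x).symm
    rw [hxs, map_sum, inner_sum]
    refine Finset.sum_eq_zero fun i _ => ?_
    rw [map_smul, inner_smul_right, real_inner_comm, hξ i, mul_zero]
  refine ⟨(0, fderiv ℝ ψ u x + (s / (2 * ‖ξ‖ ^ 2)) • ξ), ?_⟩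
  rw [hline]
  refine Prod.ext (funext fun i => ?_) ?_
  · simp only [inner_add_right, inner_smul_right, hξ i, mul_zero, add_zero, hx i]
  · simp only [inner_add_right, inner_smul_right, hxξ, zero_add, real_inner_self_eq_norm_sq]
    have := norm_ne_zero_iff.2 hξ0
    field_simp

/-- In coordinates `(u, ξ)` the bundle is a level set of `d + 1` equations in `d + n` unknowns,
regular because `V₁ < E₀` excludes `ξ = 0`. -/
theorem isSubmanifold_normalEnergyBundle (hd : d < n) (hΓ : IsSubmanifold d Γ)
    (hV : ContDiff ℝ ∞ V₁) (hE : ∀ z ∈ Γ, V₁ z < E₀) :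
    IsSubmanifold (n - 1) (normalEnergyBundle V₁ E₀ Γ) := by
  rintro ⟨z, ξ⟩ hw
  obtain ⟨W, ψ, h, u, hu, rfl⟩ := hΓ z hw.1
  have hiff : ∀ u ∈ W, ∀ ξ, (ψ u, ξ) ∈ normalEnergyBundle V₁ E₀ Γ ↔
      bundleEquation V₁ ψ (u, ξ) = (0, E₀) := by
    intro u hu ξ
    rw [h.mem_normalEnergyBundle_iff hu (hE _ (h.mapsTo hu)), bundleEquation, Prod.mk.injEq,
      funext_iff]
    rfl
  have hwu := (h.mem_normalEnergyBundle_iff hu (hE _ hw.1) ξ).1 hw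
  have hξ0 : ξ ≠ 0 := by
    rintro rfl
    have := hE _ hw.1
    simp only [norm_zero] at hwu
    linarith [hwu.2]
  have hdim : Module.finrank ℝ (EuclideanSpace ℝ (Fin d) × Config n) =
      Module.finrank ℝ ((Fin d → ℝ) × ℝ) + (n - 1) := by
    simp; omega
  obtain ⟨U, W', θ, π, hUo, haU, hUW, hW'o, hθ, hθU, hUθ⟩ := exists_levelSet_param
    (h.isOpen_source.prod isOpen_univ) (h.contDiffOn_bundleEquation hV) ⟨hu, mem_univ _⟩
    (h.surjective_fderiv_bundleEquation hV hu hwu.1 hξ0) hdim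
  rw [(hiff u hu ξ).1 hw] at hθU hUθ
  have hθW : ∀ v ∈ W', (θ v).1 ∈ W := fun v hv => (hUW (hθU v hv).1).1
  have hθd : ∀ v ∈ W', HasFDerivAt θ (fderiv ℝ θ v) v := fun v hv =>
    ((hθ.contDiffAt (hW'o.mem_nhds hv)).differentiableAt (by simp)).hasFDerivAt
  obtain ⟨OW, hOW, hOWe⟩ := h.isOpen_image W subset_rfl h.isOpen_source
  have hself := hUθ _ haU ((hiff u hu ξ).1 hw)
  refine ⟨W', fun v => (ψ (θ v).1, (θ v).2), ⟨hW'o, ?_, ?_, ?_, ?_, ?_⟩, π (u, ξ), hself.1, ?_⟩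
  · exact (h.smooth.comp (contDiff_fst.comp_contDiffOn hθ) hθW).prodMk
      (contDiff_snd.comp_contDiffOn hθ)
  · intro v hv
    have h1 : HasFDerivAt (fun v => ψ (θ v).1) _ v :=
      (h.hasFDerivAt (hθW v hv)).comp v (hθd v hv).fst
    rw [(h1.prodMk (hθd v hv).snd).fderiv]
    refine (injective_iff_map_eq_zero _).2 fun x hx => ?_
    have hx1 : fderiv ℝ ψ (θ v).1 (fderiv ℝ θ v x).1 = 0 := congrArg Prod.fst hx
    have hx2 : (fderiv ℝ θ v x).2 = 0 := congrArg Prod.snd hx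
    have hx3 : (fderiv ℝ θ v x).1 = 0 :=
      h.immersive _ (hθW v hv) (hx1.trans (map_zero _).symm)
    have hx4 : fderiv ℝ θ v x = 0 := Prod.ext hx3 hx2
    have h2 : HasFDerivAt (fun v => π (θ v)) (π.comp (fderiv ℝ θ v)) v :=
      π.hasFDerivAt.comp v (hθd v hv)
    have h3 : HasFDerivAt (fun v => π (θ v)) (ContinuousLinearMap.id ℝ _) v := by
      refine (hasFDerivAt_id v).congr_of_eventuallyEq ?_
      filter_upwards [hW'o.mem_nhds hv] with v' hv'
      exact (hθU v' hv').2.2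
    have h4 := congrArg (fun L => L x) (h2.unique h3)
    simpa [hx4] using h4.symm
  · intro v hv v' hv' he
    obtain ⟨he1, he2⟩ := Prod.mk.inj he
    have h1 : θ v = θ v' := Prod.ext (h.injOn (hθW v hv) (hθW v' hv') he1) he2
    rw [← (hθU v hv).2.2, h1, (hθU v' hv').2.2]
  · intro v hv
    exact (hiff _ (hθW v hv) _).2 (hθU v hv).2.1
  · intro W'' hW'' hW''o
    set B : Set (EuclideanSpace ℝ (Fin d) × Config n) := U ∩ π ⁻¹' W'' with hB
    have hBo : IsOpen B := hUo.inter (hW''o.preimage π.continuous)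
    -- An open set of pairs `(u, ξ)` has to be transferred to pairs `(z, ξ)`: `O` is the union of
    -- the open boxes whose part over the chart lies in `B`, and `isOpen_image` shows that it
    -- reaches all of `B`.
    let O : Set (Phase n) := {w | ∃ O₁ : Set (Config n), ∃ B₁ : Set (Config n), IsOpen O₁ ∧
      IsOpen B₁ ∧ w.1 ∈ O₁ ∧ w.2 ∈ B₁ ∧ ∀ u ∈ W, ψ u ∈ O₁ → ∀ ξ ∈ B₁, (u, ξ) ∈ B}
    have hO : IsOpen O := by
      refine isOpen_iff_mem_nhds.2 ?_
      rintro ⟨z, η⟩ ⟨O₁, B₁, hO₁, hB₁, hz, hη, hsub⟩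
      filter_upwards [(hO₁.prod hB₁).mem_nhds ⟨hz, hη⟩] with w hw
      exact ⟨O₁, B₁, hO₁, hB₁, hw.1, hw.2, hsub⟩
    have hOB : ∀ u ∈ W, ∀ ξ, (ψ u, ξ) ∈ O ↔ (u, ξ) ∈ B := by
      intro u hu ξ
      constructor
      · rintro ⟨O₁, B₁, -, -, hz, hη, hsub⟩
        exact hsub u hu hz ξ hη
      · intro hmem
        obtain ⟨W₁, B₁, hW₁, hB₁, huW₁, hξB₁, hprod⟩ := isOpen_prod_iff.1 hBo u ξ hmem
        obtain ⟨O₁, hO₁, hO₁e⟩ := h.isOpen_image (W₁ ∩ W) inter_subset_right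
          (hW₁.inter h.isOpen_source)
        refine ⟨O₁, B₁, hO₁, hB₁, (hO₁e.subset ⟨u, ⟨huW₁, hu⟩, rfl⟩).2, hξB₁, ?_⟩
        intro u' hu' hu'O ξ' hξ'
        obtain ⟨u'', hu'', he⟩ := hO₁e.symm.subset ⟨h.mapsTo hu', hu'O⟩
        rw [← h.injOn hu''.2 hu' he]
        exact hprod ⟨hu''.1, hξ'⟩
    refine ⟨O ∩ OW ×ˢ univ, hO.inter (hOW.prod isOpen_univ), ?_⟩
    ext ⟨z, η⟩
    constructor
    · rintro ⟨v, hv, he⟩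
      rw [← he]
      have h1 := hθU v (hW'' hv)
      refine ⟨(hiff _ (hθW v (hW'' hv)) _).2 h1.2.1, (hOB _ (hθW v (hW'' hv)) _).2 ⟨h1.1, ?_⟩,
        (hOWe.subset ⟨_, hθW v (hW'' hv), rfl⟩).2, mem_univ _⟩
      rw [mem_preimage, Prod.mk.eta, h1.2.2]
      exact hv
    · rintro ⟨hN, hzO, hzW, -⟩
      obtain ⟨u', hu', rfl⟩ := hOWe.symm.subset ⟨hN.1, hzW⟩
      have h1 := (hOB u' hu' η).1 hzO
      have h2 := hUθ _ h1.1 ((hiff u' hu' η).1 hN)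
      refine ⟨π (u', η), h1.2, ?_⟩
      simp only [h2.2]
  · simp only [hself.2]

/-- The part of `N_E Γ` which lies over a compact subset of `Γ` is compact. -/
lemma isCompact_normalEnergyBundle_inter (hΓ : IsSubmanifold d Γ) (hV : Continuous V₁)
    (hE : ∀ z ∈ Γ, V₁ z < E₀) {C : Set (Config n)} (hC : IsCompact C) (hCΓ : C ⊆ Γ) :
    IsCompact (normalEnergyBundle V₁ E₀ Γ ∩ Prod.fst ⁻¹' C) := by
  have hcl : IsClosed (normalEnergyBundle V₁ E₀ Γ ∩ Prod.fst ⁻¹' C) := by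
    refine isClosed_of_closure_subset fun w hw => ?_
    obtain ⟨x, hx, hlim⟩ := mem_closure_iff_seq_limit.1 hw
    obtain ⟨z, ξ⟩ := w
    have hlim1 : Tendsto (fun k => (x k).1) atTop (𝓝 z) := (continuous_fst.tendsto _).comp hlim
    have hlim2 : Tendsto (fun k => (x k).2) atTop (𝓝 ξ) := (continuous_snd.tendsto _).comp hlim
    have hzC : z ∈ C := hC.isClosed.mem_of_tendsto hlim1 (Eventually.of_forall fun k => (hx k).2)
    -- The limit point lies over `C ⊆ Γ`, so a chart is available there, and the defining equations
    -- pass to the limit because the differential of `ψ` is continuous.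
    obtain ⟨W, ψ, h, u, hu, rfl⟩ := hΓ z (hCΓ hzC)
    obtain ⟨r, O, hO, hzO, hr, hru, hinv⟩ := h.exists_localInverse hu
    refine ⟨(h.mem_normalEnergyBundle_iff hu (hE _ (hCΓ hzC)) ξ).2 ?_, hzC⟩
    have hxk : ∀ᶠ k in atTop, (∀ i, ⟪fderiv ℝ ψ (r (x k).1) (EuclideanSpace.single i 1),
        (x k).2⟫_ℝ = 0) ∧ ‖(x k).2‖ ^ 2 + V₁ (x k).1 = E₀ := by
      filter_upwards [hlim1.eventually_mem (hO.mem_nhds hzO)] with k hk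
      have h1 := hinv _ ⟨(hx k).1.1, hk⟩
      have h2 : (ψ (r (x k).1), (x k).2) ∈ normalEnergyBundle V₁ E₀ Γ := by
        rw [h1.2]; exact (hx k).1
      have h3 := (h.mem_normalEnergyBundle_iff h1.1 (hE _ (h.mapsTo h1.1)) _).1 h2
      rw [h1.2] at h3
      exact h3
    have hrlim : Tendsto (fun k => fderiv ℝ ψ (r (x k).1)) atTop (𝓝 (fderiv ℝ ψ u)) := by
      have h1 : ContinuousAt (fderiv ℝ ψ) u :=
        (h.smooth.continuousOn_fderiv_of_isOpen h.isOpen_source (by simp)).continuousAt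
          (h.isOpen_source.mem_nhds hu)
      have h2 : Tendsto r (𝓝 (ψ u)) (𝓝 u) := by
        simpa only [ContinuousAt, hru] using (hr _ hzO).continuousAt
      exact h1.tendsto.comp (h2.comp hlim1)
    refine ⟨fun i => ?_, ?_⟩
    · have h1 := (((ContinuousLinearMap.apply ℝ (Config n)
        (EuclideanSpace.single i 1)).continuous.tendsto _).comp hrlim).inner (𝕜 := ℝ) hlim2
      exact tendsto_nhds_unique h1 (tendsto_const_nhds.congr'
        (hxk.mono fun k hk => (hk.1 i).symm))
    · have h1 := (hlim2.norm.pow 2).add ((hV.tendsto _).comp hlim1)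
      exact tendsto_nhds_unique h1 (tendsto_const_nhds.congr' (hxk.mono fun k hk => hk.2.symm))
  obtain ⟨B, hB⟩ := hC.exists_bound_of_continuousOn
    (f := fun z => Real.sqrt (E₀ - V₁ z)) (by fun_prop)
  refine (hC.prod (isCompact_closedBall (0 : Config n) B)).of_isClosed_subset hcl ?_
  rintro ⟨z, ξ⟩ ⟨hN, hz⟩
  refine ⟨hz, mem_closedBall_zero_iff.2 ?_⟩
  rw [hN.2.2]
  exact (le_abs_self _).trans (hB z hz)

end Bundle

/-! ### The source term -/

section Source

variable {n d : ℕ} {V₁ V₂ : Config n → ℝ} {E₀ : ℝ} {Γ₂ Γ : Set (Config n)} {A : Config n → ℂ}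

lemma continuous_fourierHat (S : 𝓢(Config n, ℂ)) : Continuous (fourierHat S) := by
  refine continuous_of_dominated (bound := fun x => ‖S x‖) (fun ξ => ?_)
    (fun ξ => Eventually.of_forall fun x => ?_) S.integrable.norm
    (Eventually.of_forall fun x => by fun_prop)
  · have := S.continuous
    exact Continuous.aestronglyMeasurable (by fun_prop)
  · rw [norm_mul, Complex.norm_exp]
    simp

lemma sourceDensity_nonneg (d : ℕ) (A : Config n → ℂ) (S : 𝓢(Config n, ℂ)) (w : Phase n) :
    0 ≤ sourceDensity d A S w := by
  have := Real.pi_pos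
  unfold sourceDensity
  positivity

lemma continuousOn_sourceDensity (hΓ₂ : IsSubmanifold d Γ₂) (hA : SmoothOnSubmanifold d Γ₂ A)
    (S : 𝓢(Config n, ℂ)) (hΓ : Γ ⊆ Γ₂) (hE : ∀ z ∈ Γ, V₁ z < E₀) :
    ContinuousOn (sourceDensity d A S) (normalEnergyBundle V₁ E₀ Γ) := by
  have h1 : ContinuousOn (fun w : Phase n => A w.1) (normalEnergyBundle V₁ E₀ Γ) :=
    (hA.continuousOn hΓ₂).comp continuousOn_fst fun w hw => hΓ hw.1
  have h2 : ContinuousOn (fun w : Phase n => ‖w.2‖⁻¹) (normalEnergyBundle V₁ E₀ Γ) := by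
    refine continuousOn_snd.norm.inv₀ fun w hw => ?_
    rw [hw.2.2]
    exact (Real.sqrt_pos.2 (sub_pos.2 (hE _ hw.1))).ne'
  have h3 : ContinuousOn (fun w : Phase n => fourierHat S w.2) (normalEnergyBundle V₁ E₀ Γ) :=
    ((continuous_fourierHat S).comp continuous_snd).continuousOn
  exact ((continuousOn_const.mul (h1.norm.pow 2)).mul h2).mul (h3.norm.pow 2)

/-- On the bundle, the density vanishes off the part lying over the closure of the support of `A`.
This part is compact, so it has finite measure and the density, continuous on the bundle, is bounded
there. -/
lemma integrable_sourceDensity (hd : d < n) (hV : ContDiff ℝ ∞ V₁) (hΓ₂ : IsSubmanifold d Γ₂)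
    (hΓ₂_bdd : Bornology.IsBounded Γ₂) (hA : SmoothOnSubmanifold d Γ₂ A) (S : 𝓢(Config n, ℂ))
    (hΓ_open : ∃ O : Set (Config n), IsOpen O ∧ Γ = Γ₂ ∩ O)
    (hA_supp : closure (Γ₂ ∩ Function.support A) ⊆ Γ) (hE : ∀ z ∈ Γ, V₁ z < E₀) :
    SigmaFinite (bundleMeasure V₁ E₀ Γ) ∧
      Integrable (fun w => (sourceDensity d A S w : ℂ)) (bundleMeasure V₁ E₀ Γ) := by
  have hsub : Γ ⊆ Γ₂ := by
    obtain ⟨O, -, rfl⟩ := hΓ_open; exact inter_subset_left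
  have hΓ : IsSubmanifold d Γ := by
    obtain ⟨O, hO, rfl⟩ := hΓ_open; exact hΓ₂.inter hO
  have hN := isSubmanifold_normalEnergyBundle hd hΓ hV hE
  have hNm := hN.measurableSet
  have hC : IsCompact (closure (Γ₂ ∩ Function.support A)) :=
    (hΓ₂_bdd.subset inter_subset_left).isCompact_closure
  set K := normalEnergyBundle V₁ E₀ Γ ∩ Prod.fst ⁻¹' closure (Γ₂ ∩ Function.support A) with hK
  have hKc : IsCompact K := isCompact_normalEnergyBundle_inter hΓ hV.continuous hE hC hA_supp
  have hcont := continuousOn_sourceDensity hΓ₂ hA S hsub hE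
  have hae : ∀ᵐ w ∂(bundleMeasure V₁ E₀ Γ), w ∈ normalEnergyBundle V₁ E₀ Γ := by
    rw [ae_iff]; exact bundleMeasure_compl hNm
  have hmeas : AEStronglyMeasurable (sourceDensity d A S) (bundleMeasure V₁ E₀ Γ) := by
    rw [← Measure.restrict_eq_self_of_ae_mem hae]
    exact hcont.aestronglyMeasurable hNm
  obtain ⟨B, hB⟩ := hKc.exists_bound_of_continuousOn (hcont.mono inter_subset_left)
  have hint : IntegrableOn (sourceDensity d A S) K (bundleMeasure V₁ E₀ Γ) :=
    Measure.integrableOn_of_bounded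
      (bundleMeasure_lt_top_of_isCompact hN hKc inter_subset_left).ne hmeas
      ((ae_restrict_mem hKc.isClosed.measurableSet).mono hB)
  refine ⟨sigmaFinite_bundleMeasure hN, Integrable.ofReal ?_⟩
  refine hint.integrable_of_ae_notMem_eq_zero ?_
  filter_upwards [hae] with w hw hwK
  have h1 : A w.1 = 0 := by
    by_contra hne
    exact hwK ⟨hw, subset_closure ⟨hsub hw.1, hne⟩⟩
  simp [sourceDensity, h1]

end Source

lemma im_nonneg_of_isLittleO {E : ℝ → ℂ} {E₀ : ℝ} {E₁ : ℂ}
    (hE_im : ∀ h ∈ Ioc (0 : ℝ) 1, 0 ≤ (E h).im)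
    (hE : (fun h : ℝ => E h - ((E₀ : ℂ) + (h : ℂ) * E₁)) =o[𝓝[>] (0 : ℝ)] fun h : ℝ => h) :
    0 ≤ E₁.im := by
  by_contra! hneg
  -- With this error constant, and since `E₀` is real, `Im E_h ≤ h Im E₁ / 2 < 0` for small `h`.
  have h1 := (isLittleO_iff.1 hE) (c := -E₁.im / 2) (by linarith)
  obtain ⟨h, hh, hmem⟩ := (h1.and (Ioc_mem_nhdsGT one_pos)).exists
  have h2 := hE_im h hmem
  have h3 := (Complex.abs_im_le_norm _).trans hh
  simp only [Complex.sub_im, Complex.add_im, Complex.ofReal_im, Complex.mul_im, Complex.ofReal_re,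
    zero_mul, add_zero, zero_add, Real.norm_eq_abs, abs_of_pos hmem.1] at h3
  have h4 := (le_abs_self _).trans h3
  nlinarith [hmem.1]

/-- The single aperture `σ = 1/2` of property (ii) suffices, as it matches the escape estimate. The
strict inequality `R₀ < ‖x‖` makes the set open, so that test functions detect its measure. -/
lemma HasSemiclassicalProperties.measure_incoming {n d : ℕ} {V₁ V₂ : Config n → ℝ} {E₀ : ℝ}
    {E₁ : ℂ} {Γ : Set (Config n)} {A : Config n → ℂ} {S : 𝓢(Config n, ℂ)}
    {ν : Measure (Phase n)} [IsLocallyFiniteMeasure ν]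
    (hν : HasSemiclassicalProperties V₁ V₂ E₀ E₁ Γ d A S ν) :
    ∃ R₀ : ℝ, ν {w | R₀ < ‖w.1‖ ∧ ⟪w.1, w.2⟫_ℝ < -(1 / 2) * ‖w.1‖ * ‖w.2‖} = 0 := by
  obtain ⟨R, -, hR⟩ := hν.incoming (1 / 2) (by norm_num)
  refine ⟨R, measure_eq_zero_of_forall_integral_eq_zero ?_ fun q hq hqU => hR q hq
    (hqU.trans fun w hw => ⟨hw.1.le, hw.2⟩)⟩
  have h1 : Continuous fun w : Phase n => ‖w.1‖ := by fun_prop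
  have h2 : Continuous fun w : Phase n => ⟪w.1, w.2⟫_ℝ := by fun_prop
  have h3 : Continuous fun w : Phase n => -(1 / 2) * ‖w.1‖ * ‖w.2‖ := by fun_prop
  exact (isOpen_lt continuous_const h1).inter (isOpen_lt h2 h3)

theorem mainTheorem2 (n d : ℕ) (hd : d < n)
    -- the potentials
    (V₁ V₂ : Config n → ℝ) (ρ : ℝ) (hρ : 0 < ρ)
    (hV₁ : SymbolDecay ρ V₁) (hV₂ : SymbolDecay ρ V₂) (hV₂_nonneg : ∀ x, 0 ≤ V₂ x)
    -- the energies `E_h = E₀ + h E₁ + o(h)`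
    (E : ℝ → ℂ) (E₀ : ℝ) (E₁ : ℂ) (hE₀ : 0 < E₀)
    (hE_im : ∀ h ∈ Ioc (0 : ℝ) 1, 0 ≤ (E h).im)
    (hE : (fun h : ℝ => E h - ((E₀ : ℂ) + (h : ℂ) * E₁)) =o[𝓝[>] (0 : ℝ)] fun h : ℝ => h)
    (htrap : TrappedMeetsAbsorption V₁ V₂ E₀)
    -- the submanifold and the source
    (Γ₂ Γ : Set (Config n)) (hΓ₂ : IsSubmanifold d Γ₂) (hΓ₂_bdd : Bornology.IsBounded Γ₂)
    (A : Config n → ℂ) (hA : SmoothOnSubmanifold d Γ₂ A) (S : 𝓢(Config n, ℂ))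
    (hΓ_open : ∃ O : Set (Config n), IsOpen O ∧ Γ = Γ₂ ∩ O)
    (hΓ_closure : closure Γ ⊆ Γ₂)
    (hA_supp : closure (Γ₂ ∩ Function.support A) ⊆ Γ)
    (hΓ_energy : ∀ z ∈ closure Γ, V₁ z < E₀)
    (hreturn : bundleMeasure V₁ E₀ Γ (returnSet V₁ E₀ Γ) = 0) :
    -- the explicit formula
    (∀ ν : Measure (Phase n), IsLocallyFiniteMeasure ν →
      HasSemiclassicalProperties V₁ V₂ E₀ E₁ Γ d A S ν →
      ∀ q : Phase n → ℂ, IsTestFunction q →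
        (∀ t : ℝ, 0 ≤ t →
          Integrable (propagatedIntegrand V₁ V₂ E₁ d A S q t) (bundleMeasure V₁ E₀ Γ)) ∧
        IntegrableOn (fun t : ℝ =>
          ∫ w, propagatedIntegrand V₁ V₂ E₁ d A S q t w ∂(bundleMeasure V₁ E₀ Γ)) (Ioi 0) ∧
        ∫ w, q w ∂ν = ∫ t in Ioi (0 : ℝ),
          ∫ w, propagatedIntegrand V₁ V₂ E₁ d A S q t w ∂(bundleMeasure V₁ E₀ Γ)) ∧
    -- uniqueness
    (∀ ν ν' : Measure (Phase n), IsLocallyFiniteMeasure ν → IsLocallyFiniteMeasure ν' →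
      HasSemiclassicalProperties V₁ V₂ E₀ E₁ Γ d A S ν →
      HasSemiclassicalProperties V₁ V₂ E₀ E₁ Γ d A S ν' → ν = ν') := by
  have hb : 0 ≤ E₁.im := im_nonneg_of_isLittleO hE_im hE
  have hΓE : ∀ z ∈ Γ, V₁ z < E₀ := fun z hz => hΓ_energy z (subset_closure hz)
  obtain ⟨hσ, hc⟩ := integrable_sourceDensity hd hV₁.1 hΓ₂ hΓ₂_bdd hA S hΓ_open hA_supp hΓE
  obtain ⟨L₂, hL₂⟩ := hV₂.lipschitzWith hρ
  have hprop : ∀ q t w, propagatedIntegrand V₁ V₂ E₁ d A S q t w =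
      (sourceDensity d A S w : ℂ) * dampedPullback V₁ V₂ E₁.im q t w := fun q t w => by
    rw [propagatedIntegrand, dampedPullback, absorption, mul_assoc]
  have main : ∀ ν : Measure (Phase n), IsLocallyFiniteMeasure ν →
      HasSemiclassicalProperties V₁ V₂ E₀ E₁ Γ d A S ν → ∀ q : Phase n → ℂ, IsTestFunction q →
        (∀ t : ℝ, 0 ≤ t →
          Integrable (propagatedIntegrand V₁ V₂ E₁ d A S q t) (bundleMeasure V₁ E₀ Γ)) ∧
        IntegrableOn (fun t : ℝ =>
          ∫ w, propagatedIntegrand V₁ V₂ E₁ d A S q t w ∂(bundleMeasure V₁ E₀ Γ)) (Ioi 0) ∧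
        ∫ w, q w ∂ν = ∫ t in Ioi (0 : ℝ),
          ∫ w, propagatedIntegrand V₁ V₂ E₁ d A S q t w ∂(bundleMeasure V₁ E₀ Γ) := by
    intro ν hνf hν q hq
    obtain ⟨R₀, hR₀⟩ := hν.measure_incoming
    -- Lipschitz continuity and compact support are all that the explicit formula requires of `q`.
    obtain ⟨L, hL⟩ := hq.1.lipschitzWith_of_hasCompactSupport hq.2 (by simp)
    refine ⟨fun t ht => ?_, ?_⟩
    · exact (integrable_mul_dampedPullback hρ hV₁ hL₂.continuous hV₂_nonneg hb hc hq.1.continuous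
        hq.2 ht).congr (Eventually.of_forall fun w => (hprop q t w).symm)
    · simp only [hprop]
      exact integral_eq_integral_Ioi hρ hV₁ hL₂ hV₂_nonneg hE₀ htrap hb
        (sourceDensity_nonneg d A S) hc hν.support_energy hR₀ hν.liouville hL hq.2
  refine ⟨main, fun ν ν' hνf hνf' hν hν' => ?_⟩
  exact eq_of_forall_integral_testFunction_eq fun q hq =>
    (main ν hνf hν q hq).2.2.trans (main ν' hνf' hν' q hq).2.2.symm
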